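/- **Setting.** All objects are smooth ($C^\infty$). Let $M$, $N$ be (non-empty) manifolds, $1\le p<n=\dim N<m=\dim M$, and let $\Pi\colon M\to N$ be a smooth surjective submersion. Let a Lie group $G$ act, possibly only locally, on $M$, and let the action be $\Pi$-projectable: every $g\in G$ maps each fiber $\Pi^{-1}\{w\}$ (where $g$ is defined on it) into a fiber of $\Pi$. Then $g$ induces the (local) transformation $g\cdot w=\Pi(g\cdot \Pi^{-1}\{w\})$ of $N$; the transformations so obtained are those of the quotient $[G]$ of $G$ by the elements acting trivially on $N$. For $0\le k\le\infty$ let $J^k(\cdot,p)$ be the bundle of $k$-jets (classes under $k$-th order contact) of $p$-dimensional immersed submanifolds, with projections $\pi^l_k$, and let $\Phi^{(k)}\colon j_kS|_z\mapsto j_k\Phi(S)|_{\Phi(z)}$ denote the prolongation of a smooth map $\Phi$, defined on jets of submanifolds $S$ that $\Phi$ immerses (for $\Phi=\Pi$, $k\ge1$: those transverse to the fibers of $\Pi$). A differential function of order $k<\infty$ is a smooth function on an open subset of $J^k$; a differential function on an open subset of $J^\infty$ is one that is locally of finite order. Contact forms are the one-forms on $J^\infty$ that vanish on the prolongation of every $p$-dimensional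 submanifold; $\equiv$ denotes equality modulo contact forms. Fix local coordinates $(x,u)=(x^1,\dots,x^p,u^1,\dots,u^{m-p})$ on $M$ and $(y,v)=(y^1,\dots,y^p,v^1,\dots,v^{n-p})$ on $N$, and consider jets of graphs $u=u(x)$, $v=v(y)$. Horizontal one-forms are the combinations of the $dx^i$ (resp. $dy^i$) with differential functions as coefficients, $\pi_H$ is the projection of one-forms to their horizontal component along contact forms, and $d_HF=\pi_H(dF)=\sum_i(D_iF)\,dx^i$ with the total derivatives $D_i$. A contact-invariant horizontal coframe, for a group of transformations, on an open set of jets in such a coordinate domain is a pointwise linearly independent family of $p$ horizontal one-forms $\omega^i$ with $(g^{(\infty)})^*\omega^i\equiv\omega^i$ for all $g$, at every jet of the set that $g^{(\infty)}$ maps into the set. The dual operators are defined by $d_HF=\sum_j(\mathcal D_jF)\,\omega^j$ for all differential functions $F$ on open subsets of the set. **Theorem.** Let $\omega^i=\sum_jQ^i_j\,dy^j$, $i=1,\dots,p$, be a $[G]$-contact-invariant horizontal coframe on an open set $V\subset J^\infty(N,p)$, with dual operators $\mathcal D_1,\dots,\mathcal D_p$. Put $\widehat\omega^i=\pi_H\bigl((\Pi^{(\infty)})^*\omega^i\bigr)$,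 and let $U\subset J^\infty(M,p)$ be the set of jets of graphs $u=u(x)$ in the domain of $\Pi^{(\infty)}$ that $\Pi^{(\infty)}$ maps into $V$ and at which the non-singularity condition $\det(D_i\Pi^k)_{1\le i,k\le p}\ne0$, $\Pi^k=y^k\circ\Pi$, holds. Then: 1. $U$ is open, $\widehat\omega^i\equiv(\Pi^{(\infty)})^*\omega^i$ on $U$, and $\widehat\omega^1,\dots,\widehat\omega^p$ is a $G$-contact-invariant horizontal coframe on $U$. 2. Operators $\widehat{\mathcal D}_1,\dots,\widehat{\mathcal D}_p$ dual to it, $d_H\widehat F=\sum_j(\widehat{\mathcal D}_j\widehat F)\,\widehat\omega^j$, exist. They map differential functions to differential functions and $G$-invariant ones to $G$-invariant ones. 3. For every differential function $F$ on an open subset $W$ of $V$, $\widehat{\mathcal D}_i(F\circ\Pi^{(\infty)})=(\mathcal D_iF)\circ\Pi^{(\infty)}$ at all jets of $U$ over $W$. If $F$ is a differential function of finite order $k$ on an open set $W\subset J^k(N,p)$, and the coframe $\omega^i$ is of order at most $l$, where $l\ge k+1$ (i.e. $V$ is the preimage of an open subset of $J^l(N,p)$ on which the $Q^i_j$ are smooth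 functions), then on the part of $V$ over $W$ each $\mathcal D_iF$ is a differential function of order $l$, and $\widehat{\mathcal D}_i(F\circ\Pi^{(k)})=(\mathcal D_iF)\circ\Pi^{(l)}$ at the jets of $U$ over $W$; in particular, for $l=k+1$, $$\widehat{\mathcal D}_i(F\circ\Pi^{(k)})=(\mathcal D_iF)\circ\Pi^{(k+1)}.$$ 4. For every $0\le k<\infty$ and every open $W\subset J^k(N,p)$, the map $I\mapsto I\circ\Pi^{(k)}$ is an isomorphism of $\mathbb R$-algebras from the differential invariants of $[G]$ on $W$ onto those differential invariants of $G$ on $(\Pi^{(k)})^{-1}(W)$ that are constant on the fibers of $\Pi^{(k)}$. -/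

import Mathlib

open scoped Manifold ContDiff Topology

noncomputable section

/-- The coordinate space with `p` independent variables `x` and `q` dependent variables `u`. A manifold
of dimension `p + q` is a manifold modelled on this space. -/
abbrev Coord (p q : ℕ) : Type := (Fin p → ℝ) × (Fin q → ℝ)

/-! ### Jets of `p`-dimensional submanifolds -/

section Jets

variable {p q : ℕ} {M : Type*} [TopologicalSpace M] [ChartedSpace (Coord p q) M]

/-- `f` is a local parametrization, near `0 ∈ ℝ^p`, of an immersed `p`-dimensional submanifold. -/
def IsImmersionGerm (f : (Fin p → ℝ) → M) : Prop :=
  (∀ᶠ t in 𝓝 0, ContMDiffAt 𝓘(ℝ, Fin p → ℝ) 𝓘(ℝ, Coord p q) ∞ f t) ∧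
    Function.Injective (mfderiv 𝓘(ℝ, Fin p → ℝ) 𝓘(ℝ, Coord p q) f 0)

variable (p q M) in
/-- Parametrized germs of immersed `p`-dimensional submanifolds. -/
def ImmersionGerm : Type _ := {f : (Fin p → ℝ) → M // IsImmersionGerm (q := q) f}

/-- The maps `f` and `g` have the same derivatives at `0` up to order `k` in local coordinates. -/
def SameDerivs (q : ℕ) [ChartedSpace (Coord p q) M] (k : ℕ) (f g : (Fin p → ℝ) → M) : Prop :=
  f 0 = g 0 ∧ ∀ i ≤ k,
    iteratedFDeriv ℝ i (extChartAt 𝓘(ℝ, Coord p q) (f 0) ∘ f) 0 =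
      iteratedFDeriv ℝ i (extChartAt 𝓘(ℝ, Coord p q) (f 0) ∘ g) 0

/-- The submanifolds parametrized by `f` and `g` have `k`-th order contact at the point with
parameter `0`: after a local reparametrization they agree up to order `k`. -/
def HasContact (k : ℕ) (f g : ImmersionGerm p q M) : Prop :=
  ∃ φ : OpenPartialHomeomorph (Fin p → ℝ) (Fin p → ℝ),
    (0 : Fin p → ℝ) ∈ φ.source ∧ φ 0 = 0 ∧
      ContDiffOn ℝ ∞ φ φ.source ∧ ContDiffOn ℝ ∞ φ.symm φ.target ∧
      SameDerivs q k f.1 (g.1 ∘ φ)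

variable (p q M) in
/-- The extended jet bundle `J^k(M,p)`, `0 ≤ k ≤ ∞`: classes of (germs of) `p`-dimensional
submanifolds under `k`-th order contact; for `k = ∞`, contact of every finite order. -/
def Jet (k : ℕ∞) : Type _ :=
  Quot fun f g : ImmersionGerm p q M => ∀ i : ℕ, (i : ℕ∞) ≤ k → HasContact i f g

namespace Jet

/-- The `k`-jet of a parametrized submanifold at the point with parameter `0`. -/
def mk (k : ℕ∞) (f : ImmersionGerm p q M) : Jet p q M k := Quot.mk _ f

/-- The base point in `M` of a jet. -/
def base {k : ℕ∞} : Jet p q M k → M :=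
  Quot.lift (fun f => f.1 0) (by
    intro f g h
    obtain ⟨φ, -, h0, -, -, h1, -⟩ := h 0 (by simp)
    simpa [h0] using h1)

/-- The projection `π^l_k : J^l(M,p) → J^k(M,p)` for `k ≤ l`. -/
def proj {k l : ℕ∞} (hkl : k ≤ l) : Jet p q M l → Jet p q M k :=
  Quot.map id fun _ _ h i hi => h i (hi.trans hkl)

/-- The `k`-jet, at the point with parameter `t`, of the submanifold parametrized by `f`; this
is meaningful for `t` near `0`. The map `t ↦ jetAt k f t` parametrizes the prolonged submanifold. -/
def jetAt (k : ℕ∞) (f : ImmersionGerm p q M) (t : Fin p → ℝ) : Jet p q M k :=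
  open Classical in
  if h : IsImmersionGerm (q := q) (fun s => f.1 (t + s)) then mk k ⟨_, h⟩ else mk k f

end Jet

/-! ### Jet coordinates, topology and smooth functions -/

/-- Jet coordinates `(x, u^{(k)})`: a point `x` and the derivatives `u_i` of order `0 ≤ i ≤ k`,
written as multilinear maps. -/
abbrev JetCoord (p q k : ℕ) : Type :=
  (Fin p → ℝ) × (∀ i : Fin (k + 1), (Fin p → ℝ) [×(i : ℕ)]→L[ℝ] (Fin q → ℝ))

/-- The Taylor polynomial `∑ u_i(t,…,t)/i!`. -/
def taylorPoly {k : ℕ} (A : ∀ i : Fin (k + 1), (Fin p → ℝ) [×(i : ℕ)]→L[ℝ] (Fin q → ℝ))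
    (t : Fin p → ℝ) : Fin q → ℝ :=
  ∑ i : Fin (k + 1), ((i : ℕ).factorial : ℝ)⁻¹ • A i fun _ => t

/-- The graph of the Taylor polynomial, in the chart `c`, parametrized by `t ↦ x + t`. -/
def graphMap {k : ℕ} (c : OpenPartialHomeomorph M (Coord p q)) (s : JetCoord p q k)
    (t : Fin p → ℝ) : M :=
  c.symm (s.1 + t, taylorPoly s.2 t)

/-- The jet coordinates whose base point lies in the range of the chart `c`. -/
def jetCoordDomain (k : ℕ) (c : OpenPartialHomeomorph M (Coord p q)) : Set (JetCoord p q k) :=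
  {s | (s.1, taylorPoly s.2 0) ∈ c.target}

theorem contDiff_taylorPoly {k : ℕ}
    (A : ∀ i : Fin (k + 1), (Fin p → ℝ) [×(i : ℕ)]→L[ℝ] (Fin q → ℝ)) :
    ContDiff ℝ ∞ (taylorPoly A) := by
  unfold taylorPoly
  refine ContDiff.sum fun i _ => ContDiff.const_smul _ ?_
  exact (A i).contDiff.comp (contDiff_pi.2 fun _ => contDiff_id)

theorem isImmersionGerm_graphMap {k : ℕ} {c : OpenPartialHomeomorph M (Coord p q)}
    (hc : c ∈ IsManifold.maximalAtlas 𝓘(ℝ, Coord p q) ∞ M) {s : JetCoord p q k}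
    (hs : s ∈ jetCoordDomain k c) : IsImmersionGerm (q := q) (graphMap c s) := by
  have hlin : ContDiff ℝ ∞ fun t : Fin p → ℝ => ((s.1 + t, taylorPoly s.2 t) : Coord p q) :=
    (contDiff_const.add contDiff_id).prodMk (contDiff_taylorPoly s.2)
  have h0 : ((s.1 + 0, taylorPoly s.2 0) : Coord p q) ∈ c.target := by
    rw [add_zero]; exact hs
  have hev : ∀ᶠ t in 𝓝 (0 : Fin p → ℝ), ((s.1 + t, taylorPoly s.2 t) : Coord p q) ∈ c.target :=
    hlin.continuous.continuousAt.eventually (c.open_target.mem_nhds h0)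
  have hsm : ∀ᶠ t in 𝓝 (0 : Fin p → ℝ),
      ContMDiffAt 𝓘(ℝ, Fin p → ℝ) 𝓘(ℝ, Coord p q) ∞ (graphMap c s) t := by
    filter_upwards [hev] with t ht
    have h1 := (contMDiffOn_symm_of_mem_maximalAtlas hc).contMDiffAt (c.open_target.mem_nhds ht)
    exact h1.comp t (hlin.contMDiff.contMDiffAt)
  refine ⟨hsm, ?_⟩
  have hd : MDifferentiableAt 𝓘(ℝ, Fin p → ℝ) 𝓘(ℝ, Coord p q) (graphMap c s) 0 :=
    hsm.self_of_nhds.mdifferentiableAt (by simp)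
  have hcs : MDifferentiableAt 𝓘(ℝ, Coord p q) 𝓘(ℝ, Coord p q) c (graphMap c s 0) :=
    ((contMDiffOn_of_mem_maximalAtlas hc).contMDiffAt
      (c.open_source.mem_nhds (c.map_target h0))).mdifferentiableAt (by simp)
  have hfst : MDifferentiableAt 𝓘(ℝ, Coord p q) 𝓘(ℝ, Fin p → ℝ)
      (Prod.fst : Coord p q → Fin p → ℝ) (c (graphMap c s 0)) :=
    (contDiff_fst (n := 1)).contMDiff.contMDiffAt.mdifferentiableAt (by simp)
  have hcomp : (Prod.fst ∘ (c ∘ graphMap c s)) =ᶠ[𝓝 0] fun t => s.1 + t := by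
    filter_upwards [hev] with t ht
    simp [graphMap, c.right_inv ht]
  have hder : mfderiv 𝓘(ℝ, Fin p → ℝ) 𝓘(ℝ, Fin p → ℝ) (Prod.fst ∘ (c ∘ graphMap c s)) 0 =
      ContinuousLinearMap.id ℝ (Fin p → ℝ) := by
    rw [hcomp.mfderiv_eq, mfderiv_eq_fderiv]
    exact ((hasFDerivAt_id (0 : Fin p → ℝ)).const_add s.1).fderiv
  rw [mfderiv_comp (I' := 𝓘(ℝ, Coord p q)) 0 hfst (hcs.comp 0 hd),
    mfderiv_comp (I' := 𝓘(ℝ, Coord p q)) 0 hcs hd] at hder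
  intro v w hvw
  have hv := DFunLike.congr_fun hder v
  have hw := DFunLike.congr_fun hder w
  refine hv.symm.trans (Eq.trans ?_ hw)
  change (mfderiv _ _ _ _) ((mfderiv _ _ _ _) ((mfderiv _ _ (graphMap c s) 0) v)) =
    (mfderiv _ _ _ _) ((mfderiv _ _ _ _) ((mfderiv _ _ (graphMap c s) 0) w))
  rw [hvw]

/-- The local parametrization of `J^k(M,p)` by the jet coordinates `(x, u^{(k)})` of the chart `c`. -/
def jetParam (k : ℕ) {c : OpenPartialHomeomorph M (Coord p q)}
    (hc : c ∈ IsManifold.maximalAtlas 𝓘(ℝ, Coord p q) ∞ M) (s : jetCoordDomain k c) :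
    Jet p q M k :=
  Jet.mk k ⟨graphMap c s.1, isImmersionGerm_graphMap hc s.2⟩

instance instNonemptyJet [IsManifold 𝓘(ℝ, Coord p q) ∞ M] [Nonempty M] (k : ℕ∞) : Nonempty (Jet p q M k) := by
  obtain ⟨z⟩ := ‹Nonempty M›
  have hc := IsManifold.chart_mem_maximalAtlas (I := 𝓘(ℝ, Coord p q)) (n := ∞) z
  let A : ∀ i : Fin (0 + 1), (Fin p → ℝ) [×(i : ℕ)]→L[ℝ] (Fin q → ℝ) :=
    Fin.cons (ContinuousMultilinearMap.constOfIsEmpty ℝ (fun _ : Fin 0 => (Fin p → ℝ))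
      (chartAt (Coord p q) z z).2) fun i => i.elim0
  have hs : ((chartAt (Coord p q) z z).1, A) ∈ jetCoordDomain 0 (chartAt (Coord p q) z) := by
    have hA : taylorPoly A 0 = (chartAt (Coord p q) z z).2 := by
      simp [taylorPoly, A]
    change ((chartAt (Coord p q) z z).1, taylorPoly A 0) ∈ (chartAt (Coord p q) z).target
    rw [hA]
    exact mem_chart_target (Coord p q) z
  exact ⟨Jet.mk k ⟨_, isImmersionGerm_graphMap hc hs⟩⟩

/-- The topology of `J^k(M,p)`, `k < ∞`: a set is open if it is open in all jet coordinates. -/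
instance instTopologicalSpaceJet (k : ℕ) : TopologicalSpace (Jet p q M (k : ℕ∞)) :=
  ⨆ (c : OpenPartialHomeomorph M (Coord p q))
    (hc : c ∈ IsManifold.maximalAtlas 𝓘(ℝ, Coord p q) ∞ M),
    TopologicalSpace.coinduced (jetParam k hc) inferInstance

/-- The inverse limit topology of `J^∞(M,p)`. -/
instance instTopologicalSpaceJetTop : TopologicalSpace (Jet p q M (⊤ : ℕ∞)) :=
  ⨅ k : ℕ, TopologicalSpace.induced (Jet.proj (k := (k : ℕ∞)) le_top) inferInstance

/-- `F` is a (smooth) differential function of finite order `k` on the open set `W ⊆ J^k(M,p)`: it is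
smooth in all jet coordinates. -/
def SmoothOnJet {k : ℕ} (F : Jet p q M (k : ℕ∞) → ℝ) (W : Set (Jet p q M (k : ℕ∞))) : Prop :=
  ∀ (c : OpenPartialHomeomorph M (Coord p q))
    (hc : c ∈ IsManifold.maximalAtlas 𝓘(ℝ, Coord p q) ∞ M),
    open Classical in
    ContDiffOn ℝ ∞
      (fun s : JetCoord p q k => if h : s ∈ jetCoordDomain k c then F (jetParam k hc ⟨s, h⟩) else 0)
      {s | ∃ h : s ∈ jetCoordDomain k c, jetParam k hc ⟨s, h⟩ ∈ W}

/-- `F` is a differential function on the open set `U ⊆ J^∞(M,p)`: locally it is a smooth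
function on a jet bundle of finite order. -/
def SmoothOnJetInf (F : Jet p q M ⊤ → ℝ) (U : Set (Jet p q M ⊤)) : Prop :=
  ∀ ζ ∈ U, ∃ (k : ℕ) (W : Set (Jet p q M (k : ℕ∞))) (F' : Jet p q M (k : ℕ∞) → ℝ),
    IsOpen W ∧ Jet.proj le_top ζ ∈ W ∧ SmoothOnJet F' W ∧
      ∀ ζ' ∈ U, Jet.proj le_top ζ' ∈ W → F ζ' = F' (Jet.proj le_top ζ')

end Jets

/-! ### Prolongation of maps -/

section Prolong

variable {p q r : ℕ} {M N : Type*}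
  [TopologicalSpace M] [ChartedSpace (Coord p r) M]
  [TopologicalSpace N] [ChartedSpace (Coord p q) N]

/-- The jets with base point in `D` on which the prolongation of a map `Φ`, smooth on the open
set `D`, is defined: those represented by a submanifold `S` for which `Φ` restricts to an
immersion of `S` near the base point. For a submersion `Φ` and `k ≥ 1` these are the jets of submanifolds that
are transverse to the fibers of `Φ`. -/
def prolongDom {k : ℕ∞} (D : Set M) (Φ : M → N) : Set (Jet p r M k) :=
  {ζ | ∃ f : ImmersionGerm p r M, Jet.mk k f = ζ ∧ f.1 0 ∈ D ∧ IsImmersionGerm (q := q) (Φ ∘ f.1)}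

/-- The prolongation `Φ^{(k)}`, which maps the `k`-jet of `S` at `z` to the `k`-jet of `Φ(S)`
at `Φ(z)`; it is meaningful on `prolongDom D Φ`. -/
def prolong {k : ℕ∞} [Nonempty (Jet p q N k)] (D : Set M) (Φ : M → N) (ζ : Jet p r M k) :
    Jet p q N k :=
  open Classical in
  if h : ∃ f : ImmersionGerm p r M,
      Jet.mk k f = ζ ∧ f.1 0 ∈ D ∧ IsImmersionGerm (q := q) (Φ ∘ f.1) then
    Jet.mk k ⟨Φ ∘ h.choose.1, h.choose_spec.2.2⟩
  else Classical.arbitrary _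

end Prolong

/-! ### One-forms on `J^∞(M,p)` -/

section Forms

variable {p q r : ℕ} {M N : Type*}
  [TopologicalSpace M] [ChartedSpace (Coord p r) M]
  [TopologicalSpace N] [ChartedSpace (Coord p q) N]

variable (p q M) in
/-- A one-form on `J^∞(M,p)`, given by its values on tangent vectors, where a tangent
vector at `ζ` is represented as the velocity at time `0` of a curve `γ` with `γ 0 = ζ`. Only
forms `∑ A_j dB_j` with differential functions `A_j`, `B_j` are used below. -/
abbrev JetForm [ChartedSpace (Coord p q) M] : Type _ := (ℝ → Jet p q M ⊤) → ℝ

/-- The differential `dF`. -/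
def jetDiff (F : Jet p r M ⊤ → ℝ) : JetForm p r M := fun γ => deriv (fun t => F (γ t)) 0

/-- The independent variables `x = (x^1,…,x^p)` of the chart `c = (x,u)`, as functions on `J^∞(M,p)`. -/
def indepVar (c : OpenPartialHomeomorph M (Coord p r)) (i : Fin p) (ζ : Jet p r M ⊤) : ℝ :=
  (c ζ.base).1 i

/-- The horizontal one-form `∑ Q_i dx^i`. -/
def horizontalForm (c : OpenPartialHomeomorph M (Coord p r)) (Q : Fin p → Jet p r M ⊤ → ℝ) :
    JetForm p r M :=
  fun γ => ∑ i, Q i (γ 0) * jetDiff (indepVar c i) γ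

/-- The pull-back of a one-form by the prolongation of `Φ`. -/
def pullbackForm [Nonempty (Jet p q N ⊤)] (D : Set M) (Φ : M → N) (η : JetForm p q N) :
    JetForm p r M :=
  fun γ => η fun t => prolong D Φ (γ t)

/-- `η ≡ η'` at `ζ`, modulo contact forms: the two forms agree when restricted to the
prolongation of any `p`-dimensional submanifold with jet `ζ`. -/
def ContactEqAt (ζ : Jet p r M ⊤) (η η' : JetForm p r M) : Prop :=
  ∀ f : ImmersionGerm p r M, Jet.mk ⊤ f = ζ → ∀ w : Fin p → ℝ,
    η (fun t => Jet.jetAt ⊤ f (t • w)) = η' (fun t => Jet.jetAt ⊤ f (t • w))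

/-- The jets over the domain of the chart `c = (x,u)` of submanifolds transverse to the vertical
fibers `{x = const}`, i.e. of graphs `u = u(x)`. -/
def graphJets (c : OpenPartialHomeomorph M (Coord p r)) : Set (Jet p r M ⊤) :=
  {ζ | ∃ f : ImmersionGerm p r M, Jet.mk ⊤ f = ζ ∧ f.1 0 ∈ c.source ∧
    Function.Bijective (fderiv ℝ (fun t => (c (f.1 t)).1) 0)}

/-- A curve through `ζ` whose velocity is the total derivative `D_i`: it runs in
the prolongation of a submanifold `S` with jet `ζ`, with the velocity that
projects to the tangent vector of `S` on which `dx^j` takes the value `δ^j_i`. -/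
def totalCurve (c : OpenPartialHomeomorph M (Coord p r)) (i : Fin p) (ζ : Jet p r M ⊤) :
    ℝ → Jet p r M ⊤ :=
  let f : ImmersionGerm p r M := Quot.out ζ
  fun t => Jet.jetAt ⊤ f (t • (fderiv ℝ (fun s => (c (f.1 s)).1) 0).inverse (Pi.single i 1))

/-- The coefficients of the horizontal component `π_H(η) = ∑ η(D_i) dx^i` of `η`. -/
def horizontalPart (c : OpenPartialHomeomorph M (Coord p r)) (η : JetForm p r M) (i : Fin p)
    (ζ : Jet p r M ⊤) : ℝ :=
  η (totalCurve c i ζ)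

/-- The total derivative `D_i F`; these are the coefficients of `d_H F = π_H(dF) = ∑ (D_i F) dx^i`. -/
def totalDeriv (c : OpenPartialHomeomorph M (Coord p r)) (i : Fin p) (F : Jet p r M ⊤ → ℝ) :
    Jet p r M ⊤ → ℝ :=
  horizontalPart c (jetDiff F) i

end Forms

/-! ### Group actions -/

/-- A map `toFun` with domain of definition `dom`. -/
structure LocalTransf (M : Type*) where
  dom : Set M
  toFun : M → M

/-- A smooth local action of a Lie group `G` on `M`; a global action is the case `dom = univ`. -/
structure LocalAction {E G E' M : Type*} [NormedAddCommGroup E] [NormedSpace ℝ E]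
    [TopologicalSpace G] [ChartedSpace E G] [Group G] [NormedAddCommGroup E'] [NormedSpace ℝ E']
    [TopologicalSpace M] [ChartedSpace E' M] where
  dom : Set (G × M)
  act : G → M → M
  isOpen_dom : IsOpen dom
  smooth : ContMDiffOn (𝓘(ℝ, E).prod 𝓘(ℝ, E')) 𝓘(ℝ, E') ∞ (fun x : G × M => act x.1 x.2) dom
  one_mem : ∀ z, (1, z) ∈ dom
  one_act : ∀ z, act 1 z = z
  mul_act : ∀ g h z, (h, z) ∈ dom → (g, act h z) ∈ dom → (g * h, z) ∈ dom →
    act g (act h z) = act (g * h) z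
  inv_mem : ∀ g z, (g, z) ∈ dom → (g⁻¹, act g z) ∈ dom
  inv_act : ∀ g z, (g, z) ∈ dom → act g⁻¹ (act g z) = z

namespace LocalAction

variable {E G E' M N : Type*} [NormedAddCommGroup E] [NormedSpace ℝ E]
    [TopologicalSpace G] [ChartedSpace E G] [Group G] [NormedAddCommGroup E'] [NormedSpace ℝ E']
    [TopologicalSpace M] [ChartedSpace E' M]

/-- The local transformation `z ↦ g · z` of `M`. -/
def transf (A : LocalAction (E := E) (G := G) (E' := E') (M := M)) (g : G) : LocalTransf M :=
  ⟨{z | (g, z) ∈ A.dom}, A.act g⟩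

/-- The action is projectable under `P : M → N`: every `g` maps every fiber of `P` (as far as
`g` is defined on it) into a fiber. For a global action, applying this to `g` and
`g⁻¹` shows that `g` maps each fiber onto a fiber. -/
def Projectable (A : LocalAction (E := E) (G := G) (E' := E') (M := M)) (P : M → N) : Prop :=
  ∀ (g : G) (w : N), ∃ w' : N, ∀ z, P z = w → (g, z) ∈ A.dom → P (A.act g z) = w'

/-- The transformation `w ↦ g · w = P (g · P⁻¹{w})` of `N` induced by `g` under a projectable
action. It depends only on the class `[g]` of `g` modulo the elements that act trivially on `N`,
and these are the transformations by which the quotient `[G]` acts on `N`. -/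
def projected (A : LocalAction (E := E) (G := G) (E' := E') (M := M)) (P : M → N) (g : G) :
    LocalTransf N where
  dom := P '' {z | (g, z) ∈ A.dom}
  toFun w :=
    open Classical in
    if h : ∃ z, (g, z) ∈ A.dom ∧ P z = w then P (A.act g h.choose) else w

end LocalAction

/-! ### Contact-invariant coframes, dual operators, differential invariants -/

section Invariants

variable {p r : ℕ} {M : Type*} [TopologicalSpace M] [ChartedSpace (Coord p r) M]
  [IsManifold 𝓘(ℝ, Coord p r) ∞ M] [Nonempty M] {Γ : Type*}

/-- The one-forms `ω^i = ∑_j Q i j dx^j` form a horizontal coframe on the open subset `U` of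
`J^∞(M,p)`, contact-invariant under the prolongations of the local transformations `τ g`. -/
structure IsContactInvariantCoframe (τ : Γ → LocalTransf M)
    (c : OpenPartialHomeomorph M (Coord p r)) (U : Set (Jet p r M ⊤))
    (Q : Fin p → Fin p → Jet p r M ⊤ → ℝ) : Prop where
  isOpen : IsOpen U
  subset : U ⊆ graphJets c
  smooth : ∀ i j, SmoothOnJetInf (Q i j) U
  linearIndependent : ∀ ζ ∈ U, LinearIndependent ℝ fun i j => Q i j ζ
  invariant : ∀ g i, ∀ ζ ∈ U, ζ ∈ prolongDom (q := r) (τ g).dom (τ g).toFun →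
    prolong (τ g).dom (τ g).toFun ζ ∈ U →
    ContactEqAt ζ (pullbackForm (τ g).dom (τ g).toFun (horizontalForm c (Q i)))
      (horizontalForm c (Q i))

/-- The operators `𝒟_1,…,𝒟_p` are dual to the coframe `ω^j = ∑_i Q j i dx^i` on `U`:
`d_H F = ∑_j (𝒟_j F) ω^j` for every differential function `F` on an open subset of `U`. -/
def IsDual (c : OpenPartialHomeomorph M (Coord p r)) (U : Set (Jet p r M ⊤))
    (Q : Fin p → Fin p → Jet p r M ⊤ → ℝ)
    (𝒟 : Fin p → (Jet p r M ⊤ → ℝ) → Jet p r M ⊤ → ℝ) : Prop :=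
  ∀ (W : Set (Jet p r M ⊤)) (F : Jet p r M ⊤ → ℝ), IsOpen W → W ⊆ U → SmoothOnJetInf F W →
    ∀ ζ ∈ W, ∀ i, totalDeriv c i F ζ = ∑ j, 𝒟 j F ζ * Q j i ζ

/-- `F` is invariant, on `W`, under the prolongations of the local transformations `τ g`. -/
def IsInvariantOn {k : ℕ∞} (τ : Γ → LocalTransf M) (F : Jet p r M k → ℝ) (W : Set (Jet p r M k)) :
    Prop :=
  ∀ g, ∀ ζ ∈ W, ζ ∈ prolongDom (q := r) (τ g).dom (τ g).toFun →
    prolong (τ g).dom (τ g).toFun ζ ∈ W → F (prolong (τ g).dom (τ g).toFun ζ) = F ζ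

/-- The algebra of differential invariants of order `k` with domain `W ⊆ J^k(M,p)`. -/
def differentialInvariants {k : ℕ} (τ : Γ → LocalTransf M) (W : Set (Jet p r M (k : ℕ∞))) :
    Subalgebra ℝ (W → ℝ) where
  carrier := {f | ∃ F : Jet p r M (k : ℕ∞) → ℝ, SmoothOnJet F W ∧ IsInvariantOn τ F W ∧
    f = fun ζ : W => F ζ}
  mul_mem' := by
    rintro _ _ ⟨F, hF, hF', rfl⟩ ⟨F₁, hF₁, hF₁', rfl⟩
    refine ⟨F * F₁, fun c hc => ?_, fun g ζ h1 h2 h3 => ?_, rfl⟩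
    · refine ((hF c hc).mul (hF₁ c hc)).congr ?_
      rintro s ⟨h, -⟩
      simp [h]
    · simp [hF' g ζ h1 h2 h3, hF₁' g ζ h1 h2 h3]
  add_mem' := by
    rintro _ _ ⟨F, hF, hF', rfl⟩ ⟨F₁, hF₁, hF₁', rfl⟩
    refine ⟨F + F₁, fun c hc => ?_, fun g ζ h1 h2 h3 => ?_, rfl⟩
    · refine ((hF c hc).add (hF₁ c hc)).congr ?_
      rintro s ⟨h, -⟩
      simp [h]
    · simp [hF' g ζ h1 h2 h3, hF₁' g ζ h1 h2 h3]
  algebraMap_mem' a := by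
    refine ⟨fun _ => a, fun c hc => ?_, fun _ _ _ _ _ => rfl, rfl⟩
    refine (contDiffOn_const (c := a)).congr ?_
    rintro s ⟨h, -⟩
    simp [h]

/-- The functions on `W` that are constant on the fibers of a map `Ψ`. -/
def fiberwiseConstant {X Y : Type*} (Ψ : X → Y) (W : Set X) : Subalgebra ℝ (W → ℝ) where
  carrier := {f | ∀ ζ ζ' : W, Ψ ζ = Ψ ζ' → f ζ = f ζ'}
  mul_mem' := fun ha hb ζ ζ' h => by simp [ha ζ ζ' h, hb ζ ζ' h]
  add_mem' := fun ha hb ζ ζ' h => by simp [ha ζ ζ' h, hb ζ ζ' h]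
  algebraMap_mem' _ _ _ _ := rfl

end Invariants

/-! ### The surjective map `P : M → N` -/

section Projection

variable {p q r : ℕ} {M N : Type*}
  [TopologicalSpace M] [ChartedSpace (Coord p r) M]
  [TopologicalSpace N] [ChartedSpace (Coord p q) N]
  [IsManifold 𝓘(ℝ, Coord p q) ∞ N] [Nonempty N]

/-- The `p × p` matrix `D_0 P = (D_i P^k)` of total derivatives of the components
`P^k = y^k ∘ P`, in the charts `c = (x,u)` of `M` and `d = (y,v)` of `N`. -/
def totalJacobian (c : OpenPartialHomeomorph M (Coord p r))
    (d : OpenPartialHomeomorph N (Coord p q)) (P : M → N) (ζ : Jet p r M ⊤) :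
    Matrix (Fin p) (Fin p) ℝ :=
  Matrix.of fun i k => totalDeriv c i (fun ζ' => (d (P ζ'.base)).1 k) ζ

/-- The preimage of `W ⊆ J^k(N,p)` under `P^{(k)}`, a set of jets of `P`-regular submanifolds. -/
def prolongPreimage {k : ℕ∞} (P : M → N) (W : Set (Jet p q N k)) : Set (Jet p r M k) :=
  {ζ | ζ ∈ prolongDom (q := q) Set.univ P ∧ prolong Set.univ P ζ ∈ W}

/-- The jets over `V ⊆ J^∞(N,p)`, in the domain of the charts `c` and `d`, at which the
non-singularity condition `det D_0 P ≠ 0` holds. -/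
def nonsingularJets (c : OpenPartialHomeomorph M (Coord p r))
    (d : OpenPartialHomeomorph N (Coord p q)) (P : M → N) (V : Set (Jet p q N ⊤)) :
    Set (Jet p r M ⊤) :=
  {ζ | ζ ∈ prolongPreimage P V ∧ ζ ∈ graphJets c ∧ P ζ.base ∈ d.source ∧
    (totalJacobian c d P ζ).det ≠ 0}

/-- The coefficients of the horizontal components `ω̂^i = π_H(P^* ω^i)` of the pull-backs of the
one-forms `ω^i = ∑_j Q i j dy^j`. -/
def liftedCoframe (c : OpenPartialHomeomorph M (Coord p r))
    (d : OpenPartialHomeomorph N (Coord p q)) (P : M → N)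
    (Q : Fin p → Fin p → Jet p q N ⊤ → ℝ) : Fin p → Fin p → Jet p r M ⊤ → ℝ :=
  fun i => horizontalPart c (pullbackForm Set.univ P (horizontalForm d (Q i)))

end Projection

end

/-! All objects are evaluated on parametrized germs `f : ℝ^p → M`. The jet of `f` is `germJet`, the
prolongation of `Φ` sends the jet of `f` to the jet of `Φ ∘ f` (`prolong_germJet`), and congruence
modulo contact forms means equality on the velocities `s ↦ f (s + ·)` of prolonged submanifolds.
With `horizontalValue` the value of a horizontal form on such a velocity, the central identity is
`horizontalValue_liftedCoframe`: `ω̂` on `f` equals `ω` on `P ∘ f`.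

Invariance of the lifted coframe follows from `[g] ∘ P = P ∘ g`: the value of `ω̂` on `g ∘ f` is
that of `ω` on `P ∘ g ∘ f = [g] ∘ P ∘ f`, hence that of `ω` on `P ∘ f`, hence that of `ω̂` on `f`.
Linear independence holds because the coefficient matrix of `ω̂` is that of `ω` times the transposed
total Jacobian of `P`. On a germ, `dF = ∑ (𝒟_j F) ω^j`, and the coefficients are unique
(`eq_of_sum_mul_horizontalValue`). Comparing the two expansions of one derivative gives both the
invariance of `𝒟_j F` (`isInvariantOn_dual`) and the intertwining formula (`IsDual.intertwine`).

The analysis underneath rests on two facts. A smooth family of germs has jets that depend smoothly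
on the parameter (`IsSmoothFamily.exists_jetCoord`), so openness and smoothness on jet spaces can be
tested along families. The derivative of a function of order `k` along a prolonged submanifold
depends only on the derivatives of order at most `k + 1` of the submanifold
(`jetDeriv_eq_of_eqDerivs`), so total derivatives do not depend on the chosen representative and
raise the order by one.

For the algebra isomorphism, local sections of the submersion lift germs and smooth families from
`N` to `M`. Hence the prolongation of `P` maps the preimage of `W` onto `W`, and a smooth invariant
function constant on its fibers descends to a smooth invariant function. -/

noncomputable section

/-! ### Derivatives up to order `k`, Taylor polynomials, and the inverse function theorem. -/

section Calculus

variable {E F G : Type*} [NormedAddCommGroup E] [NormedSpace ℝ E]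
  [NormedAddCommGroup F] [NormedSpace ℝ F] [NormedAddCommGroup G] [NormedSpace ℝ G]

/-- `f` and `g` have the same derivatives at `x` up to order `k`. -/
def EqDerivs (k : ℕ) (f g : E → F) (x : E) : Prop :=
  ∀ i ≤ k, iteratedFDeriv ℝ i f x = iteratedFDeriv ℝ i g x

theorem EqDerivs.refl (k : ℕ) (f : E → F) (x : E) : EqDerivs k f f x := fun _ _ => rfl

theorem EqDerivs.symm {k : ℕ} {f g : E → F} {x : E} (h : EqDerivs k f g x) : EqDerivs k g f x :=
  fun i hi => (h i hi).symm

theorem EqDerivs.trans {k : ℕ} {f g h : E → F} {x : E} (h₁ : EqDerivs k f g x)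
    (h₂ : EqDerivs k g h x) : EqDerivs k f h x :=
  fun i hi => (h₁ i hi).trans (h₂ i hi)

theorem EqDerivs.of_eventuallyEq (k : ℕ) {f g : E → F} {x : E} (h : f =ᶠ[𝓝 x] g) :
    EqDerivs k f g x :=
  fun i _ => (h.iteratedFDeriv ℝ i).self_of_nhds

theorem EqDerivs.eq {k : ℕ} {f g : E → F} {x : E} (h : EqDerivs k f g x) : f x = g x := by
  have := DFunLike.congr_fun (h 0 (Nat.zero_le k)) 0
  simpa using this

theorem EqDerivs.fderiv_eq {k : ℕ} (hk : 1 ≤ k) {f g : E → F} {x : E} (h : EqDerivs k f g x) :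
    fderiv ℝ f x = fderiv ℝ g x := by
  ext v
  have := DFunLike.congr_fun (h 1 hk) (fun _ => v)
  simpa [iteratedFDeriv_one_apply] using this

/-- By the Faà di Bruno formula, a derivative of order `i` of a composition is a sum over ordered
partitions in which only derivatives of order at most `i` of the two factors occur. -/
theorem EqDerivs.comp {k : ℕ} {Φ Ψ : F → G} {f g : E → F} {x : E}
    (hΦ : ContDiffAt ℝ k Φ (f x)) (hΨ : ContDiffAt ℝ k Ψ (f x))
    (hf : ContDiffAt ℝ k f x) (hg : ContDiffAt ℝ k g x)
    (h : EqDerivs k Φ Ψ (f x)) (h' : EqDerivs k f g x) :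
    EqDerivs k (Φ ∘ f) (Ψ ∘ g) x := by
  intro i hi
  have hx : f x = g x := h'.eq
  have hik : (i : ℕ∞ω) ≤ (k : ℕ∞ω) := by exact_mod_cast hi
  rw [iteratedFDeriv_comp hΦ hf hik, iteratedFDeriv_comp (hx ▸ hΨ) hg hik, ← hx]
  unfold FormalMultilinearSeries.taylorComp FormalMultilinearSeries.compAlongOrderedFinpartition
  refine Finset.sum_congr rfl fun c _ => ?_
  congr 1
  · exact h _ (c.length_le.trans hi)
  · funext m
    exact h' _ ((c.partSize_le m).trans hi)

theorem EqDerivs.comp_left {k : ℕ} {Φ : F → G} {f g : E → F} {x : E}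
    (hΦ : ContDiffAt ℝ k Φ (f x)) (hf : ContDiffAt ℝ k f x) (hg : ContDiffAt ℝ k g x)
    (h' : EqDerivs k f g x) : EqDerivs k (Φ ∘ f) (Φ ∘ g) x :=
  EqDerivs.comp hΦ hΦ hf hg (EqDerivs.refl _ _ _) h'

theorem EqDerivs.comp_right {k : ℕ} {Φ Ψ : F → G} {f : E → F} {x : E}
    (hΦ : ContDiffAt ℝ k Φ (f x)) (hΨ : ContDiffAt ℝ k Ψ (f x)) (hf : ContDiffAt ℝ k f x)
    (h : EqDerivs k Φ Ψ (f x)) : EqDerivs k (Φ ∘ f) (Ψ ∘ f) x :=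
  EqDerivs.comp hΦ hΨ hf hf h (EqDerivs.refl _ _ _)

theorem EqDerivs.add {k : ℕ} {f g f' g' : E → F} {x : E}
    (hf : ContDiffAt ℝ k f x) (hg : ContDiffAt ℝ k g x)
    (hf' : ContDiffAt ℝ k f' x) (hg' : ContDiffAt ℝ k g' x)
    (h : EqDerivs k f g x) (h' : EqDerivs k f' g' x) :
    EqDerivs k (fun y => f y + f' y) (fun y => g y + g' y) x := by
  intro i hi
  have hik : (i : ℕ∞ω) ≤ (k : ℕ∞ω) := by exact_mod_cast hi
  rw [fun_iteratedFDeriv_add_apply (hf.of_le hik) (hf'.of_le hik),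
    fun_iteratedFDeriv_add_apply (hg.of_le hik) (hg'.of_le hik), h i hi, h' i hi]

theorem ContDiffAt.of_infty {f : E → F} {x : E} (h : ContDiffAt ℝ ∞ f x) (k : ℕ) :
    ContDiffAt ℝ k f x :=
  h.of_le (by exact_mod_cast le_top)

theorem infty_bound (m n : ℕ) : (m : ℕ∞ω) + n ≤ (∞ : ℕ∞ω) := by
  rw [← Nat.cast_add]
  exact_mod_cast (le_top : ((m + n : ℕ) : ℕ∞) ≤ ⊤)

/-- Uncurrying the first argument, as a continuous linear map. -/
def uncurryLeftCLM (E F : Type*) [NormedAddCommGroup E] [NormedSpace ℝ E]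
    [NormedAddCommGroup F] [NormedSpace ℝ F] (i : ℕ) :
    (E →L[ℝ] E [×i]→L[ℝ] F) →L[ℝ] (E [×(i + 1)]→L[ℝ] F) :=
  ((continuousMultilinearCurryLeftEquiv ℝ (fun _ : Fin (i + 1) => E)
    F).symm.toContinuousLinearEquiv : (E →L[ℝ] E [×i]→L[ℝ] F) ≃L[ℝ] (E [×(i + 1)]→L[ℝ] F))

/-! ### Symmetry of the iterated derivative -/

/-- Swapping the first two arguments is the symmetry of the second derivative of `D^n f`. A swap of
later arguments keeps the first one fixed and comes from differentiating the identity of one order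
less, which is why smoothness is assumed near `x`. -/
theorem iteratedFDeriv_comp_swap_castSucc_succ {f : E → F} {n : ℕ} (i : Fin n) {x : E}
    (hf : ∀ᶠ y in 𝓝 x, ContDiffAt ℝ ∞ f y) (v : Fin (n + 1) → E) :
    iteratedFDeriv ℝ (n + 1) f x (v ∘ Equiv.swap i.castSucc i.succ) =
      iteratedFDeriv ℝ (n + 1) f x v := by
  induction n generalizing x with
  | zero => exact i.elim0
  | succ n ih =>
    refine Fin.cases ?_ (fun j => ?_) i
    · have hsm : ContDiffAt ℝ 2 (iteratedFDeriv ℝ n f) x :=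
        hf.self_of_nhds.iteratedFDeriv_right (infty_bound 2 n)
      have key : ∀ w : Fin (n + 1 + 1) → E, iteratedFDeriv ℝ (n + 1 + 1) f x w =
          fderiv ℝ (fderiv ℝ (iteratedFDeriv ℝ n f)) x (w 0) (w 1)
            (fun l => w l.succ.succ) := by
        intro w
        rw [iteratedFDeriv_succ_apply_left]
        have h2 : fderiv ℝ (iteratedFDeriv ℝ (n + 1) f) x = _ :=
          ((uncurryLeftCLM E F n).hasFDerivAt.comp x
            ((hsm.fderiv_right (m := 1) (by norm_num)).differentiableAt (by simp)).hasFDerivAt).fderiv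
        rw [h2]
        rfl
      have hsymm := hsm.isSymmSndFDerivAt (by simp)
      rw [key, key, hsymm]
      have e0 : Equiv.swap (Fin.castSucc (0 : Fin (n + 1))) (Fin.succ 0) 0 = 1 := by simp
      have e1 : Equiv.swap (Fin.castSucc (0 : Fin (n + 1))) (Fin.succ 0) 1 = 0 := by simp
      simp only [Function.comp, e0, e1]
      congr 1
    · rw [iteratedFDeriv_succ_apply_left, iteratedFDeriv_succ_apply_left]
      have e0 : Equiv.swap (Fin.castSucc j.succ) (Fin.succ j.succ) 0 = 0 := by
        rw [Equiv.swap_apply_of_ne_of_ne] <;> simp [Fin.ext_iff]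
      have et : Fin.tail (v ∘ Equiv.swap (Fin.castSucc j.succ) (Fin.succ j.succ)) =
          Fin.tail v ∘ Equiv.swap j.castSucc j.succ := by
        funext l
        simp only [Fin.tail, Function.comp]
        congr 1
        simp only [Equiv.swap_apply_def, Fin.ext_iff, Fin.val_succ, Fin.val_castSucc]
        split_ifs <;> simp_all
      rw [et]
      simp only [Function.comp_apply, e0]
      have hd : DifferentiableAt ℝ (iteratedFDeriv ℝ (n + 1) f) x :=
        (hf.self_of_nhds.iteratedFDeriv_right (m := 1) (infty_bound 1 _)).differentiableAt
          (by simp)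
      have h2 : ∀ w : Fin (n + 1) → E, fderiv ℝ (iteratedFDeriv ℝ (n + 1) f) x (v 0) w =
          fderiv ℝ (fun y => iteratedFDeriv ℝ (n + 1) f y w) x (v 0) := by
        intro w
        have := ((ContinuousMultilinearMap.apply ℝ (fun _ : Fin (n + 1) => E) F w).hasFDerivAt.comp
          x hd.hasFDerivAt).fderiv
        exact (DFunLike.congr_fun this (v 0)).symm
      rw [h2, h2]
      -- The induction hypothesis holds at all nearby points, so both sides have the same derivative
      -- at `x`.
      have h3 : (fun y => iteratedFDeriv ℝ (n + 1) f y (Fin.tail v ∘ Equiv.swap j.castSucc j.succ))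
          =ᶠ[𝓝 x] fun y => iteratedFDeriv ℝ (n + 1) f y (Fin.tail v) := by
        filter_upwards [hf.eventually_nhds] with y hy
        exact ih j hy _
      rw [h3.fderiv_eq]

/-- Adjacent transpositions generate the symmetric group. -/
theorem iteratedFDeriv_comp_perm_of_smooth {f : E → F} {n : ℕ} {x : E}
    (hf : ∀ᶠ y in 𝓝 x, ContDiffAt ℝ ∞ f y) (σ : Equiv.Perm (Fin n)) (v : Fin n → E) :
    iteratedFDeriv ℝ n f x (v ∘ σ) = iteratedFDeriv ℝ n f x v := by
  cases n with
  | zero => congr 1; funext i; exact i.elim0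
  | succ n =>
    have hσ : σ ∈ Submonoid.closure
        (Set.range fun i : Fin n => Equiv.swap i.castSucc i.succ) := by
      rw [Equiv.Perm.mclosure_swap_castSucc_succ]; trivial
    induction hσ using Submonoid.closure_induction generalizing v with
    | mem τ hτ =>
      obtain ⟨i, rfl⟩ := hτ
      exact iteratedFDeriv_comp_swap_castSucc_succ i hf v
    | one => rfl
    | mul σ τ _ _ h1 h2 =>
      have : v ∘ ⇑(σ * τ) = (v ∘ σ) ∘ τ := rfl
      rw [this, h2, h1]

/-! ### Taylor polynomials -/

/-- The polynomial map `∑ a_i(t,…,t)/i!`. -/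
def polyMap {k : ℕ} (a : ∀ i : Fin (k + 1), E [×(i : ℕ)]→L[ℝ] F) (t : E) : F :=
  ∑ i : Fin (k + 1), ((i : ℕ).factorial : ℝ)⁻¹ • a i fun _ => t

/-- Joint smoothness in the multilinear map and the vector; the induction curries off one argument
at a time. It lets Taylor coefficients serve as parameters of a smooth family. -/
theorem contDiff_multilinear_diag (n : ℕ) :
    ContDiff ℝ ∞ fun x : (E [×n]→L[ℝ] F) × E => x.1 fun _ => x.2 := by
  induction n with
  | zero =>
    have : (fun x : (E [×0]→L[ℝ] F) × E => x.1 fun _ => x.2) =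
        fun x => continuousMultilinearCurryFin0 ℝ E F x.1 := by
      funext x
      simp [Matrix.zero_empty, Subsingleton.elim (fun _ : Fin 0 => x.2) 0]
    rw [this]
    exact (LinearIsometryEquiv.contDiff _).comp contDiff_fst
  | succ n ih =>
    have h1 : ContDiff ℝ ∞ fun x : (E [×(n + 1)]→L[ℝ] F) × E =>
        continuousMultilinearCurryLeftEquiv ℝ (fun _ : Fin (n + 1) => E) F x.1 x.2 :=
      ((LinearIsometryEquiv.contDiff _).comp contDiff_fst).clm_apply contDiff_snd
    convert! ih.comp (h1.prodMk contDiff_snd) using 1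
    funext x
    simp only [Function.comp_apply, continuousMultilinearCurryLeftEquiv_apply]
    congr 1
    funext i
    refine Fin.cases ?_ (fun j => ?_) i <;> simp

theorem contDiff_polyMap_uncurry {k : ℕ} :
    ContDiff ℝ ∞ fun x : (∀ i : Fin (k + 1), E [×(i : ℕ)]→L[ℝ] F) × E => polyMap x.1 x.2 := by
  unfold polyMap
  refine ContDiff.sum fun i _ => ContDiff.const_smul _ ?_
  exact (contDiff_multilinear_diag i).comp
    (((ContinuousLinearMap.proj (R := ℝ) (φ := fun i : Fin (k + 1) => E [×(i : ℕ)]→L[ℝ] F)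
      i).contDiff.comp contDiff_fst).prodMk contDiff_snd)

/-- The polynomial is its own finite power series, with `i`-th term `a i / i!`. Its `i`-th
derivative sums this term over all `i!` permutations of the arguments, and symmetry of `a i` makes
the summands equal. -/
theorem iteratedFDeriv_polyMap [CompleteSpace F] {k : ℕ}
    (a : ∀ i : Fin (k + 1), E [×(i : ℕ)]→L[ℝ] F)
    (i : Fin (k + 1)) (hsymm : ∀ (σ : Equiv.Perm (Fin i)) (v : Fin i → E), a i (v ∘ σ) = a i v) :
    iteratedFDeriv ℝ i (polyMap a) 0 = a i := by
  let P : FormalMultilinearSeries ℝ E F := fun n =>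
    if h : n < k + 1 then ((n.factorial : ℝ)⁻¹ • a ⟨n, h⟩) else 0
  have hP : HasFiniteFPowerSeriesOnBall (polyMap a) P 0 (k + 1) ⊤ := by
    refine HasFiniteFPowerSeriesOnBall.mk' (fun m hm => ?_) (by simp) fun y _ => ?_
    · exact dif_neg (not_lt.2 hm)
    · rw [zero_add, polyMap, Finset.sum_range]
      refine Finset.sum_congr rfl fun i _ => ?_
      simp only [P, i.2, dif_pos]
      rfl
  ext1 v
  rw [hP.toHasFPowerSeriesOnBall.iteratedFDeriv_eq_sum_of_completeSpace]
  have : ∀ σ : Equiv.Perm (Fin i), P i (fun j => v (σ j)) = (((i : ℕ).factorial : ℝ)⁻¹ • a i v) := by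
    intro σ
    simp only [P, i.2, dif_pos, smul_apply]
    congr 1
    exact hsymm σ v
  simp only [this, Finset.sum_const, Finset.card_univ, Fintype.card_perm, Fintype.card_fin]
  rw [← Nat.cast_smul_eq_nsmul ℝ, smul_smul, mul_inv_cancel₀ (by positivity), one_smul]

/-- A smooth map has the same derivatives at `x` as its Taylor polynomial. -/
theorem eqDerivs_polyMap [CompleteSpace F] {k : ℕ} {f : E → F} {x : E}
    (hf : ∀ᶠ y in 𝓝 x, ContDiffAt ℝ ∞ f y) :
    EqDerivs k (polyMap fun i : Fin (k + 1) => iteratedFDeriv ℝ i f x) (fun t => f (x + t)) 0 := by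
  intro i hi
  have h := iteratedFDeriv_polyMap (fun i : Fin (k + 1) => iteratedFDeriv ℝ i f x)
    ⟨i, Nat.lt_succ_of_le hi⟩ fun σ v => iteratedFDeriv_comp_perm_of_smooth hf σ v
  rw [h, iteratedFDeriv_comp_add_left, add_zero]

/-! ### Inverse function theorem -/

theorem ContinuousLinearMap.isInvertible_of_bijective [CompleteSpace E] [CompleteSpace F]
    {L : E →L[ℝ] F} (h : Function.Bijective L) : L.IsInvertible :=
  ⟨ContinuousLinearEquiv.ofBijective L (LinearMap.ker_eq_bot.2 h.1) (LinearMap.range_eq_top.2 h.2),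
    by ext; rfl⟩

theorem isOpen_isInvertible [CompleteSpace E] : IsOpen {L : E →L[ℝ] F | L.IsInvertible} := by
  have := ContinuousLinearEquiv.isOpen (𝕜 := ℝ) (E := E) (F := F)
  exact this

/-- The source is shrunk to an open set `O` on which `f` is smooth with invertible derivative, so
that the inverse is smooth on the whole target and not only at the image of `x`. -/
theorem exists_smooth_openPartialHomeomorph [CompleteSpace E] {f : E → F} {x : E}
    (hf : ∀ᶠ y in 𝓝 x, ContDiffAt ℝ ∞ f y) (hinv : (fderiv ℝ f x).IsInvertible) :
    ∃ φ : OpenPartialHomeomorph E F, x ∈ φ.source ∧ (∀ y, φ y = f y) ∧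
      ContDiffOn ℝ ∞ φ φ.source ∧ ContDiffOn ℝ ∞ φ.symm φ.target := by
  obtain ⟨e, he⟩ := hinv
  have hfx := hf.self_of_nhds
  have hd : HasFDerivAt f (e : E →L[ℝ] F) x := by
    rw [he]; exact (hfx.differentiableAt (by simp)).hasFDerivAt
  have hinv' : ∀ᶠ y in 𝓝 x, (fderiv ℝ f y).IsInvertible :=
    (hfx.fderiv_right (m := 0) (by simp)).continuousAt.eventually
      (isOpen_isInvertible.mem_nhds ⟨e, he⟩)
  obtain ⟨O, hO, hOo, hxO⟩ := eventually_nhds_iff.1 (hf.and hinv')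
  let φ₀ := hfx.toOpenPartialHomeomorph f hd (by simp)
  refine ⟨φ₀.restrOpen O hOo, ?_, fun y => rfl, ?_, ?_⟩
  · exact ⟨hfx.mem_toOpenPartialHomeomorph_source hd (by simp), hxO⟩
  · intro y hy
    exact (hO y hy.2).1.contDiffWithinAt
  · intro z hz
    set φ := φ₀.restrOpen O hOo
    have hy : φ.symm z ∈ φ.source := φ.map_target hz
    obtain ⟨h1, e', he'⟩ := hO _ hy.2
    refine (φ.contDiffAt_symm (f₀' := e') hz ?_ h1).contDiffWithinAt
    rw [he']
    exact (h1.differentiableAt (by simp)).hasFDerivAt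

/-! ### Derivatives of a parametrized graph -/

variable {S : Type*} [NormedAddCommGroup S] [NormedSpace ℝ S]

/-- The derivatives of `V ∘ Y⁻¹` along `Y`, for families of maps `Y` and `V`. -/
def graphDeriv (Y : S × E → E) (V : S × E → F) : ∀ i : ℕ, S × E → (E [×i]→L[ℝ] F)
  | 0 => fun x => (continuousMultilinearCurryFin0 ℝ E F).symm (V x)
  | i + 1 => fun x =>
      (continuousMultilinearCurryLeftEquiv ℝ (fun _ : Fin (i + 1) => E) F).symm
        (((fderiv ℝ (graphDeriv Y V i) x).comp (ContinuousLinearMap.inr ℝ S E)).comp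
          ((fderiv ℝ Y x).comp (ContinuousLinearMap.inr ℝ S E)).inverse)

/-- Each step of the recursion differentiates in the second variable and divides by the partial
derivative of `Y`; inversion of linear maps is smooth at invertible ones. -/
theorem contDiffAt_graphDeriv [CompleteSpace E] {Y : S × E → E} {V : S × E → F} {x : S × E}
    (hY : ∀ᶠ y in 𝓝 x, ContDiffAt ℝ ∞ Y y) (hV : ∀ᶠ y in 𝓝 x, ContDiffAt ℝ ∞ V y)
    (hinv : ((fderiv ℝ Y x).comp (ContinuousLinearMap.inr ℝ S E)).IsInvertible) (i : ℕ) :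
    ContDiffAt ℝ ∞ (graphDeriv Y V i) x := by
  induction i with
  | zero =>
    exact (continuousMultilinearCurryFin0 ℝ E F).symm.contDiff.contDiffAt.comp x hV.self_of_nhds
  | succ i ih =>
    have hu : ContDiff ℝ ∞ (uncurryLeftCLM E F i) := ContinuousLinearMap.contDiff _
    have h1 : ContDiffAt ℝ ∞
        (fun y => (fderiv ℝ (graphDeriv Y V i) y).comp (ContinuousLinearMap.inr ℝ S E)) x :=
      (ih.fderiv_right (m := ∞) le_rfl).clm_comp contDiffAt_const
    have h2 : ContDiffAt ℝ ∞
        (fun y => (fderiv ℝ Y y).comp (ContinuousLinearMap.inr ℝ S E)) x :=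
      (hY.self_of_nhds.fderiv_right (m := ∞) le_rfl).clm_comp contDiffAt_const
    have h3 : ContDiffAt ℝ ∞
        (fun y => ((fderiv ℝ Y y).comp (ContinuousLinearMap.inr ℝ S E)).inverse) x :=
      ContDiffAt.comp (g := ContinuousLinearMap.inverse) x hinv.contDiffAt_map_inverse h2
    exact hu.contDiffAt.comp x (h1.clm_comp h3)

theorem fderiv_comp_prodMk_right {f : S × E → F} {s : S} {t : E}
    (hf : DifferentiableAt ℝ f (s, t)) :
    fderiv ℝ (fun t => f (s, t)) t = (fderiv ℝ f (s, t)).comp (ContinuousLinearMap.inr ℝ S E) :=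
  (hf.hasFDerivAt.comp t (hasFDerivAt_prodMk_right s t)).fderiv

/-- Differentiate the identity of order `i` in `t` and cancel the invertible partial derivative of
`Y`. The derivatives of the graph function `w` are thus expressed by `Y` and `V` alone, which depend
smoothly on `s` although `w` is only available for one `s` at a time. The identity is kept for all
`t` near `t₀` so that it can be differentiated again. -/
theorem iteratedFDeriv_eq_graphDeriv [CompleteSpace E] {Y : S × E → E} {V : S × E → F} {s : S}
    {t₀ : E} {w : E → F} (hY : ∀ᶠ y in 𝓝 (s, t₀), ContDiffAt ℝ ∞ Y y)
    (hV : ∀ᶠ y in 𝓝 (s, t₀), ContDiffAt ℝ ∞ V y)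
    (hinv : ((fderiv ℝ Y (s, t₀)).comp (ContinuousLinearMap.inr ℝ S E)).IsInvertible)
    (hw : ∀ᶠ y in 𝓝 (Y (s, t₀)), ContDiffAt ℝ ∞ w y)
    (hwY : ∀ᶠ t in 𝓝 t₀, w (Y (s, t)) = V (s, t)) (i : ℕ) :
    ∀ᶠ t in 𝓝 t₀, iteratedFDeriv ℝ i w (Y (s, t)) = graphDeriv Y V i (s, t) := by
  have hc : ContinuousAt (fun t : E => (s, t)) t₀ := by fun_prop
  have hinv' : ∀ᶠ y in 𝓝 (s, t₀),
      ((fderiv ℝ Y y).comp (ContinuousLinearMap.inr ℝ S E)).IsInvertible :=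
    ((hY.self_of_nhds.fderiv_right (m := 0) (by simp)).clm_comp
      contDiffAt_const).continuousAt.eventually (isOpen_isInvertible.mem_nhds hinv)
  have hYc : ContinuousAt (fun t => Y (s, t)) t₀ := hY.self_of_nhds.continuousAt.comp hc
  induction i with
  | zero =>
    filter_upwards [hwY] with t ht
    simp [graphDeriv, iteratedFDeriv_zero_eq_comp, ht]
  | succ i ih =>
    filter_upwards [ih.eventually_nhds, hc.eventually hY.eventually_nhds,
      hc.eventually hV.eventually_nhds, hc.eventually hinv', hYc.eventually hw] with t h1 h2 h3 h4 h5
    rw [iteratedFDeriv_succ_eq_comp_left]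
    simp only [Function.comp_apply, graphDeriv]
    congr 1
    have hYd : DifferentiableAt ℝ Y (s, t) := h2.self_of_nhds.differentiableAt (by simp)
    have hWd : DifferentiableAt ℝ (graphDeriv Y V i) (s, t) :=
      (contDiffAt_graphDeriv h2 h3 h4 i).differentiableAt (by simp)
    have hwd : DifferentiableAt ℝ (iteratedFDeriv ℝ i w) (Y (s, t)) :=
      (h5.iteratedFDeriv_right (m := 1) (infty_bound 1 _)).differentiableAt (by simp)
    have h6 : fderiv ℝ (fun t => iteratedFDeriv ℝ i w (Y (s, t))) t =
        (fderiv ℝ (iteratedFDeriv ℝ i w) (Y (s, t))).comp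
          ((fderiv ℝ Y (s, t)).comp (ContinuousLinearMap.inr ℝ S E)) := by
      rw [← fderiv_comp_prodMk_right hYd]
      exact fderiv_comp t hwd (hYd.comp t (by fun_prop))
    have h7 : fderiv ℝ (fun t => iteratedFDeriv ℝ i w (Y (s, t))) t =
        (fderiv ℝ (graphDeriv Y V i) (s, t)).comp (ContinuousLinearMap.inr ℝ S E) := by
      rw [← fderiv_comp_prodMk_right hWd]
      exact Filter.EventuallyEq.fderiv_eq h1
    rw [← h7, h6, ContinuousLinearMap.comp_assoc]
    obtain ⟨e, he⟩ := h4
    rw [← he, ContinuousLinearMap.inverse_equiv]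
    ext1 v
    simp

end Calculus

end

noncomputable section

/-! ### Coordinate expressions of maps and germs, and charts adapted to a submanifold. -/

section Charts

variable {p q : ℕ} {M : Type*} [TopologicalSpace M] [ChartedSpace (Coord p q) M]
  {S : Type*} [NormedAddCommGroup S] [NormedSpace ℝ S]

theorem contDiffAt_chart_comp {c : OpenPartialHomeomorph M (Coord p q)}
    (hc : c ∈ IsManifold.maximalAtlas 𝓘(ℝ, Coord p q) ∞ M) {f : S → M} {x : S}
    (hf : ContMDiffAt 𝓘(ℝ, S) 𝓘(ℝ, Coord p q) ∞ f x) (hx : f x ∈ c.source) :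
    ContDiffAt ℝ ∞ (fun s => c (f s)) x :=
  ((contMDiffAt_of_mem_maximalAtlas hc hx).comp x hf).contDiffAt

theorem contMDiffAt_chart_symm_comp {c : OpenPartialHomeomorph M (Coord p q)}
    (hc : c ∈ IsManifold.maximalAtlas 𝓘(ℝ, Coord p q) ∞ M) {g : S → Coord p q} {x : S}
    (hg : ContDiffAt ℝ ∞ g x) (hx : g x ∈ c.target) :
    ContMDiffAt 𝓘(ℝ, S) 𝓘(ℝ, Coord p q) ∞ (fun s => c.symm (g s)) x :=
  (contMDiffAt_symm_of_mem_maximalAtlas hc hx).comp x hg.contMDiffAt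

theorem eventually_contDiffAt_chart_comp {c : OpenPartialHomeomorph M (Coord p q)}
    (hc : c ∈ IsManifold.maximalAtlas 𝓘(ℝ, Coord p q) ∞ M) {f : S → M} {x : S}
    (hf : ∀ᶠ y in 𝓝 x, ContMDiffAt 𝓘(ℝ, S) 𝓘(ℝ, Coord p q) ∞ f y) (hx : f x ∈ c.source) :
    ∀ᶠ y in 𝓝 x, f y ∈ c.source ∧ ContDiffAt ℝ ∞ (fun s => c (f s)) y := by
  filter_upwards [hf, hf.self_of_nhds.continuousAt.eventually (c.open_source.mem_nhds hx)]
    with y h1 h2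
  exact ⟨h2, contDiffAt_chart_comp hc h1 h2⟩

theorem eventually_contMDiffAt_chart_symm_comp {c : OpenPartialHomeomorph M (Coord p q)}
    (hc : c ∈ IsManifold.maximalAtlas 𝓘(ℝ, Coord p q) ∞ M) {g : S → Coord p q} {x : S}
    (hg : ∀ᶠ y in 𝓝 x, ContDiffAt ℝ ∞ g y) (hx : g x ∈ c.target) :
    ∀ᶠ y in 𝓝 x, g y ∈ c.target ∧
      ContMDiffAt 𝓘(ℝ, S) 𝓘(ℝ, Coord p q) ∞ (fun s => c.symm (g s)) y := by
  filter_upwards [hg, hg.self_of_nhds.continuousAt.eventually (c.open_target.mem_nhds hx)]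
    with y h1 h2
  exact ⟨h2, contMDiffAt_chart_symm_comp hc h1 h2⟩

variable {r : ℕ} {N : Type*} [TopologicalSpace N] [ChartedSpace (Coord p r) N]

/-- In the charts, both sides arise by composing with the coordinate expression of `Φ`. The case `Φ
= id` gives independence of the chart, the general case gives that maps respect contact. -/
theorem eqDerivs_chart_comp {c : OpenPartialHomeomorph M (Coord p q)}
    (hc : c ∈ IsManifold.maximalAtlas 𝓘(ℝ, Coord p q) ∞ M)
    {d : OpenPartialHomeomorph N (Coord p r)}
    (hd : d ∈ IsManifold.maximalAtlas 𝓘(ℝ, Coord p r) ∞ N) {Φ : M → N} {f g : S → M} {x : S}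
    (hΦ : ContMDiffAt 𝓘(ℝ, Coord p q) 𝓘(ℝ, Coord p r) ∞ Φ (f x))
    (hf : ContMDiffAt 𝓘(ℝ, S) 𝓘(ℝ, Coord p q) ∞ f x)
    (hg : ContMDiffAt 𝓘(ℝ, S) 𝓘(ℝ, Coord p q) ∞ g x) (hfg : f x = g x)
    (hx : f x ∈ c.source) (hx' : Φ (f x) ∈ d.source) {k : ℕ}
    (h : EqDerivs k (fun s => c (f s)) (fun s => c (g s)) x) :
    EqDerivs k (fun s => d (Φ (f s))) (fun s => d (Φ (g s))) x := by
  have hΨ : ContDiffAt ℝ ∞ (fun y => d (Φ (c.symm y))) (c (f x)) := by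
    refine contDiffAt_chart_comp (f := fun y => Φ (c.symm y)) hd ?_ (by simpa [hx] using hx')
    refine ContMDiffAt.comp (g := Φ) _ (by simpa [hx] using hΦ) ?_
    exact contMDiffAt_symm_of_mem_maximalAtlas hc (c.map_source hx)
  have key : ∀ g : S → M, ContMDiffAt 𝓘(ℝ, S) 𝓘(ℝ, Coord p q) ∞ g x → f x = g x →
      (fun s => d (Φ (g s))) =ᶠ[𝓝 x] (fun y => d (Φ (c.symm y))) ∘ fun s => c (g s) := by
    intro g hg hfg
    filter_upwards [hg.continuousAt.eventually (c.open_source.mem_nhds (hfg ▸ hx))] with s hs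
    simp [c.left_inv hs]
  refine (EqDerivs.of_eventuallyEq k (key f hf rfl)).trans (EqDerivs.trans ?_
    (EqDerivs.of_eventuallyEq k (key g hg hfg)).symm)
  exact EqDerivs.comp_left (hΨ.of_infty k) ((contDiffAt_chart_comp hc hf hx).of_infty k)
    ((contDiffAt_chart_comp hc hg (hfg ▸ hx)).of_infty k) h

theorem injective_mfderiv_of_comp {f : (Fin p → ℝ) → M} {Ψ : M → N}
    (hf : MDifferentiableAt 𝓘(ℝ, Fin p → ℝ) 𝓘(ℝ, Coord p q) f 0)
    (hΨ : MDifferentiableAt 𝓘(ℝ, Coord p q) 𝓘(ℝ, Coord p r) Ψ (f 0))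
    (h : Function.Injective (mfderiv 𝓘(ℝ, Fin p → ℝ) 𝓘(ℝ, Coord p r) (Ψ ∘ f) 0)) :
    Function.Injective (mfderiv 𝓘(ℝ, Fin p → ℝ) 𝓘(ℝ, Coord p q) f 0) := by
  rw [mfderiv_comp 0 hΨ hf] at h
  intro v w hvw
  apply h
  change (mfderiv _ _ _ _) ((mfderiv _ _ f 0) v) = (mfderiv _ _ _ _) ((mfderiv _ _ f 0) w)
  rw [hvw]

theorem IsImmersionGerm.congr {f g : (Fin p → ℝ) → M} (hf : IsImmersionGerm (q := q) f)
    (h : f =ᶠ[𝓝 0] g) : IsImmersionGerm (q := q) g := by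
  refine ⟨?_, ?_⟩
  · filter_upwards [hf.1, h.eventually_nhds] with t h1 h2
    exact h1.congr_of_eventuallyEq (Filter.EventuallyEq.symm h2)
  · rw [← h.mfderiv_eq]
    have := hf.2
    exact this

/-- Used with `Ψ` an inverse transformation, to see that a transformation preserves immersions, and
with `Ψ` the submersion, to see that lifts are immersed. -/
theorem IsImmersionGerm.of_comp {f : (Fin p → ℝ) → M} {Ψ : M → N}
    (hf : ∀ᶠ t in 𝓝 0, ContMDiffAt 𝓘(ℝ, Fin p → ℝ) 𝓘(ℝ, Coord p q) ∞ f t)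
    (hΨ : ContMDiffAt 𝓘(ℝ, Coord p q) 𝓘(ℝ, Coord p r) ∞ Ψ (f 0))
    (h : IsImmersionGerm (q := r) (Ψ ∘ f)) : IsImmersionGerm (q := q) f :=
  ⟨hf, injective_mfderiv_of_comp (hf.self_of_nhds.mdifferentiableAt (by simp))
    (hΨ.mdifferentiableAt (by simp)) h.2⟩

theorem isImmersionGerm_iff {c : OpenPartialHomeomorph M (Coord p q)}
    (hc : c ∈ IsManifold.maximalAtlas 𝓘(ℝ, Coord p q) ∞ M) {f : (Fin p → ℝ) → M}
    (hf : ∀ᶠ t in 𝓝 0, ContMDiffAt 𝓘(ℝ, Fin p → ℝ) 𝓘(ℝ, Coord p q) ∞ f t)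
    (hx : f 0 ∈ c.source) :
    IsImmersionGerm (q := q) f ↔ Function.Injective (fderiv ℝ (fun t => c (f t)) 0) := by
  have hfd := hf.self_of_nhds.mdifferentiableAt (by simp)
  have hcd := (contMDiffAt_of_mem_maximalAtlas hc hx).mdifferentiableAt (by simp)
  have hcsd := (contMDiffAt_symm_of_mem_maximalAtlas hc (c.map_source hx)).mdifferentiableAt
    (by simp)
  rw [← mfderiv_eq_fderiv]
  constructor
  · rintro ⟨-, h⟩
    refine injective_mfderiv_of_comp (f := fun t => c (f t)) (Ψ := c.symm) (hcd.comp 0 hfd)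
      hcsd ?_
    have : (c.symm ∘ fun t => c (f t)) =ᶠ[𝓝 0] f := by
      filter_upwards [hfd.continuousAt.eventually (c.open_source.mem_nhds hx)] with t ht
      exact c.left_inv ht
    rw [this.mfderiv_eq]
    intro v w hvw
    exact h hvw
  · intro h
    exact ⟨hf, injective_mfderiv_of_comp (Ψ := c) hfd hcd h⟩

variable [IsManifold 𝓘(ℝ, Coord p q) ∞ M]

theorem sameDerivs_iff {c : OpenPartialHomeomorph M (Coord p q)}
    (hc : c ∈ IsManifold.maximalAtlas 𝓘(ℝ, Coord p q) ∞ M) {f g : (Fin p → ℝ) → M}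
    (hf : ContMDiffAt 𝓘(ℝ, Fin p → ℝ) 𝓘(ℝ, Coord p q) ∞ f 0)
    (hg : ContMDiffAt 𝓘(ℝ, Fin p → ℝ) 𝓘(ℝ, Coord p q) ∞ g 0)
    (hx : f 0 ∈ c.source) {k : ℕ} :
    SameDerivs q k f g ↔
      f 0 = g 0 ∧ EqDerivs k (fun s => c (f s)) (fun s => c (g s)) 0 := by
  have hc' := IsManifold.chart_mem_maximalAtlas (I := 𝓘(ℝ, Coord p q)) (n := ∞) (f 0)
  have hcoe : (extChartAt 𝓘(ℝ, Coord p q) (f 0) : M → Coord p q) = chartAt (Coord p q) (f 0) := by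
    simp only [mfld_simps]
  unfold SameDerivs
  rw [hcoe]
  refine and_congr_right fun hfg => ⟨fun h => ?_, fun h => ?_⟩
  · exact eqDerivs_chart_comp (Φ := id) hc' hc contMDiffAt_id hf hg hfg
      (mem_chart_source _ _) hx h
  · exact eqDerivs_chart_comp (Φ := id) hc hc' contMDiffAt_id hf hg hfg hx
      (mem_chart_source _ _) h

/-! ### Adapted charts -/

/-- A left inverse `g` of `L` splits the space as the range of `L` plus `ker g`, and `ker g` has
dimension `q`. -/
theorem exists_linearEquiv_fst_comp_eq_id (L : (Fin p → ℝ) →L[ℝ] Coord p q)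
    (hL : Function.Injective L) :
    ∃ A : Coord p q ≃L[ℝ] Coord p q, ∀ v, (A (L v)).1 = v := by
  obtain ⟨g, hg⟩ := LinearMap.exists_leftInverse_of_injective (L : (Fin p → ℝ) →ₗ[ℝ] Coord p q)
    (LinearMap.ker_eq_bot.2 hL)
  have hg' : ∀ v, g (L v) = v := fun v => DFunLike.congr_fun hg v
  have hgs : Function.Surjective g := fun v => ⟨L v, hg' v⟩
  have hdim : Module.finrank ℝ (LinearMap.ker g) = Module.finrank ℝ (Fin q → ℝ) := by
    have h1 := LinearMap.finrank_range_add_finrank_ker g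
    rw [LinearMap.range_eq_top.2 hgs, finrank_top] at h1
    simp [Coord] at h1 ⊢
    omega
  let e : LinearMap.ker g ≃ₗ[ℝ] (Fin q → ℝ) := LinearEquiv.ofFinrankEq _ _ hdim
  let π : Coord p q →ₗ[ℝ] LinearMap.ker g :=
    LinearMap.codRestrict _ (LinearMap.id - (L : (Fin p → ℝ) →ₗ[ℝ] Coord p q) ∘ₗ g)
      (fun v => by simp [hg'])
  -- The first component is `g`, the second the projection `v - L (g v)` onto `ker g`, identified
  -- with `ℝ^q`.
  let A₀ : Coord p q →ₗ[ℝ] Coord p q := g.prod (e.toLinearMap ∘ₗ π)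
  have hinj : Function.Injective A₀ := by
    rw [← LinearMap.ker_eq_bot, LinearMap.ker_eq_bot']
    intro v hv
    have h1 : g v = 0 := congrArg Prod.fst hv
    have h2 : e (π v) = 0 := congrArg Prod.snd hv
    have h3 : π v = 0 := by simpa using h2
    have h4 : v - L (g v) = 0 := congrArg Subtype.val h3
    simpa [h1] using h4
  refine ⟨(LinearEquiv.ofInjectiveEndo A₀ hinj).toContinuousLinearEquiv, fun v => ?_⟩
  exact hg' v

/-- A linear change of a chart at `f 0` makes the tangent space of the submanifold transverse to the
fibers `x = const`. Jet coordinates describe only graphs, so this is what makes them available at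
every jet. -/
theorem exists_adapted_chart {f : (Fin p → ℝ) → M} (hf : IsImmersionGerm (q := q) f) :
    ∃ d ∈ IsManifold.maximalAtlas 𝓘(ℝ, Coord p q) ∞ M, f 0 ∈ d.source ∧
      (fderiv ℝ (fun t => (d (f t)).1) 0).IsInvertible := by
  set c := chartAt (Coord p q) (f 0) with hcdef
  have hc : c ∈ IsManifold.maximalAtlas 𝓘(ℝ, Coord p q) ∞ M :=
    IsManifold.chart_mem_maximalAtlas (I := 𝓘(ℝ, Coord p q)) (n := ∞) (f 0)
  have hx : f 0 ∈ c.source := mem_chart_source _ _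
  have hinj := (isImmersionGerm_iff hc hf.1 hx).1 hf
  obtain ⟨A, hA⟩ := exists_linearEquiv_fst_comp_eq_id _ hinj
  refine ⟨c.transHomeomorph A.toHomeomorph, ?_, hx, ?_⟩
  · refine OpenPartialHomeomorph.mem_maximalAtlas_of_contMDiffOn _ ?_ ?_
    · exact A.contDiff.contMDiff.comp_contMDiffOn (contMDiffOn_of_mem_maximalAtlas hc)
    · exact (contMDiffOn_symm_of_mem_maximalAtlas hc).comp
        A.symm.contDiff.contMDiff.contMDiffOn (fun y hy => hy)
  · have hd : HasFDerivAt (fun t => ((c.transHomeomorph A.toHomeomorph) (f t)).1)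
        (ContinuousLinearMap.id ℝ (Fin p → ℝ)) 0 := by
      have h1 := ((contDiffAt_chart_comp hc hf.1.self_of_nhds hx).differentiableAt
        (by simp)).hasFDerivAt
      have h2 := hasFDerivAt_fst.comp (0 : Fin p → ℝ)
        (A.hasFDerivAt.comp (0 : Fin p → ℝ) h1)
      convert! h2 using 1
      ext1 v
      exact (hA v).symm
    rw [hd.fderiv]
    exact ⟨ContinuousLinearEquiv.refl ℝ _, rfl⟩

end Charts

/-! ### Reparametrizations, and contact as an equivalence relation. -/

section Contact

variable {p q : ℕ} {M : Type*} [TopologicalSpace M] [ChartedSpace (Coord p q) M]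

theorem ImmersionGerm.contMDiffAt (f : ImmersionGerm p q M) :
    ContMDiffAt 𝓘(ℝ, Fin p → ℝ) 𝓘(ℝ, Coord p q) ∞ f.1 0 := f.2.1.self_of_nhds

/-- Smooth local diffeomorphisms of `ℝ^p` that fix the origin. -/
structure IsReparam (φ : OpenPartialHomeomorph (Fin p → ℝ) (Fin p → ℝ)) : Prop where
  zero_mem : (0 : Fin p → ℝ) ∈ φ.source
  map_zero : φ 0 = 0
  smooth : ContDiffOn ℝ ∞ φ φ.source
  smooth_symm : ContDiffOn ℝ ∞ φ.symm φ.target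

namespace IsReparam

variable {φ ψ : OpenPartialHomeomorph (Fin p → ℝ) (Fin p → ℝ)}

theorem contDiffAt (h : IsReparam φ) : ContDiffAt ℝ ∞ φ 0 :=
  h.smooth.contDiffAt (φ.open_source.mem_nhds h.zero_mem)

theorem eventually_contDiffAt (h : IsReparam φ) : ∀ᶠ t in 𝓝 0, ContDiffAt ℝ ∞ φ t := by
  filter_upwards [φ.open_source.mem_nhds h.zero_mem] with t ht
  exact h.smooth.contDiffAt (φ.open_source.mem_nhds ht)

theorem refl : IsReparam (OpenPartialHomeomorph.refl (Fin p → ℝ)) :=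
  ⟨trivial, rfl, contDiffOn_id, contDiffOn_id⟩

theorem symm (h : IsReparam φ) : IsReparam φ.symm := by
  refine ⟨?_, ?_, h.smooth_symm, h.smooth⟩
  · have := φ.map_source h.zero_mem
    rwa [h.map_zero] at this
  · have := φ.left_inv h.zero_mem
    rwa [h.map_zero] at this

theorem trans (h : IsReparam φ) (h' : IsReparam ψ) : IsReparam (φ.trans ψ) := by
  refine ⟨?_, ?_, ?_, ?_⟩
  · rw [OpenPartialHomeomorph.trans_source]
    exact ⟨h.zero_mem, by simpa [h.map_zero] using h'.zero_mem⟩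
  · simp [h.map_zero, h'.map_zero]
  · rw [OpenPartialHomeomorph.trans_source]
    exact h'.smooth.comp (h.smooth.mono Set.inter_subset_left) fun t ht => ht.2
  · rw [OpenPartialHomeomorph.trans_target]
    exact h.smooth_symm.comp (h'.smooth_symm.mono Set.inter_subset_left) fun t ht => ht.2

theorem isInvertible_fderiv (h : IsReparam φ) : (fderiv ℝ φ 0).IsInvertible := by
  have h1 := (h.contDiffAt.differentiableAt (by simp)).hasFDerivAt
  have h2 := (h.symm.contDiffAt.differentiableAt (by simp)).hasFDerivAt
  have e1 : (fderiv ℝ φ.symm 0).comp (fderiv ℝ φ 0) = ContinuousLinearMap.id ℝ _ := by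
    have h3 := HasFDerivAt.comp (g := φ.symm) (0 : Fin p → ℝ) (by rwa [h.map_zero]) h1
    refine (h3.congr_of_eventuallyEq ?_).unique (hasFDerivAt_id _)
    filter_upwards [φ.open_source.mem_nhds h.zero_mem] with t ht
    exact (φ.left_inv ht).symm
  have e2 : (fderiv ℝ φ 0).comp (fderiv ℝ φ.symm 0) = ContinuousLinearMap.id ℝ _ := by
    have h3 := HasFDerivAt.comp (g := φ) (0 : Fin p → ℝ) (by rwa [h.symm.map_zero]) h2
    refine (h3.congr_of_eventuallyEq ?_).unique (hasFDerivAt_id _)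
    filter_upwards [φ.open_target.mem_nhds h.symm.zero_mem] with t ht
    exact (φ.right_inv ht).symm
  exact ⟨ContinuousLinearEquiv.equivOfInverse _ _ (DFunLike.congr_fun e1) (DFunLike.congr_fun e2),
    rfl⟩

theorem contMDiffAt_comp (h : IsReparam φ) {f : (Fin p → ℝ) → M}
    (hf : ContMDiffAt 𝓘(ℝ, Fin p → ℝ) 𝓘(ℝ, Coord p q) ∞ f 0) :
    ContMDiffAt 𝓘(ℝ, Fin p → ℝ) 𝓘(ℝ, Coord p q) ∞ (f ∘ φ) 0 :=
  ContMDiffAt.comp (g := f) 0 (by rwa [h.map_zero]) h.contDiffAt.contMDiffAt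

theorem eventually_contMDiffAt_comp (h : IsReparam φ) {f : (Fin p → ℝ) → M}
    (hf : ∀ᶠ t in 𝓝 0, ContMDiffAt 𝓘(ℝ, Fin p → ℝ) 𝓘(ℝ, Coord p q) ∞ f t) :
    ∀ᶠ t in 𝓝 0, ContMDiffAt 𝓘(ℝ, Fin p → ℝ) 𝓘(ℝ, Coord p q) ∞ (f ∘ φ) t := by
  have h1 : Filter.Tendsto φ (𝓝 0) (𝓝 0) := by
    have := h.contDiffAt.continuousAt
    rwa [ContinuousAt, h.map_zero] at this
  filter_upwards [h.eventually_contDiffAt, h1.eventually hf] with t h2 h3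
  exact ContMDiffAt.comp t h3 h2.contMDiffAt

/-- A smooth map of `ℝ^p` with invertible derivative that fixes the origin is a reparametrization. -/
theorem exists_of_fderiv {g : (Fin p → ℝ) → (Fin p → ℝ)}
    (hg : ∀ᶠ t in 𝓝 0, ContDiffAt ℝ ∞ g t) (hinv : (fderiv ℝ g 0).IsInvertible) (h0 : g 0 = 0) :
    ∃ φ : OpenPartialHomeomorph (Fin p → ℝ) (Fin p → ℝ), IsReparam φ ∧ ∀ t, φ t = g t := by
  obtain ⟨φ, h1, h2, h3, h4⟩ := exists_smooth_openPartialHomeomorph hg hinv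
  exact ⟨φ, ⟨h1, by rw [h2, h0], h3, h4⟩, h2⟩

end IsReparam

theorem hasContact_iff {k : ℕ} {f g : ImmersionGerm p q M} :
    HasContact k f g ↔ ∃ φ, IsReparam φ ∧ SameDerivs q k f.1 (g.1 ∘ φ) :=
  ⟨fun ⟨φ, h1, h2, h3, h4, h5⟩ => ⟨φ, ⟨h1, h2, h3, h4⟩, h5⟩,
    fun ⟨φ, ⟨h1, h2, h3, h4⟩, h5⟩ => ⟨φ, h1, h2, h3, h4, h5⟩⟩

theorem HasContact.of_le {k l : ℕ} {f g : ImmersionGerm p q M} (h : HasContact l f g)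
    (hkl : k ≤ l) : HasContact k f g := by
  obtain ⟨φ, h1, h2, h3, h4, h5, h6⟩ := h
  exact ⟨φ, h1, h2, h3, h4, h5, fun i hi => h6 i (hi.trans hkl)⟩

theorem HasContact.refl (k : ℕ) (f : ImmersionGerm p q M) : HasContact k f f :=
  hasContact_iff.2 ⟨_, IsReparam.refl, rfl, fun _ _ => rfl⟩

variable [IsManifold 𝓘(ℝ, Coord p q) ∞ M]

theorem hasContact_iff_chart {c : OpenPartialHomeomorph M (Coord p q)}
    (hc : c ∈ IsManifold.maximalAtlas 𝓘(ℝ, Coord p q) ∞ M) {k : ℕ} {f g : ImmersionGerm p q M}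
    (hx : f.1 0 ∈ c.source) :
    HasContact k f g ↔ f.1 0 = g.1 0 ∧ ∃ φ, IsReparam φ ∧
      EqDerivs k (fun t => c (f.1 t)) (fun t => c (g.1 (φ t))) 0 := by
  rw [hasContact_iff]
  constructor
  · rintro ⟨φ, hφ, h⟩
    rw [sameDerivs_iff hc f.contMDiffAt (hφ.contMDiffAt_comp g.contMDiffAt) hx] at h
    exact ⟨by simpa [hφ.map_zero] using h.1, φ, hφ, h.2⟩
  · rintro ⟨h0, φ, hφ, h⟩
    refine ⟨φ, hφ, ?_⟩
    rw [sameDerivs_iff hc f.contMDiffAt (hφ.contMDiffAt_comp g.contMDiffAt) hx]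
    exact ⟨by simpa [hφ.map_zero] using h0, h⟩

theorem HasContact.symm {k : ℕ} {f g : ImmersionGerm p q M} (h : HasContact k f g) :
    HasContact k g f := by
  have hc := IsManifold.chart_mem_maximalAtlas (I := 𝓘(ℝ, Coord p q)) (n := ∞) (f.1 0)
  have hx : f.1 0 ∈ (chartAt (Coord p q) (f.1 0)).source := mem_chart_source _ _
  obtain ⟨h0, φ, hφ, h⟩ := (hasContact_iff_chart hc hx).1 h
  have hx' : g.1 0 ∈ (chartAt (Coord p q) (f.1 0)).source := h0 ▸ hx
  refine (hasContact_iff_chart hc hx').2 ⟨h0.symm, φ.symm, hφ.symm, ?_⟩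
  set c := chartAt (Coord p q) (f.1 0)
  have hφ0 := hφ.symm.map_zero
  have hcf := (contDiffAt_chart_comp hc f.contMDiffAt hx).of_infty k
  have hcg : ContDiffAt ℝ k (fun t => c (g.1 (φ t))) 0 :=
    (contDiffAt_chart_comp hc (hφ.contMDiffAt_comp g.contMDiffAt)
      (by simpa [hφ.map_zero] using hx')).of_infty k
  have h1 := EqDerivs.comp_right (Φ := fun t => c (f.1 t)) (Ψ := fun t => c (g.1 (φ t)))
    (f := φ.symm) (x := 0) (by rwa [hφ0]) (by rwa [hφ0])
    (hφ.symm.contDiffAt.of_infty k) (by rw [hφ0]; exact h)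
  refine EqDerivs.symm (h1.trans (EqDerivs.of_eventuallyEq k ?_))
  filter_upwards [φ.open_target.mem_nhds hφ.symm.zero_mem] with t ht
  simp [φ.right_inv ht]

theorem HasContact.trans {k : ℕ} {f g h : ImmersionGerm p q M} (h₁ : HasContact k f g)
    (h₂ : HasContact k g h) : HasContact k f h := by
  have hc := IsManifold.chart_mem_maximalAtlas (I := 𝓘(ℝ, Coord p q)) (n := ∞) (f.1 0)
  have hx : f.1 0 ∈ (chartAt (Coord p q) (f.1 0)).source := mem_chart_source _ _
  obtain ⟨h0, φ, hφ, h1⟩ := (hasContact_iff_chart hc hx).1 h₁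
  have hx' : g.1 0 ∈ (chartAt (Coord p q) (f.1 0)).source := h0 ▸ hx
  obtain ⟨h0', ψ, hψ, h2⟩ := (hasContact_iff_chart hc hx').1 h₂
  refine (hasContact_iff_chart hc hx).2 ⟨h0.trans h0', _, hφ.trans hψ, h1.trans ?_⟩
  have hcg := (contDiffAt_chart_comp hc g.contMDiffAt hx').of_infty k
  have hch : ContDiffAt ℝ k (fun t => chartAt (Coord p q) (f.1 0) (h.1 (ψ t))) 0 :=
    (contDiffAt_chart_comp hc (hψ.contMDiffAt_comp h.contMDiffAt)
      (by simpa [hψ.map_zero, ← h0'] using hx')).of_infty k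
  exact EqDerivs.comp_right (Φ := fun t => chartAt (Coord p q) (f.1 0) (g.1 t))
    (Ψ := fun t => chartAt (Coord p q) (f.1 0) (h.1 (ψ t))) (f := φ) (x := 0) (by rwa [hφ.map_zero]) (by rwa [hφ.map_zero])
    (hφ.contDiffAt.of_infty k) (by rw [hφ.map_zero]; exact h2)

namespace Jet

/-- A quotient identifies along the generated equivalence relation; contact is already an
equivalence, so equality of jets gives contact directly. For `k = ∞` the reparametrization may
depend on the order. -/
theorem mk_eq_mk_iff {k : ℕ∞} {f g : ImmersionGerm p q M} :
    mk k f = mk k g ↔ ∀ i : ℕ, (i : ℕ∞) ≤ k → HasContact i f g := by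
  refine ⟨fun h => ?_, fun h => Quot.sound h⟩
  have he : Equivalence fun f g : ImmersionGerm p q M =>
      ∀ i : ℕ, (i : ℕ∞) ≤ k → HasContact i f g :=
    ⟨fun f i _ => HasContact.refl i f, fun h i hi => (h i hi).symm,
      fun h h' i hi => (h i hi).trans (h' i hi)⟩
  exact he.eqvGen_iff.1 (Quot.eqvGen_exact h)

theorem mk_eq_mk_iff_nat {k : ℕ} {f g : ImmersionGerm p q M} :
    mk (k : ℕ∞) f = mk k g ↔ HasContact k f g :=
  mk_eq_mk_iff.trans ⟨fun h => h k le_rfl, fun h _ hi => h.of_le (by exact_mod_cast hi)⟩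

end Jet

end Contact

end

noncomputable section

theorem isOpen_jetCoordDomain {p q : ℕ} {M : Type*} [TopologicalSpace M] (k : ℕ) (c : OpenPartialHomeomorph M (Coord p q)) :
    IsOpen (jetCoordDomain k c) := by
  have h : Continuous fun s : JetCoord p q k => ((s.1, taylorPoly s.2 0) : Coord p q) := by
    refine continuous_fst.prodMk ?_
    exact (contDiff_polyMap_uncurry (E := Fin p → ℝ) (F := Fin q → ℝ) (k := k)).continuous.comp
      (continuous_snd.prodMk continuous_const)
  exact c.open_target.preimage h

/-! ### Smooth families of submanifolds and the smooth structure of finite jet spaces. -/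

section Families

variable {p q : ℕ} {M : Type*} [TopologicalSpace M] [ChartedSpace (Coord p q) M]

/-- The `k`-jet at `0` of a parametrized submanifold, with an arbitrary value if `f` is not an
immersion germ. -/
def germJet (q : ℕ) [ChartedSpace (Coord p q) M] (k : ℕ∞) [Nonempty (Jet p q M k)]
    (f : (Fin p → ℝ) → M) : Jet p q M k :=
  open Classical in
  if h : IsImmersionGerm (q := q) f then Jet.mk k ⟨f, h⟩ else Classical.arbitrary _

/-- An immersion germ as an element of the type of immersion germs. -/
def IsImmersionGerm.toGerm {f : (Fin p → ℝ) → M} (h : IsImmersionGerm (q := q) f) :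
    ImmersionGerm p q M := ⟨f, h⟩

@[simp] theorem IsImmersionGerm.coe_toGerm {f : (Fin p → ℝ) → M}
    (h : IsImmersionGerm (q := q) f) : h.toGerm.1 = f := rfl

theorem germJet_eq_mk {k : ℕ∞} [Nonempty (Jet p q M k)] {f : (Fin p → ℝ) → M}
    (h : IsImmersionGerm (q := q) f) : germJet q k f = Jet.mk k h.toGerm := dif_pos h

theorem germJet_coe {k : ℕ∞} [Nonempty (Jet p q M k)] (f : ImmersionGerm p q M) :
    germJet q k f.1 = Jet.mk k f := germJet_eq_mk f.2

variable {S : Type*} [NormedAddCommGroup S] [NormedSpace ℝ S]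

/-- `H` is a smooth family, parametrized by `s` near `s₀`, of parametrized submanifolds. -/
def IsSmoothFamily (q : ℕ) [ChartedSpace (Coord p q) M] (H : S → (Fin p → ℝ) → M) (s₀ : S) :
    Prop :=
  ∀ᶠ x in 𝓝 (s₀, (0 : Fin p → ℝ)),
    ContMDiffAt 𝓘(ℝ, S × (Fin p → ℝ)) 𝓘(ℝ, Coord p q) ∞ (fun x => H x.1 x.2) x

theorem IsSmoothFamily.eventually {H : S → (Fin p → ℝ) → M} {s₀ : S}
    (hH : IsSmoothFamily q H s₀) : ∀ᶠ s in 𝓝 s₀, IsSmoothFamily q H s := by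
  have hc : ContinuousAt (fun s : S => (s, (0 : Fin p → ℝ))) s₀ := by fun_prop
  exact hc.eventually hH.eventually_nhds

theorem IsSmoothFamily.eventually_contMDiffAt {H : S → (Fin p → ℝ) → M} {s₀ : S}
    (hH : IsSmoothFamily q H s₀) :
    ∀ᶠ t in 𝓝 0, ContMDiffAt 𝓘(ℝ, Fin p → ℝ) 𝓘(ℝ, Coord p q) ∞ (H s₀) t := by
  have hc : ContinuousAt (fun t : Fin p → ℝ => (s₀, t)) 0 := by fun_prop
  filter_upwards [hc.eventually hH] with t ht
  exact ht.comp t (f := fun t => (s₀, t))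
    (contDiff_prodMk_right s₀).contMDiff.contMDiffAt

theorem IsSmoothFamily.shift {f : (Fin p → ℝ) → M} {s₀ : Fin p → ℝ}
    (hf : ∀ᶠ t in 𝓝 s₀, ContMDiffAt 𝓘(ℝ, Fin p → ℝ) 𝓘(ℝ, Coord p q) ∞ f t) :
    IsSmoothFamily q (fun s t => f (s + t)) s₀ := by
  have hc : Filter.Tendsto (fun x : (Fin p → ℝ) × (Fin p → ℝ) => x.1 + x.2) (𝓝 (s₀, 0))
      (𝓝 s₀) := by
    have : Continuous fun x : (Fin p → ℝ) × (Fin p → ℝ) => x.1 + x.2 := by fun_prop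
    simpa using this.tendsto (s₀, 0)
  filter_upwards [hc.eventually hf] with x hx
  exact ContMDiffAt.comp (g := f) x hx
    (contDiff_fst.add contDiff_snd).contMDiff.contMDiffAt

variable {r : ℕ} {N : Type*} [TopologicalSpace N] [ChartedSpace (Coord p r) N]

theorem IsSmoothFamily.comp {H : S → (Fin p → ℝ) → M} {s₀ : S} (hH : IsSmoothFamily q H s₀)
    {Φ : M → N} (hΦ : ∀ᶠ z in 𝓝 (H s₀ 0),
      ContMDiffAt 𝓘(ℝ, Coord p q) 𝓘(ℝ, Coord p r) ∞ Φ z) :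
    IsSmoothFamily r (fun s t => Φ (H s t)) s₀ := by
  filter_upwards [hH, hH.self_of_nhds.continuousAt.eventually hΦ] with x h1 h2
  exact ContMDiffAt.comp (g := Φ) x h2 h1

theorem isSmoothFamily_chart_symm {c : OpenPartialHomeomorph M (Coord p q)}
    (hc : c ∈ IsManifold.maximalAtlas 𝓘(ℝ, Coord p q) ∞ M)
    {g : S → (Fin p → ℝ) → Coord p q} {s₀ : S}
    (hg : ∀ᶠ x in 𝓝 (s₀, (0 : Fin p → ℝ)), ContDiffAt ℝ ∞ (fun x => g x.1 x.2) x)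
    (hx : g s₀ 0 ∈ c.target) : IsSmoothFamily q (fun s t => c.symm (g s t)) s₀ := by
  filter_upwards [eventually_contMDiffAt_chart_symm_comp hc hg hx] with x h
  exact h.2

theorem isSmoothFamily_graphMap {k : ℕ} {c : OpenPartialHomeomorph M (Coord p q)}
    (hc : c ∈ IsManifold.maximalAtlas 𝓘(ℝ, Coord p q) ∞ M) {s : JetCoord p q k}
    (hs : s ∈ jetCoordDomain k c) : IsSmoothFamily q (graphMap c) s := by
  refine isSmoothFamily_chart_symm (g := fun s : JetCoord p q k => fun t =>
    ((s.1 + t, taylorPoly s.2 t) : Coord p q)) hc ?_ ?_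
  · refine Filter.Eventually.of_forall fun x => ContDiff.contDiffAt ?_
    refine ContDiff.prodMk ((contDiff_fst.comp contDiff_fst).add contDiff_snd) ?_
    exact (contDiff_polyMap_uncurry (E := Fin p → ℝ) (F := Fin q → ℝ) (k := k)).comp
      ((contDiff_snd.comp contDiff_fst).prodMk contDiff_snd)
  · simpa [jetCoordDomain] using hs

/-- Since the coordinate domain is open, openness in the subtype can be replaced by openness in the
whole space of jet coordinates. -/
theorem isOpen_jet_iff {k : ℕ} {W : Set (Jet p q M (k : ℕ∞))} :
    IsOpen W ↔ ∀ (c : OpenPartialHomeomorph M (Coord p q))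
      (hc : c ∈ IsManifold.maximalAtlas 𝓘(ℝ, Coord p q) ∞ M),
      IsOpen {s | ∃ h : s ∈ jetCoordDomain k c, jetParam k hc ⟨s, h⟩ ∈ W} := by
  have : IsOpen W ↔ ∀ (c : OpenPartialHomeomorph M (Coord p q))
      (hc : c ∈ IsManifold.maximalAtlas 𝓘(ℝ, Coord p q) ∞ M),
      IsOpen (jetParam k hc ⁻¹' W) := by
    change IsOpen[⨆ (c : OpenPartialHomeomorph M (Coord p q))
      (hc : c ∈ IsManifold.maximalAtlas 𝓘(ℝ, Coord p q) ∞ M),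
      TopologicalSpace.coinduced (jetParam k hc) inferInstance] W ↔ _
    simp only [isOpen_iSup_iff, isOpen_coinduced]
  rw [this]
  refine forall₂_congr fun c hc => ?_
  rw [(isOpen_jetCoordDomain k c).isOpenEmbedding_subtypeVal.isOpen_iff_image_isOpen]
  have : (Subtype.val '' (jetParam k hc ⁻¹' W)) =
      {s | ∃ h : s ∈ jetCoordDomain k c, jetParam k hc ⟨s, h⟩ ∈ W} := by
    ext s
    simp
  rw [this]

variable [IsManifold 𝓘(ℝ, Coord p q) ∞ M] [Nonempty M]

theorem germJet_eq_iff {k : ℕ} {f g : (Fin p → ℝ) → M} (hf : IsImmersionGerm (q := q) f)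
    (hg : IsImmersionGerm (q := q) g) :
    germJet q (k : ℕ∞) f = germJet q k g ↔ HasContact k hf.toGerm hg.toGerm := by
  rw [germJet_eq_mk hf, germJet_eq_mk hg, Jet.mk_eq_mk_iff_nat]

theorem jetParam_eq_germJet {k : ℕ} {c : OpenPartialHomeomorph M (Coord p q)}
    (hc : c ∈ IsManifold.maximalAtlas 𝓘(ℝ, Coord p q) ∞ M) (s : jetCoordDomain k c) :
    jetParam k hc s = germJet q k (graphMap c s.1) :=
  (germJet_eq_mk (isImmersionGerm_graphMap hc s.2)).symm

/-- The germ is a reparametrization of the graph of `w`, and this graph and the graph of the Taylor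
polynomial of `w` have the same derivatives up to order `k`. -/
theorem germJet_eq_jetParam_of_graph {d : OpenPartialHomeomorph M (Coord p q)}
    (hd : d ∈ IsManifold.maximalAtlas 𝓘(ℝ, Coord p q) ∞ M) {f : (Fin p → ℝ) → M}
    (hf : ∀ᶠ t in 𝓝 0, ContMDiffAt 𝓘(ℝ, Fin p → ℝ) 𝓘(ℝ, Coord p q) ∞ f t)
    (hx : f 0 ∈ d.source) {w : (Fin p → ℝ) → (Fin q → ℝ)}
    (hinv : (fderiv ℝ (fun t => (d (f t)).1) 0).IsInvertible)
    (hw : ∀ᶠ y in 𝓝 (d (f 0)).1, ContDiffAt ℝ ∞ w y)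
    (hwf : ∀ᶠ t in 𝓝 0, w (d (f t)).1 = (d (f t)).2) (k : ℕ) :
    IsImmersionGerm (q := q) f ∧
    ∃ h : (((d (f 0)).1, fun i => iteratedFDeriv ℝ i w (d (f 0)).1) : JetCoord p q k) ∈
      jetCoordDomain k d,
      germJet q (k : ℕ∞) f = jetParam k hd ⟨_, h⟩ := by
  have hdf := eventually_contDiffAt_chart_comp hd hf hx
  have hg : ∀ᶠ t in 𝓝 0, ContDiffAt ℝ ∞ (fun t => (d (f t)).1) t :=
    hdf.mono fun t ht => ht.2.fst
  have himm : IsImmersionGerm (q := q) f := by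
    rw [isImmersionGerm_iff hd hf hx]
    have h1 : fderiv ℝ (fun t => (d (f t)).1) 0 =
        (ContinuousLinearMap.fst ℝ _ _).comp (fderiv ℝ (fun t => d (f t)) 0) :=
      (hasFDerivAt_fst.comp (0 : Fin p → ℝ)
        (hdf.self_of_nhds.2.differentiableAt (by simp)).hasFDerivAt).fderiv
    have h2 := hinv.injective
    rw [h1] at h2
    exact Function.Injective.of_comp (f := Prod.fst) h2
  have hpoly := eqDerivs_polyMap (k := k) hw
  have hp0 : taylorPoly (fun i : Fin (k + 1) => iteratedFDeriv ℝ i w (d (f 0)).1) 0 =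
      (d (f 0)).2 := by
    have := hpoly.eq
    simp only [add_zero] at this
    exact this.trans hwf.self_of_nhds
  have hmem : (((d (f 0)).1, fun i => iteratedFDeriv ℝ i w (d (f 0)).1) : JetCoord p q k) ∈
      jetCoordDomain k d := by
    change ((d (f 0)).1, _) ∈ d.target
    rw [hp0]
    exact d.map_source hx
  refine ⟨himm, hmem, ?_⟩
  rw [jetParam_eq_germJet, germJet_eq_iff himm (isImmersionGerm_graphMap hd hmem),
    hasContact_iff_chart hd (by simpa using hx)]
  refine ⟨?_, ?_⟩
  · change f 0 = d.symm ((d (f 0)).1 + 0, taylorPoly _ 0)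
    rw [hp0, add_zero, Prod.mk.eta, d.left_inv hx]
  -- The reparametrization sends `t` to the displacement of the `x`-coordinates from the base point,
  -- since `graphMap` is parametrized by that displacement.
  have hg' : ∀ᶠ t in 𝓝 0, ContDiffAt ℝ ∞ (fun t => (d (f t)).1 - (d (f 0)).1) t :=
    hg.mono fun t ht => ht.sub contDiffAt_const
  obtain ⟨φ, hφ, hφg⟩ := IsReparam.exists_of_fderiv hg' (by rwa [fderiv_sub_const]) (by simp)
  refine ⟨φ, hφ, ?_⟩
  have e1 : (fun t => d (f t)) =ᶠ[𝓝 0]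
      (fun y => (((d (f 0)).1 + y, 0) : Coord p q) +
        ContinuousLinearMap.inr ℝ (Fin p → ℝ) (Fin q → ℝ) (w ((d (f 0)).1 + y))) ∘ φ := by
    filter_upwards [hwf] with t ht
    ext1 <;> simp [hφg, ht]
  have hcont : ContinuousAt (fun t => (((d (f 0)).1 + φ t, taylorPoly
      (fun i : Fin (k + 1) => iteratedFDeriv ℝ i w (d (f 0)).1) (φ t)) : Coord p q)) 0 :=
    (continuousAt_const.add hφ.contDiffAt.continuousAt).prodMk
      ((contDiff_taylorPoly _).continuous.continuousAt.comp hφ.contDiffAt.continuousAt)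
  have e2 : (fun t => d (graphMap d
        (((d (f 0)).1, fun i => iteratedFDeriv ℝ i w (d (f 0)).1) : JetCoord p q k) (φ t)))
      =ᶠ[𝓝 0] (fun y => (((d (f 0)).1 + y, 0) : Coord p q) +
        ContinuousLinearMap.inr ℝ (Fin p → ℝ) (Fin q → ℝ)
          (taylorPoly (fun i : Fin (k + 1) => iteratedFDeriv ℝ i w (d (f 0)).1) y)) ∘ φ := by
    have h0 : (((d (f 0)).1 + φ 0, taylorPoly
        (fun i : Fin (k + 1) => iteratedFDeriv ℝ i w (d (f 0)).1) (φ 0)) : Coord p q) ∈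
        d.target := by
      rw [hφ.map_zero, add_zero]; exact hmem
    filter_upwards [hcont.eventually (d.open_target.mem_nhds h0)] with t ht
    simp only [graphMap, d.right_inv ht]
    ext1 <;> simp
  refine (EqDerivs.of_eventuallyEq k e1).trans (EqDerivs.trans ?_
    (EqDerivs.of_eventuallyEq k e2).symm)
  have hw0 : ContDiffAt ℝ k (fun y => w ((d (f 0)).1 + y)) 0 := by
    refine ContDiffAt.comp (g := w) 0 ?_ (contDiffAt_const.add contDiffAt_id)
    simpa using hw.self_of_nhds.of_infty k
  have hT0 : ContDiffAt ℝ k (taylorPoly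
      (fun i : Fin (k + 1) => iteratedFDeriv ℝ i w (d (f 0)).1)) 0 :=
    (contDiff_taylorPoly _).contDiffAt.of_infty k
  have hi : ContDiff ℝ k (ContinuousLinearMap.inr ℝ (Fin p → ℝ) (Fin q → ℝ)) :=
    ContinuousLinearMap.contDiff _
  have hl : ContDiffAt ℝ k (fun y => (((d (f 0)).1 + y, 0) : Coord p q)) 0 :=
    (contDiffAt_const.add contDiffAt_id).prodMk contDiffAt_const
  have h1 := hi.contDiffAt.comp 0 hw0
  have h2 := hi.contDiffAt.comp 0 hT0
  refine EqDerivs.comp_right ?_ ?_ (hφ.contDiffAt.of_infty k) ?_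
  · rw [hφ.map_zero]; exact hl.add h1
  · rw [hφ.map_zero]; exact hl.add h2
  · rw [hφ.map_zero]
    exact EqDerivs.add hl hl h1 h2 (EqDerivs.refl _ _ _)
      (EqDerivs.comp_left hi.contDiffAt hw0 hT0 hpoly.symm)

/-- In suitable jet coordinates, the jets of a smooth family of submanifolds depend smoothly on
the parameter. -/
theorem IsSmoothFamily.exists_jetCoord {H : S → (Fin p → ℝ) → M} {s₀ : S}
    (hH : IsSmoothFamily q H s₀) (himm : IsImmersionGerm (q := q) (H s₀)) (k : ℕ) :
    ∃ (d : OpenPartialHomeomorph M (Coord p q))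
      (hd : d ∈ IsManifold.maximalAtlas 𝓘(ℝ, Coord p q) ∞ M) (T : S → JetCoord p q k),
      ContDiffAt ℝ ∞ T s₀ ∧ ∀ᶠ s in 𝓝 s₀, IsImmersionGerm (q := q) (H s) ∧
        ∃ h : T s ∈ jetCoordDomain k d, germJet q (k : ℕ∞) (H s) = jetParam k hd ⟨T s, h⟩ := by
  obtain ⟨d, hd, hx, hinv⟩ := exists_adapted_chart himm
  let Y : S × (Fin p → ℝ) → (Fin p → ℝ) := fun x => (d (H x.1 x.2)).1
  let V : S × (Fin p → ℝ) → (Fin q → ℝ) := fun x => (d (H x.1 x.2)).2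
  let T : S → JetCoord p q k := fun s => (Y (s, 0), fun i => graphDeriv Y V i (s, 0))
  have hdH := eventually_contDiffAt_chart_comp hd hH hx
  have hY : ∀ᶠ x in 𝓝 (s₀, (0 : Fin p → ℝ)), ContDiffAt ℝ ∞ Y x := hdH.mono fun x hx => hx.2.fst
  have hV : ∀ᶠ x in 𝓝 (s₀, (0 : Fin p → ℝ)), ContDiffAt ℝ ∞ V x := hdH.mono fun x hx => hx.2.snd
  have hinv₀ : ((fderiv ℝ Y (s₀, 0)).comp (ContinuousLinearMap.inr ℝ S _)).IsInvertible := by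
    rw [← fderiv_comp_prodMk_right (hY.self_of_nhds.differentiableAt (by simp))]
    exact hinv
  have hinv' : ∀ᶠ x in 𝓝 (s₀, (0 : Fin p → ℝ)),
      ((fderiv ℝ Y x).comp (ContinuousLinearMap.inr ℝ S _)).IsInvertible :=
    ((hY.self_of_nhds.fderiv_right (m := 0) (by simp)).clm_comp
      contDiffAt_const).continuousAt.eventually (isOpen_isInvertible.mem_nhds hinv₀)
  have hc : ContinuousAt (fun s : S => (s, (0 : Fin p → ℝ))) s₀ := by fun_prop
  have hcd : ContDiffAt ℝ ∞ (fun s : S => (s, (0 : Fin p → ℝ))) s₀ :=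
    contDiffAt_id.prodMk contDiffAt_const
  refine ⟨d, hd, T, ?_, ?_⟩
  · refine ContDiffAt.prodMk (ContDiffAt.comp (g := Y) s₀ hY.self_of_nhds hcd) (contDiffAt_pi.2 fun i => ?_)
    exact (contDiffAt_graphDeriv hY hV hinv₀ i).comp s₀ hcd
  · filter_upwards [hH.eventually, hc.eventually hdH.eventually_nhds, hc.eventually hinv']
      with s h1 h2 h3
    have hYs : ∀ᶠ x in 𝓝 (s, (0 : Fin p → ℝ)), ContDiffAt ℝ ∞ Y x := h2.mono fun x hx => hx.2.fst
    have hVs : ∀ᶠ x in 𝓝 (s, (0 : Fin p → ℝ)), ContDiffAt ℝ ∞ V x := h2.mono fun x hx => hx.2.snd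
    have hct : ContinuousAt (fun t : Fin p → ℝ => (s, t)) 0 := by fun_prop
    have hg : ∀ᶠ t in 𝓝 0, ContDiffAt ℝ ∞ (fun t => Y (s, t)) t :=
      (hct.eventually hYs).mono fun t ht => ht.comp t (contDiff_prodMk_right s).contDiffAt
    have hgi : (fderiv ℝ (fun t => Y (s, t)) 0).IsInvertible := by
      rw [fderiv_comp_prodMk_right (hYs.self_of_nhds.differentiableAt (by simp))]
      exact h3
    obtain ⟨φ, hφ0, hφ, hφs, hφs'⟩ := exists_smooth_openPartialHomeomorph hg hgi
    -- The function whose graph is the submanifold `H s`. It is built separately for each `s`;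
    -- smoothness in `s` is read off from `T`, which does not involve `w`.
    let w : (Fin p → ℝ) → (Fin q → ℝ) := fun y => V (s, φ.symm y)
    have hφt : Y (s, 0) ∈ φ.target := by rw [← hφ 0]; exact φ.map_source hφ0
    have hsymm0 : φ.symm (Y (s, 0)) = 0 := by rw [← hφ 0, φ.left_inv hφ0]
    have hw : ∀ᶠ y in 𝓝 (Y (s, 0)), ContDiffAt ℝ ∞ w y := by
      have hcs : Filter.Tendsto (fun y => (s, φ.symm y)) (𝓝 (Y (s, 0))) (𝓝 (s, 0)) := by
        have h := (φ.continuousAt_symm hφt)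
        rw [ContinuousAt, hsymm0] at h
        exact tendsto_const_nhds.prodMk_nhds h
      filter_upwards [hcs.eventually hVs, φ.open_target.mem_nhds hφt] with y hy hy'
      exact ContDiffAt.comp (g := V) y hy (contDiffAt_const.prodMk
        (hφs'.contDiffAt (φ.open_target.mem_nhds hy')))
    have hwY : ∀ᶠ t in 𝓝 (0 : Fin p → ℝ), w (Y (s, t)) = V (s, t) := by
      filter_upwards [φ.open_source.mem_nhds hφ0] with t ht
      simp only [w]
      rw [← hφ t, φ.left_inv ht]
    obtain ⟨g1, g2, g3⟩ := germJet_eq_jetParam_of_graph hd h1.eventually_contMDiffAt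
      (h2.self_of_nhds.1) hgi hw hwY k
    have hT : (((d (H s 0)).1, fun i => iteratedFDeriv ℝ i w (d (H s 0)).1) : JetCoord p q k) =
        T s := by
      refine Prod.ext rfl ?_
      funext i
      exact (iteratedFDeriv_eq_graphDeriv hYs hVs h3 hw hwY i).self_of_nhds
    refine ⟨g1, hT ▸ g2, ?_⟩
    rw [g3]
    congr 2

theorem IsSmoothFamily.eventually_isImmersionGerm {H : S → (Fin p → ℝ) → M} {s₀ : S}
    (hH : IsSmoothFamily q H s₀) (himm : IsImmersionGerm (q := q) (H s₀)) :
    ∀ᶠ s in 𝓝 s₀, IsImmersionGerm (q := q) (H s) := by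
  obtain ⟨d, hd, T, -, h⟩ := hH.exists_jetCoord himm 0
  exact h.mono fun s hs => hs.1

/-! ### Open sets and smooth functions on jet spaces -/

theorem IsSmoothFamily.eventually_germJet_mem {H : S → (Fin p → ℝ) → M} {s₀ : S}
    (hH : IsSmoothFamily q H s₀) (himm : IsImmersionGerm (q := q) (H s₀)) {k : ℕ}
    {W : Set (Jet p q M (k : ℕ∞))} (hW : IsOpen W) (hs₀ : germJet q (k : ℕ∞) (H s₀) ∈ W) :
    ∀ᶠ s in 𝓝 s₀, germJet q (k : ℕ∞) (H s) ∈ W := by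
  obtain ⟨d, hd, T, hT, h⟩ := hH.exists_jetCoord himm k
  obtain ⟨-, h0, e0⟩ := h.self_of_nhds
  have := hT.continuousAt.eventually
    ((isOpen_jet_iff.1 hW d hd).mem_nhds ⟨h0, by rwa [← e0]⟩)
  filter_upwards [this, h] with s ⟨h1, h2⟩ ⟨_, h3, h4⟩
  rw [h4]
  exact h2

/-- `F` is smooth at the jet `ζ`. -/
def JetSmoothAt {k : ℕ} (F : Jet p q M (k : ℕ∞) → ℝ) (ζ : Jet p q M (k : ℕ∞)) : Prop :=
  ∀ (c : OpenPartialHomeomorph M (Coord p q)),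
    c ∈ IsManifold.maximalAtlas 𝓘(ℝ, Coord p q) ∞ M → ∀ s ∈ jetCoordDomain k c,
      germJet q (k : ℕ∞) (graphMap c s) = ζ →
      ContDiffAt ℝ ∞ (fun s => F (germJet q (k : ℕ∞) (graphMap c s))) s

/-- Passing to `germJet` removes the dependence on membership proofs. On the open coordinate domain
the default value `0` plays no role near a point. -/
theorem smoothOnJet_iff {k : ℕ} {F : Jet p q M (k : ℕ∞) → ℝ} {W : Set (Jet p q M (k : ℕ∞))}
    (hW : IsOpen W) : SmoothOnJet F W ↔ ∀ ζ ∈ W, JetSmoothAt F ζ := by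
  classical
  have key : ∀ (c : OpenPartialHomeomorph M (Coord p q))
      (hc : c ∈ IsManifold.maximalAtlas 𝓘(ℝ, Coord p q) ∞ M), ∀ s ∈ jetCoordDomain k c,
      (fun s : JetCoord p q k =>
        if h : s ∈ jetCoordDomain k c then F (jetParam k hc ⟨s, h⟩) else 0) =ᶠ[𝓝 s]
        fun s => F (germJet q (k : ℕ∞) (graphMap c s)) := by
    intro c hc s hs
    filter_upwards [(isOpen_jetCoordDomain k c).mem_nhds hs] with s' hs'
    rw [dif_pos hs', jetParam_eq_germJet]
  constructor
  · rintro h ζ hζ c hc s hs rfl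
    have hmem : s ∈ {s | ∃ h : s ∈ jetCoordDomain k c, jetParam k hc ⟨s, h⟩ ∈ W} :=
      ⟨hs, by rwa [jetParam_eq_germJet]⟩
    have h1 := (h c hc).contDiffAt ((isOpen_jet_iff.1 hW c hc).mem_nhds hmem)
    exact h1.congr_of_eventuallyEq (key c hc s hs).symm
  · rintro h c hc s ⟨hs, hsW⟩
    rw [jetParam_eq_germJet] at hsW
    exact ((h _ hsW c hc s hs rfl).congr_of_eventuallyEq (key c hc s hs)).contDiffWithinAt

/-- `F` along the family is `F` in the coordinates of an adapted chart composed with the smooth map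
`T`. This is the means by which all smoothness on jet spaces is transported. -/
theorem IsSmoothFamily.contDiffAt_germJet {H : S → (Fin p → ℝ) → M} {s₀ : S}
    (hH : IsSmoothFamily q H s₀) (himm : IsImmersionGerm (q := q) (H s₀)) {k : ℕ}
    {F : Jet p q M (k : ℕ∞) → ℝ} (hF : JetSmoothAt F (germJet q (k : ℕ∞) (H s₀))) :
    ContDiffAt ℝ ∞ (fun s => F (germJet q (k : ℕ∞) (H s))) s₀ := by
  obtain ⟨d, hd, T, hT, h⟩ := hH.exists_jetCoord himm k
  obtain ⟨-, h0, e0⟩ := h.self_of_nhds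
  have h1 := hF d hd (T s₀) h0 (by rw [e0, jetParam_eq_germJet])
  refine (h1.comp s₀ hT).congr_of_eventuallyEq ?_
  filter_upwards [h] with s ⟨_, h3, h4⟩
  rw [h4, jetParam_eq_germJet]
  rfl

theorem JetSmoothAt.comp {k : ℕ} {ι : Type*} [Fintype ι] {F : ι → Jet p q M (k : ℕ∞) → ℝ}
    {ζ : Jet p q M (k : ℕ∞)} (hF : ∀ a, JetSmoothAt (F a) ζ) {g : (ι → ℝ) → ℝ}
    (hg : ContDiffAt ℝ ∞ g fun a => F a ζ) : JetSmoothAt (fun ζ => g fun a => F a ζ) ζ := by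
  rintro c hc s hs rfl
  exact ContDiffAt.comp (g := g) s hg (contDiffAt_pi.2 fun a => hF a c hc s hs rfl)

/-- Openness of a set of jets can be checked on families of graphs. -/
theorem isOpen_of_eventually_germJet {k : ℕ} {W : Set (Jet p q M (k : ℕ∞))}
    (h : ∀ (c : OpenPartialHomeomorph M (Coord p q)),
      c ∈ IsManifold.maximalAtlas 𝓘(ℝ, Coord p q) ∞ M → ∀ s ∈ jetCoordDomain k c,
      germJet q (k : ℕ∞) (graphMap c s) ∈ W →
      ∀ᶠ s' in 𝓝 s, germJet q (k : ℕ∞) (graphMap c s') ∈ W) : IsOpen W := by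
  rw [isOpen_jet_iff]
  intro c hc
  rw [isOpen_iff_mem_nhds]
  rintro s ⟨hs, hsW⟩
  rw [jetParam_eq_germJet] at hsW
  filter_upwards [h c hc s hs hsW, (isOpen_jetCoordDomain k c).mem_nhds hs] with s' h1 h2
  exact ⟨h2, by rwa [jetParam_eq_germJet]⟩

theorem isOpen_inter_preimage_of_jetSmoothAt {k : ℕ} {W : Set (Jet p q M (k : ℕ∞))}
    (hW : IsOpen W) {F : Jet p q M (k : ℕ∞) → ℝ} (hF : ∀ ζ ∈ W, JetSmoothAt F ζ) {O : Set ℝ}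
    (hO : IsOpen O) : IsOpen (W ∩ F ⁻¹' O) := by
  refine isOpen_of_eventually_germJet fun c hc s hs hsW => ?_
  filter_upwards [(isSmoothFamily_graphMap hc hs).eventually_germJet_mem
    (isImmersionGerm_graphMap hc hs) hW hsW.1,
    (hF _ hsW.1 c hc s hs rfl).continuousAt.eventually (hO.mem_nhds hsW.2)] with s' h1 h2
  exact ⟨h1, h2⟩

/-! ### Projections between jet spaces -/

theorem Jet.proj_germJet {k l : ℕ∞} (hkl : k ≤ l) {f : (Fin p → ℝ) → M}
    (hf : IsImmersionGerm (q := q) f) : Jet.proj hkl (germJet q l f) = germJet q k f := by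
  rw [germJet_eq_mk hf, germJet_eq_mk hf]
  rfl

theorem Jet.continuous_proj {k l : ℕ} (hkl : (k : ℕ∞) ≤ l) :
    Continuous (Jet.proj (p := p) (q := q) (M := M) hkl) := by
  refine ⟨fun W hW => isOpen_of_eventually_germJet fun c hc s hs hsW => ?_⟩
  have hH := isSmoothFamily_graphMap hc hs
  have himm := isImmersionGerm_graphMap hc hs
  rw [Set.mem_preimage, Jet.proj_germJet hkl himm] at hsW
  filter_upwards [hH.eventually_germJet_mem himm hW hsW, hH.eventually_isImmersionGerm himm]
    with s' h1 h2
  rwa [Set.mem_preimage, Jet.proj_germJet hkl h2]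

theorem JetSmoothAt.comp_proj {k l : ℕ} (hkl : (k : ℕ∞) ≤ l) {F : Jet p q M (k : ℕ∞) → ℝ}
    {ζ : Jet p q M (l : ℕ∞)} (hF : JetSmoothAt F (Jet.proj hkl ζ)) :
    JetSmoothAt (fun ζ => F (Jet.proj hkl ζ)) ζ := by
  rintro c hc s hs rfl
  have hH := isSmoothFamily_graphMap hc hs
  have himm := isImmersionGerm_graphMap hc hs
  rw [Jet.proj_germJet hkl himm] at hF
  refine (hH.contDiffAt_germJet himm hF).congr_of_eventuallyEq ?_
  filter_upwards [hH.eventually_isImmersionGerm himm] with s' h2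
  rw [Jet.proj_germJet hkl h2]

end Families

end

noncomputable section

set_option linter.unusedSectionVars false

/-! ### Jets of germs, and families through a prescribed representative. -/

section GermJet

variable {p q : ℕ} {M : Type*} [TopologicalSpace M] [ChartedSpace (Coord p q) M]

theorem base_germJet {k : ℕ∞} [Nonempty (Jet p q M k)] {f : (Fin p → ℝ) → M}
    (hf : IsImmersionGerm (q := q) f) : (germJet q k f).base = f 0 := by
  rw [germJet_eq_mk hf]
  rfl

theorem exists_germJet_eq {k : ℕ∞} [Nonempty (Jet p q M k)] (ζ : Jet p q M k) :
    ∃ f, IsImmersionGerm (q := q) f ∧ germJet q k f = ζ := by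
  obtain ⟨f, rfl⟩ := Quot.exists_rep ζ
  exact ⟨f.1, f.2, germJet_eq_mk f.2⟩

variable [IsManifold 𝓘(ℝ, Coord p q) ∞ M] [Nonempty M]

theorem germJet_eq_iff_forall {k : ℕ∞} {f g : (Fin p → ℝ) → M} (hf : IsImmersionGerm (q := q) f)
    (hg : IsImmersionGerm (q := q) g) :
    germJet q k f = germJet q k g ↔
      ∀ i : ℕ, (i : ℕ∞) ≤ k → HasContact i hf.toGerm hg.toGerm := by
  rw [germJet_eq_mk hf, germJet_eq_mk hg, Jet.mk_eq_mk_iff]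

theorem hasContact_of_eventuallyEq {f g : ImmersionGerm p q M} (h : f.1 =ᶠ[𝓝 0] g.1) (k : ℕ) :
    HasContact k f g := by
  have hc := IsManifold.chart_mem_maximalAtlas (I := 𝓘(ℝ, Coord p q)) (n := ∞) (f.1 0)
  rw [hasContact_iff_chart hc (mem_chart_source _ _)]
  refine ⟨h.self_of_nhds, _, IsReparam.refl, EqDerivs.of_eventuallyEq k ?_⟩
  filter_upwards [h] with t ht
  simp [ht]

theorem germJet_congr {k : ℕ∞} {f g : (Fin p → ℝ) → M} (hf : IsImmersionGerm (q := q) f)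
    (h : f =ᶠ[𝓝 0] g) : germJet q k f = germJet q k g :=
  (germJet_eq_iff_forall hf (hf.congr h)).2 fun i _ => hasContact_of_eventuallyEq h i

/-- A family of submanifolds can be modified to pass through a given submanifold without changing
its `k`-jets. -/
theorem exists_family_through {k : ℕ} {c : OpenPartialHomeomorph M (Coord p q)}
    (hc : c ∈ IsManifold.maximalAtlas 𝓘(ℝ, Coord p q) ∞ M) {s₀ : JetCoord p q k}
    (hs₀ : s₀ ∈ jetCoordDomain k c) {f : (Fin p → ℝ) → M} (hf : IsImmersionGerm (q := q) f)
    (h : germJet q (k : ℕ∞) f = germJet q k (graphMap c s₀)) :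
    ∃ H : JetCoord p q k → (Fin p → ℝ) → M, IsSmoothFamily q H s₀ ∧ f =ᶠ[𝓝 0] H s₀ ∧
      ∀ᶠ s in 𝓝 s₀, germJet q (k : ℕ∞) (H s) = germJet q k (graphMap c s) := by
  let Γ : JetCoord p q k → (Fin p → ℝ) → Coord p q := fun s t => (s.1 + t, taylorPoly s.2 t)
  have hΓ : ContDiff ℝ ∞ fun x : JetCoord p q k × (Fin p → ℝ) => Γ x.1 x.2 := by
    refine ContDiff.prodMk ((contDiff_fst.comp contDiff_fst).add contDiff_snd) ?_
    exact (contDiff_polyMap_uncurry (E := Fin p → ℝ) (F := Fin q → ℝ) (k := k)).comp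
      ((contDiff_snd.comp contDiff_fst).prodMk contDiff_snd)
  have hΓs : ∀ s, ContDiff ℝ ∞ (Γ s) := fun s => hΓ.comp (contDiff_prodMk_right s)
  have hΓ₀ : Γ s₀ 0 ∈ c.target := by simpa [Γ, jetCoordDomain] using hs₀
  have hg₀ := isImmersionGerm_graphMap hc hs₀
  have hf0 : f 0 = graphMap c s₀ 0 := by
    have := congrArg Jet.base h
    rwa [base_germJet hf, base_germJet hg₀] at this
  have hx : f 0 ∈ c.source := by rw [hf0]; exact c.map_target hΓ₀
  obtain ⟨-, φ, hφ, hcon⟩ := (hasContact_iff_chart hc hx).1 ((germJet_eq_iff hf hg₀).1 h)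
  simp only [IsImmersionGerm.coe_toGerm] at hcon
  -- The defect between `f` and the reparametrized Taylor graph; by contact it vanishes to order `k`
  -- at `0`.
  let δ : (Fin p → ℝ) → Coord p q := fun t => c (f t) - Γ s₀ (φ t)
  have hcf := eventually_contDiffAt_chart_comp hc hf.1 hx
  have hδ : ∀ᶠ t in 𝓝 0, ContDiffAt ℝ ∞ δ t := by
    filter_upwards [hcf, hφ.eventually_contDiffAt] with t h1 h2
    exact h1.2.sub ((hΓs s₀).contDiffAt.comp t h2)
  have htend : ∀ s, Filter.Tendsto (fun t => Γ s (φ t)) (𝓝 0) (𝓝 (Γ s 0)) := by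
    intro s
    have := (hΓs s).continuous.continuousAt.comp (x := (0 : Fin p → ℝ)) hφ.contDiffAt.continuousAt
    rw [ContinuousAt, Function.comp_apply, hφ.map_zero] at this
    exact this
  have hcg : ∀ s, Γ s 0 ∈ c.target →
      (fun t => c (graphMap c s (φ t))) =ᶠ[𝓝 0] fun t => Γ s (φ t) := by
    intro s hs
    filter_upwards [(htend s).eventually (c.open_target.mem_nhds hs)] with t ht
    exact c.right_inv ht
  have hδ0 : δ 0 = 0 := by
    have : c (f 0) = Γ s₀ (φ 0) := hcon.eq.trans (hcg s₀ hΓ₀).self_of_nhds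
    simp only [δ, this, sub_self]
  have hΓφ : ∀ s, ContDiffAt ℝ k (fun t => Γ s (φ t)) 0 := fun s =>
    ((hΓs s).contDiffAt.comp 0 hφ.contDiffAt).of_infty k
  have hδk : EqDerivs k δ (fun _ => 0) 0 := by
    have h1 : EqDerivs k (fun t => c (f t)) (fun t => Γ s₀ (φ t)) 0 :=
      hcon.trans (EqDerivs.of_eventuallyEq k (hcg s₀ hΓ₀))
    have h2 := EqDerivs.add (hcf.self_of_nhds.2.of_infty k) (hΓφ s₀) (hΓφ s₀).neg (hΓφ s₀).neg
      h1 (EqDerivs.refl k (fun t => - Γ s₀ (φ t)) 0)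
    simpa only [← sub_eq_add_neg, sub_self] using h2
  let H : JetCoord p q k → (Fin p → ℝ) → M := fun s t => c.symm (Γ s (φ t) + δ t)
  have hHf : f =ᶠ[𝓝 0] H s₀ := by
    filter_upwards [hcf] with t ht
    simp only [H, δ, add_sub_cancel, c.left_inv ht.1]
  have htgt : ∀ s, Γ s 0 ∈ c.target → Γ s (φ 0) + δ 0 ∈ c.target := by
    intro s hs
    rwa [hφ.map_zero, hδ0, add_zero]
  have hH : ∀ s, Γ s 0 ∈ c.target → IsSmoothFamily q H s := by
    intro s hs
    refine isSmoothFamily_chart_symm hc (g := fun s t => Γ s (φ t) + δ t) ?_ (htgt s hs)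
    have hc2 : ContinuousAt (fun x : JetCoord p q k × (Fin p → ℝ) => x.2) (s, 0) :=
      continuousAt_snd
    filter_upwards [hc2.eventually hδ, hc2.eventually hφ.eventually_contDiffAt] with x h1 h2
    refine ContDiffAt.add ?_ (h1.comp x contDiffAt_snd)
    exact ContDiffAt.comp (g := fun x : JetCoord p q k × (Fin p → ℝ) => Γ x.1 x.2) x
      hΓ.contDiffAt (contDiffAt_fst.prodMk (h2.comp x contDiffAt_snd))
  refine ⟨H, hH s₀ hΓ₀, hHf, ?_⟩
  filter_upwards [(hH s₀ hΓ₀).eventually_isImmersionGerm (hf.congr hHf),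
    (isOpen_jetCoordDomain k c).mem_nhds hs₀] with s h1 h2
  have hΓt : Γ s 0 ∈ c.target := by simpa [Γ, jetCoordDomain] using h2
  have hH0 : H s 0 = c.symm (Γ s 0) := by simp only [H, hφ.map_zero, hδ0, add_zero]
  rw [germJet_eq_iff h1 (isImmersionGerm_graphMap hc h2), hasContact_iff_chart hc
    (by simp only [IsImmersionGerm.coe_toGerm, hH0]; exact c.map_target hΓt)]
  refine ⟨hH0, φ, hφ, ?_⟩
  simp only [IsImmersionGerm.coe_toGerm]
  have e1 : (fun t => c (H s t)) =ᶠ[𝓝 0] fun t => Γ s (φ t) + δ t := by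
    have hcont : ContinuousAt (fun t => Γ s (φ t) + δ t) 0 :=
      ((hΓφ s).add (hδ.self_of_nhds.of_infty k)).continuousAt
    filter_upwards [hcont.eventually (c.open_target.mem_nhds (htgt s hΓt))] with t ht
    exact c.right_inv ht
  refine (EqDerivs.of_eventuallyEq k e1).trans (EqDerivs.trans ?_
    (EqDerivs.of_eventuallyEq k (hcg s hΓt)).symm)
  have h3 := EqDerivs.add (hΓφ s) (hΓφ s) (hδ.self_of_nhds.of_infty k) contDiffAt_const
    (EqDerivs.refl k _ 0) hδk
  simpa only [add_zero] using h3

end GermJet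

/-! ### Prolongation of maps to jets of finite order. -/

section Prolongation

variable {p q r : ℕ} {M N : Type*}
  [TopologicalSpace M] [ChartedSpace (Coord p r) M] [IsManifold 𝓘(ℝ, Coord p r) ∞ M] [Nonempty M]
  [TopologicalSpace N] [ChartedSpace (Coord p q) N] [IsManifold 𝓘(ℝ, Coord p q) ∞ N] [Nonempty N]
  {D : Set M} {Φ : M → N}

/-- `Φ` is smooth near every point of `D`. -/
def SmoothNear (p r q : ℕ) [ChartedSpace (Coord p r) M] [ChartedSpace (Coord p q) N]
    (D : Set M) (Φ : M → N) : Prop :=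
  ∀ z ∈ D, ∀ᶠ z' in 𝓝 z, ContMDiffAt 𝓘(ℝ, Coord p r) 𝓘(ℝ, Coord p q) ∞ Φ z'

theorem eventually_contMDiffAt_comp {f : (Fin p → ℝ) → M} (hf : IsImmersionGerm (q := r) f)
    (hΦ : ∀ᶠ z in 𝓝 (f 0), ContMDiffAt 𝓘(ℝ, Coord p r) 𝓘(ℝ, Coord p q) ∞ Φ z) :
    ∀ᶠ t in 𝓝 0, ContMDiffAt 𝓘(ℝ, Fin p → ℝ) 𝓘(ℝ, Coord p q) ∞ (Φ ∘ f) t := by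
  filter_upwards [hf.1, hf.1.self_of_nhds.continuousAt.eventually hΦ] with t h1 h2
  exact h2.comp t h1

theorem HasContact.comp_eqDerivs {k : ℕ} {f g : ImmersionGerm p r M} (h : HasContact k f g)
    (hΦ : ContMDiffAt 𝓘(ℝ, Coord p r) 𝓘(ℝ, Coord p q) ∞ Φ (f.1 0))
    {d : OpenPartialHomeomorph N (Coord p q)}
    (hd : d ∈ IsManifold.maximalAtlas 𝓘(ℝ, Coord p q) ∞ N) (hx : Φ (f.1 0) ∈ d.source) :
    f.1 0 = g.1 0 ∧ ∃ φ, IsReparam φ ∧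
      EqDerivs k (fun t => d (Φ (f.1 t))) (fun t => d (Φ (g.1 (φ t)))) 0 := by
  have hc := IsManifold.chart_mem_maximalAtlas (I := 𝓘(ℝ, Coord p r)) (n := ∞) (f.1 0)
  obtain ⟨h0, φ, hφ, h1⟩ := (hasContact_iff_chart hc (mem_chart_source _ _)).1 h
  exact ⟨h0, φ, hφ, eqDerivs_chart_comp hc hd hΦ f.contMDiffAt (hφ.contMDiffAt_comp g.contMDiffAt)
    (by simpa [hφ.map_zero] using h0) (mem_chart_source _ _) hx h1⟩

/-- The same reparametrization witnesses contact of the images. This is the well-definedness of the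
prolongation. -/
theorem germJet_comp_eq {k : ℕ∞} {f g : (Fin p → ℝ) → M} (hf : IsImmersionGerm (q := r) f)
    (hg : IsImmersionGerm (q := r) g) (h : germJet r k f = germJet r k g)
    (hΦ : ContMDiffAt 𝓘(ℝ, Coord p r) 𝓘(ℝ, Coord p q) ∞ Φ (f 0))
    (hf' : IsImmersionGerm (q := q) (Φ ∘ f)) (hg' : IsImmersionGerm (q := q) (Φ ∘ g)) :
    germJet q k (Φ ∘ f) = germJet q k (Φ ∘ g) := by
  rw [germJet_eq_iff_forall hf hg] at h
  rw [germJet_eq_iff_forall hf' hg']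
  intro i hi
  have hd := IsManifold.chart_mem_maximalAtlas (I := 𝓘(ℝ, Coord p q)) (n := ∞) (Φ (f 0))
  obtain ⟨h0, h1⟩ := (h i hi).comp_eqDerivs hΦ hd (mem_chart_source _ _)
  rw [hasContact_iff_chart hd (mem_chart_source _ _)]
  exact ⟨congrArg Φ h0, h1⟩

theorem mem_prolongDom_iff {k : ℕ∞} {ζ : Jet p r M k} :
    ζ ∈ prolongDom (q := q) D Φ ↔ ∃ f, IsImmersionGerm (q := r) f ∧ germJet r k f = ζ ∧ f 0 ∈ D ∧
      IsImmersionGerm (q := q) (Φ ∘ f) := by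
  constructor
  · rintro ⟨f, rfl, h1, h2⟩
    exact ⟨f.1, f.2, germJet_eq_mk f.2, h1, h2⟩
  · rintro ⟨f, hf, rfl, h1, h2⟩
    exact ⟨hf.toGerm, (germJet_eq_mk hf).symm, h1, h2⟩

theorem germJet_mem_prolongDom {k : ℕ∞} {f : (Fin p → ℝ) → M} (hf : IsImmersionGerm (q := r) f)
    (hD : f 0 ∈ D) (h : IsImmersionGerm (q := q) (Φ ∘ f)) :
    germJet r k f ∈ prolongDom (q := q) D Φ :=
  mem_prolongDom_iff.2 ⟨f, hf, rfl, hD, h⟩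

/-- The representative chosen in `prolong` is immaterial by `germJet_comp_eq`, so prolongations may
be computed on any admissible germ. -/
theorem prolong_germJet (hΦ : SmoothNear p r q D Φ) {k : ℕ∞} {f : (Fin p → ℝ) → M}
    (hf : IsImmersionGerm (q := r) f) (hD : f 0 ∈ D) (h : IsImmersionGerm (q := q) (Φ ∘ f)) :
    prolong D Φ (germJet r k f) = germJet q k (Φ ∘ f) := by
  have hex : ∃ g : ImmersionGerm p r M,
      Jet.mk k g = germJet r k f ∧ g.1 0 ∈ D ∧ IsImmersionGerm (q := q) (Φ ∘ g.1) :=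
    ⟨hf.toGerm, (germJet_eq_mk hf).symm, hD, h⟩
  rw [prolong, dif_pos hex]
  obtain ⟨h1, h2, h3⟩ := hex.choose_spec
  rw [← germJet_coe] at h1
  exact (germJet_eq_mk h3).symm.trans
    (germJet_comp_eq hex.choose.2 hf h1 (hΦ _ h2).self_of_nhds h3 h)

/-- The derivatives of `Φ ∘ f` and `Φ ∘ g` differ by the invertible derivative of a
reparametrization. At order `0` this fails: a point alone does not decide whether `Φ` immerses the
submanifold. -/
theorem isImmersionGerm_comp_of_germJet_eq {k : ℕ∞} (hk : 1 ≤ k) {f g : (Fin p → ℝ) → M}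
    (hf : IsImmersionGerm (q := r) f) (hg : IsImmersionGerm (q := r) g)
    (h : germJet r k f = germJet r k g)
    (hΦ : ∀ᶠ z in 𝓝 (f 0), ContMDiffAt 𝓘(ℝ, Coord p r) 𝓘(ℝ, Coord p q) ∞ Φ z)
    (hg' : IsImmersionGerm (q := q) (Φ ∘ g)) : IsImmersionGerm (q := q) (Φ ∘ f) := by
  rw [germJet_eq_iff_forall hf hg] at h
  have hd := IsManifold.chart_mem_maximalAtlas (I := 𝓘(ℝ, Coord p q)) (n := ∞) (Φ (f 0))
  obtain ⟨h0, φ, hφ, h1⟩ := (h 1 (by exact_mod_cast hk)).comp_eqDerivs hΦ.self_of_nhds hd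
    (mem_chart_source _ _)
  simp only [IsImmersionGerm.coe_toGerm] at h0 h1
  have hx : Φ (g 0) ∈ (chartAt (Coord p q) (Φ (f 0))).source := by
    rw [← h0]; exact mem_chart_source _ _
  rw [isImmersionGerm_iff hd (eventually_contMDiffAt_comp hf hΦ) (mem_chart_source _ _)]
  have hinj := (isImmersionGerm_iff hd hg'.1 hx).1 hg'
  have e : fderiv ℝ (fun t => chartAt (Coord p q) (Φ (f 0)) ((Φ ∘ f) t)) 0 =
      (fderiv ℝ (fun t => chartAt (Coord p q) (Φ (f 0)) ((Φ ∘ g) t)) 0).comp (fderiv ℝ φ 0) := by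
    refine (h1.fderiv_eq le_rfl).trans ?_
    have h2 := ((contDiffAt_chart_comp hd hg'.1.self_of_nhds hx).differentiableAt
      (by simp)).hasFDerivAt
    exact (HasFDerivAt.comp (g := fun t => chartAt (Coord p q) (Φ (f 0)) ((Φ ∘ g) t))
      (0 : Fin p → ℝ) (by rwa [hφ.map_zero])
      (hφ.contDiffAt.differentiableAt (by simp)).hasFDerivAt).fderiv
  rw [e]
  exact hinj.comp hφ.isInvertible_fderiv.injective

theorem germJet_mem_prolongDom_iff (hΦ : SmoothNear p r q D Φ) {k : ℕ∞} (hk : 1 ≤ k)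
    {f : (Fin p → ℝ) → M} (hf : IsImmersionGerm (q := r) f) :
    germJet r k f ∈ prolongDom (q := q) D Φ ↔ f 0 ∈ D ∧ IsImmersionGerm (q := q) (Φ ∘ f) := by
  refine ⟨fun h => ?_, fun h => germJet_mem_prolongDom hf h.1 h.2⟩
  obtain ⟨g, hg, h1, h2, h3⟩ := mem_prolongDom_iff.1 h
  have h0 : f 0 = g 0 := by
    have := congrArg Jet.base h1
    rw [base_germJet hf, base_germJet hg] at this
    exact this.symm
  exact ⟨h0 ▸ h2, isImmersionGerm_comp_of_germJet_eq hk hf hg h1.symm (h0 ▸ hΦ _ h2) h3⟩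

theorem proj_mem_prolongDom {k l : ℕ∞} (hkl : k ≤ l) {ζ : Jet p r M l}
    (hζ : ζ ∈ prolongDom (q := q) D Φ) : Jet.proj hkl ζ ∈ prolongDom (q := q) D Φ := by
  obtain ⟨f, hf, rfl, h1, h2⟩ := mem_prolongDom_iff.1 hζ
  rw [Jet.proj_germJet hkl hf]
  exact germJet_mem_prolongDom hf h1 h2

theorem proj_prolong (hΦ : SmoothNear p r q D Φ) {k l : ℕ∞} (hkl : k ≤ l) {ζ : Jet p r M l}
    (hζ : ζ ∈ prolongDom (q := q) D Φ) :
    Jet.proj hkl (prolong (q := q) D Φ ζ) = prolong D Φ (Jet.proj hkl ζ) := by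
  obtain ⟨f, hf, rfl, h1, h2⟩ := mem_prolongDom_iff.1 hζ
  rw [Jet.proj_germJet hkl hf, prolong_germJet hΦ hf h1 h2, prolong_germJet hΦ hf h1 h2,
    Jet.proj_germJet hkl h2]

/-- Near a jet in its domain, the prolongation is given by composing a smooth family with `Φ`. -/
theorem exists_family_prolong (hD : IsOpen D) (hΦ : SmoothNear p r q D Φ) {k : ℕ}
    {c : OpenPartialHomeomorph M (Coord p r)}
    (hc : c ∈ IsManifold.maximalAtlas 𝓘(ℝ, Coord p r) ∞ M) {s₀ : JetCoord p r k}
    (hs₀ : s₀ ∈ jetCoordDomain k c)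
    (h : germJet r (k : ℕ∞) (graphMap c s₀) ∈ prolongDom (q := q) D Φ) :
    ∃ H : JetCoord p r k → (Fin p → ℝ) → N, IsSmoothFamily q H s₀ ∧
      IsImmersionGerm (q := q) (H s₀) ∧
      ∀ᶠ s in 𝓝 s₀, germJet r (k : ℕ∞) (graphMap c s) ∈ prolongDom (q := q) D Φ ∧
        prolong D Φ (germJet r (k : ℕ∞) (graphMap c s)) = germJet q k (H s) := by
  obtain ⟨f, hf, h1, h2, h3⟩ := mem_prolongDom_iff.1 h
  -- For `k = 0` the graph of the Taylor polynomial need not be immersed by `Φ`. The family is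
  -- therefore moved to pass through the representative `f` for which this is known.
  obtain ⟨H, hH, hHf, hev⟩ := exists_family_through hc hs₀ hf h1
  have hH0 : H s₀ 0 ∈ D := hHf.self_of_nhds ▸ h2
  have hH' : IsSmoothFamily q (fun s t => Φ (H s t)) s₀ := hH.comp (hΦ _ hH0)
  have himm : IsImmersionGerm (q := q) (fun t => Φ (H s₀ t)) :=
    h3.congr (hHf.mono fun t ht => by simp [ht])
  refine ⟨_, hH', himm, ?_⟩
  have hc0 : ContinuousAt (fun s => H s 0) s₀ :=
    hH.self_of_nhds.continuousAt.comp (f := fun s => (s, 0)) (by fun_prop)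
  filter_upwards [hev, hH.eventually_isImmersionGerm (hf.congr hHf),
    hH'.eventually_isImmersionGerm himm, hc0.eventually (hD.mem_nhds hH0)] with s e1 e2 e3 e4
  rw [← e1]
  exact ⟨germJet_mem_prolongDom e2 e4 e3, prolong_germJet hΦ e2 e4 e3⟩

theorem isOpen_prolong_preimage (hD : IsOpen D) (hΦ : SmoothNear p r q D Φ) {k : ℕ}
    {W : Set (Jet p q N (k : ℕ∞))} (hW : IsOpen W) :
    IsOpen {ζ : Jet p r M (k : ℕ∞) | ζ ∈ prolongDom (q := q) D Φ ∧ prolong D Φ ζ ∈ W} := by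
  refine isOpen_of_eventually_germJet fun c hc s hs hsW => ?_
  obtain ⟨H, hH, himm, hev⟩ := exists_family_prolong hD hΦ hc hs hsW.1
  have h0 := hsW.2
  rw [hev.self_of_nhds.2] at h0
  filter_upwards [hev, hH.eventually_germJet_mem himm hW h0] with s' h1 h2
  exact ⟨h1.1, by rwa [h1.2]⟩

theorem JetSmoothAt.comp_prolong (hD : IsOpen D) (hΦ : SmoothNear p r q D Φ) {k : ℕ}
    {F : Jet p q N (k : ℕ∞) → ℝ} {ζ : Jet p r M (k : ℕ∞)} (hζ : ζ ∈ prolongDom (q := q) D Φ)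
    (hF : JetSmoothAt F (prolong D Φ ζ)) : JetSmoothAt (fun ζ => F (prolong D Φ ζ)) ζ := by
  rintro c hc s hs rfl
  obtain ⟨H, hH, himm, hev⟩ := exists_family_prolong hD hΦ hc hs hζ
  rw [hev.self_of_nhds.2] at hF
  refine (hH.contDiffAt_germJet himm hF).congr_of_eventuallyEq ?_
  filter_upwards [hev] with s' h1
  rw [h1.2]

end Prolongation

end

noncomputable section

set_option linter.unusedSectionVars false

/-! ### Derivatives along prolonged submanifolds, and total derivatives at finite order. -/

section JetDeriv

variable {p q : ℕ} {M : Type*} [TopologicalSpace M] [ChartedSpace (Coord p q) M]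
  [IsManifold 𝓘(ℝ, Coord p q) ∞ M] [Nonempty M]

/-- The derivative of `F` along the prolongation of the submanifold parametrized by `f`. -/
def jetDeriv {k : ℕ∞} (F : Jet p q M k → ℝ) (f : (Fin p → ℝ) → M) : (Fin p → ℝ) →L[ℝ] ℝ :=
  fderiv ℝ (fun s => F (germJet q k fun t => f (s + t))) 0

theorem IsImmersionGerm.isSmoothFamily_shift {f : (Fin p → ℝ) → M}
    (hf : IsImmersionGerm (q := q) f) : IsSmoothFamily q (fun s t => f (s + t)) 0 :=
  IsSmoothFamily.shift hf.1

theorem IsImmersionGerm.shift_zero {f : (Fin p → ℝ) → M}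
    (hf : IsImmersionGerm (q := q) f) : IsImmersionGerm (q := q) fun t => f (0 + t) := by
  simpa only [zero_add] using hf

theorem IsImmersionGerm.eventually_shift {f : (Fin p → ℝ) → M}
    (hf : IsImmersionGerm (q := q) f) :
    ∀ᶠ s in 𝓝 0, IsImmersionGerm (q := q) fun t => f (s + t) :=
  hf.isSmoothFamily_shift.eventually_isImmersionGerm hf.shift_zero

theorem hasFDerivAt_jetDeriv {k : ℕ} {F : Jet p q M (k : ℕ∞) → ℝ} {f : (Fin p → ℝ) → M}
    (hf : IsImmersionGerm (q := q) f) (hF : JetSmoothAt F (germJet q (k : ℕ∞) f)) :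
    HasFDerivAt (fun s => F (germJet q (k : ℕ∞) fun t => f (s + t))) (jetDeriv F f) 0 := by
  have := hf.isSmoothFamily_shift.contDiffAt_germJet hf.shift_zero (F := F)
    (by simpa only [zero_add] using hF)
  exact (this.differentiableAt (by simp)).hasFDerivAt

theorem jetDeriv_comp_reparam {k : ℕ} {F : Jet p q M (k : ℕ∞) → ℝ} {g : (Fin p → ℝ) → M}
    (hg : IsImmersionGerm (q := q) g) (hF : JetSmoothAt F (germJet q (k : ℕ∞) g))
    {φ : OpenPartialHomeomorph (Fin p → ℝ) (Fin p → ℝ)} (hφ : IsReparam φ)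
    (hgφ : IsImmersionGerm (q := q) fun t => g (φ t)) :
    jetDeriv F (fun t => g (φ t)) = (jetDeriv F g).comp (fderiv ℝ φ 0) := by
  have h1 := HasFDerivAt.comp (g := fun s => F (germJet q (k : ℕ∞) fun t => g (s + t)))
    (0 : Fin p → ℝ) (by rw [hφ.map_zero]; exact hasFDerivAt_jetDeriv hg hF)
    (hφ.contDiffAt.differentiableAt (by simp)).hasFDerivAt
  refine (h1.congr_of_eventuallyEq ?_).fderiv
  have hφ0 : Filter.Tendsto φ (𝓝 0) (𝓝 0) := by
    have := hφ.contDiffAt.continuousAt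
    rwa [ContinuousAt, hφ.map_zero] at this
  have hinv : ∀ᶠ s in 𝓝 0, (fderiv ℝ φ s).IsInvertible :=
    (hφ.contDiffAt.fderiv_right (m := 0) (by simp)).continuousAt.eventually
      (isOpen_isInvertible.mem_nhds hφ.isInvertible_fderiv)
  filter_upwards [hgφ.eventually_shift, hφ0.eventually hg.eventually_shift,
    hφ.eventually_contDiffAt.eventually_nhds, hinv] with s e1 e2 e3 e4
  simp only [Function.comp_apply]
  congr 1
  -- The map `t ↦ φ (s + t) - φ s` reparametrizes near `s`, so `g ∘ φ` at parameter `s` has the same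
  -- jet as `g` at parameter `φ s`.
  have hψ : ∀ᶠ t in 𝓝 0, ContDiffAt ℝ ∞ (fun t => φ (s + t) - φ s) t := by
    have : Filter.Tendsto (fun t : Fin p → ℝ => s + t) (𝓝 0) (𝓝 s) := by
      have : Continuous fun t : Fin p → ℝ => s + t := by fun_prop
      simpa using this.tendsto 0
    filter_upwards [this.eventually e3] with t ht
    exact (ContDiffAt.comp (g := φ) t ht (contDiffAt_const.add contDiffAt_id)).sub contDiffAt_const
  obtain ⟨ψ, hψ, hψe⟩ := IsReparam.exists_of_fderiv hψ
    (by rw [fderiv_sub_const, fderiv_comp_add_left, add_zero]; exact e4) (by simp)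
  rw [germJet_eq_iff e1 e2, hasContact_iff]
  refine ⟨ψ, hψ, ?_⟩
  have : (fun t => g (φ (s + t))) = (fun t => g (φ s + t)) ∘ ψ := by
    funext t
    simp [hψe]
  simp only [IsImmersionGerm.coe_toGerm]
  rw [this]
  exact ⟨rfl, fun _ _ => rfl⟩

/-- In the chart, `f` is `h` plus a map `u` with vanishing derivatives up to order `k + 1`. At
parameter `s` the `k`-jet of `f` is that of `h` plus the Taylor polynomial `β s` of `u` at `s`. Both
`β` and its derivative vanish at `0`, so along the joint family of shifts and polynomial corrections
the two curves of jets have the same velocity. -/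
theorem jetDeriv_eq_of_eqDerivs {k : ℕ} {F : Jet p q M (k : ℕ∞) → ℝ} {f h : (Fin p → ℝ) → M}
    (hf : IsImmersionGerm (q := q) f) (hh : IsImmersionGerm (q := q) h)
    (hF : JetSmoothAt F (germJet q (k : ℕ∞) h)) {c : OpenPartialHomeomorph M (Coord p q)}
    (hc : c ∈ IsManifold.maximalAtlas 𝓘(ℝ, Coord p q) ∞ M) (hfc : f 0 ∈ c.source)
    (hhc : h 0 ∈ c.source)
    (hfh : EqDerivs (k + 1) (fun t => c (f t)) (fun t => c (h t)) 0) :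
    jetDeriv F f = jetDeriv F h := by
  let B := ∀ i : Fin (k + 1), (Fin p → ℝ) [×(i : ℕ)]→L[ℝ] Coord p q
  have hcf := eventually_contDiffAt_chart_comp hc hf.1 hfc
  have hch := eventually_contDiffAt_chart_comp hc hh.1 hhc
  let u : (Fin p → ℝ) → Coord p q := fun t => c (f t) - c (h t)
  have hu : ∀ᶠ t in 𝓝 0, ContDiffAt ℝ ∞ u t := by
    filter_upwards [hcf, hch] with t h1 h2
    exact h1.2.sub h2.2
  have hu0 : EqDerivs (k + 1) u (fun _ => 0) 0 := by
    have h2 := EqDerivs.add (hcf.self_of_nhds.2.of_infty (k + 1))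
      (hch.self_of_nhds.2.of_infty (k + 1)) (hch.self_of_nhds.2.of_infty (k + 1)).neg
      (hch.self_of_nhds.2.of_infty (k + 1)).neg hfh (EqDerivs.refl (k + 1) (fun t => - c (h t)) 0)
    simpa only [← sub_eq_add_neg, sub_self] using h2
  have hu0' : ∀ i ≤ k + 1, iteratedFDeriv ℝ i u 0 = 0 := fun i hi => by
    rw [hu0 i hi]
    exact congrFun iteratedFDeriv_fun_zero 0
  -- Taylor coefficients of `u` at `s` up to order `k`. The derivative of the top one at `0` is the
  -- derivative of `u` of order `k + 1`; this is where the extra order of agreement is used.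
  let β : (Fin p → ℝ) → B := fun s i => iteratedFDeriv ℝ i u s
  have hβ0 : β 0 = 0 := by
    funext i
    exact hu0' i (by omega)
  have hβ : HasFDerivAt β (0 : (Fin p → ℝ) →L[ℝ] B) 0 := by
    rw [hasFDerivAt_pi']
    intro i
    have hd : DifferentiableAt ℝ (iteratedFDeriv ℝ (i : ℕ) u) 0 :=
      (hu.self_of_nhds.iteratedFDeriv_right (m := 1) (infty_bound 1 _)).differentiableAt (by simp)
    have h0 : fderiv ℝ (iteratedFDeriv ℝ (i : ℕ) u) 0 = 0 := by
      refine ContinuousLinearMap.ext fun v => ContinuousMultilinearMap.ext fun w => ?_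
      have h1 := iteratedFDeriv_succ_apply_left (𝕜 := ℝ) (f := u) (x := 0)
        (Fin.cons v w : Fin ((i : ℕ) + 1) → Fin p → ℝ)
      rw [hu0' _ (by omega)] at h1
      simpa using h1.symm
    have := hd.hasFDerivAt
    rw [h0] at this
    simpa using this
  let H : (Fin p → ℝ) × B → (Fin p → ℝ) → M := fun x t =>
    c.symm (c (h (x.1 + t)) + polyMap x.2 t)
  have hp0 : ∀ t, polyMap (0 : B) t = 0 := fun t => by
    refine Finset.sum_eq_zero fun i _ => ?_
    change _ • (0 : (Fin p → ℝ) [×(i : ℕ)]→L[ℝ] Coord p q) _ = 0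
    simp
  have hH : IsSmoothFamily q H (0, 0) := by
    refine isSmoothFamily_chart_symm hc
      (g := fun (x : (Fin p → ℝ) × B) t => c (h (x.1 + t)) + polyMap x.2 t) ?_ ?_
    · have ht : Filter.Tendsto (fun x : ((Fin p → ℝ) × B) × (Fin p → ℝ) => x.1.1 + x.2)
          (𝓝 ((0, 0), 0)) (𝓝 0) := by
        have : Continuous fun x : ((Fin p → ℝ) × B) × (Fin p → ℝ) => x.1.1 + x.2 := by fun_prop
        simpa using this.tendsto ((0, 0), 0)
      filter_upwards [ht.eventually hch] with x hx
      refine ContDiffAt.add ?_ ?_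
      · exact ContDiffAt.comp (g := fun t => c (h t)) x hx.2
          ((contDiff_fst.comp contDiff_fst).add contDiff_snd).contDiffAt
      · exact (contDiff_polyMap_uncurry.comp
          ((contDiff_snd.comp contDiff_fst).prodMk contDiff_snd)).contDiffAt
    · simp only [hp0, add_zero]
      exact c.map_source hhc
  have e0 : ∀ᶠ s in 𝓝 (0 : Fin p → ℝ), (fun t => h (s + t)) =ᶠ[𝓝 0] H (s, 0) := by
    filter_upwards [hch.eventually_nhds] with s hs
    have ht : Filter.Tendsto (fun t : Fin p → ℝ => s + t) (𝓝 0) (𝓝 s) := by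
      have : Continuous fun t : Fin p → ℝ => s + t := by fun_prop
      simpa using this.tendsto 0
    filter_upwards [ht.eventually hs] with t ht
    simp only [H, hp0, add_zero, c.left_inv ht.1]
  have himm : IsImmersionGerm (q := q) (H (0, 0)) := hh.shift_zero.congr e0.self_of_nhds
  have hΨ : HasFDerivAt (fun x => F (germJet q (k : ℕ∞) (H x)))
      (fderiv ℝ (fun x => F (germJet q (k : ℕ∞) (H x))) (0, 0)) (0, 0) := by
    have := hH.contDiffAt_germJet himm (F := F) (by
      rw [← germJet_congr hh.shift_zero e0.self_of_nhds]
      simpa only [zero_add] using hF)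
    exact (this.differentiableAt (by simp)).hasFDerivAt
  set DΨ := fderiv ℝ (fun x => F (germJet q (k : ℕ∞) (H x))) (0, 0)
  have hjh : jetDeriv F h = DΨ.comp ((ContinuousLinearMap.id ℝ _).prod 0) := by
    have h1 := HasFDerivAt.comp (f := fun s : Fin p → ℝ => (s, (0 : B))) (0 : Fin p → ℝ) hΨ
      ((hasFDerivAt_id (0 : Fin p → ℝ)).prodMk (hasFDerivAt_const (0 : B) (0 : Fin p → ℝ)))
    refine (h1.congr_of_eventuallyEq ?_).fderiv
    filter_upwards [e0, hh.eventually_shift] with s e1 e2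
    rw [germJet_congr e2 e1]
    rfl
  have hjf : jetDeriv F f = DΨ.comp ((ContinuousLinearMap.id ℝ _).prod 0) := by
    have h1 := HasFDerivAt.comp (f := fun s : Fin p → ℝ => (s, β s)) (0 : Fin p → ℝ)
      (by rw [hβ0]; exact hΨ) ((hasFDerivAt_id (0 : Fin p → ℝ)).prodMk hβ)
    refine (h1.congr_of_eventuallyEq ?_).fderiv
    have hcont : Filter.Tendsto (fun s => (s, β s)) (𝓝 0) (𝓝 ((0 : Fin p → ℝ), (0 : B))) := by
      have := hβ.continuousAt
      rw [ContinuousAt, hβ0] at this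
      exact Filter.tendsto_id.prodMk_nhds this
    filter_upwards [hf.eventually_shift, hcont.eventually (hH.eventually_isImmersionGerm himm),
      hu.eventually_nhds, hcf.eventually_nhds, hch.eventually_nhds] with s e1 e2 e3 e4 e5
    simp only [Function.comp_apply]
    congr 1
    rw [germJet_eq_iff e1 e2, hasContact_iff_chart hc
      (by simpa using e4.self_of_nhds.1)]
    simp only [IsImmersionGerm.coe_toGerm]
    have hpoly := eqDerivs_polyMap (k := k) e3
    have hval : c (h (s + 0)) + polyMap (β s) 0 = c (f s) := by
      have h2 : polyMap (β s) 0 = u (s + 0) := hpoly.eq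
      rw [h2]
      simp [u]
    refine ⟨?_, _, IsReparam.refl, ?_⟩
    · change f (s + 0) = c.symm (c (h (s + 0)) + polyMap (β s) 0)
      rw [hval, c.left_inv e4.self_of_nhds.1, add_zero]
    have ht : Filter.Tendsto (fun t : Fin p → ℝ => s + t) (𝓝 0) (𝓝 s) := by
      have : Continuous fun t : Fin p → ℝ => s + t := by fun_prop
      simpa using this.tendsto 0
    have hsh : ∀ {w : (Fin p → ℝ) → Coord p q}, ContDiffAt ℝ ∞ w s →
        ContDiffAt ℝ k (fun t => w (s + t)) 0 := fun {w} hw =>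
      (ContDiffAt.comp (g := w) 0 (by simpa using hw)
        (contDiffAt_const.add contDiffAt_id)).of_infty k
    have hpc : ContDiff ℝ ∞ (polyMap (β s)) :=
      contDiff_polyMap_uncurry.comp (contDiff_prodMk_right (β s))
    have h3 := EqDerivs.add (hsh e5.self_of_nhds.2) (hsh e5.self_of_nhds.2)
      (hsh e3.self_of_nhds) (hpc.contDiffAt.of_infty k) (EqDerivs.refl k _ 0) hpoly.symm
    have e6 : (fun t => c (f (s + t))) = fun t => c (h (s + t)) + u (s + t) := by
      funext t
      simp [u]
    have e7 : (fun t => c (H (s, β s) ((OpenPartialHomeomorph.refl (Fin p → ℝ)) t))) =ᶠ[𝓝 0]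
        fun t => c (h (s + t)) + polyMap (β s) t := by
      have hcont' : ContinuousAt (fun t => c (h (s + t)) + polyMap (β s) t) 0 :=
        (hsh e5.self_of_nhds.2).continuousAt.add hpc.continuous.continuousAt
      filter_upwards [hcont'.eventually (c.open_target.mem_nhds
        (by simpa only [hval] using c.map_source e4.self_of_nhds.1))] with t ht
      exact c.right_inv ht
    rw [e6]
    exact h3.trans (EqDerivs.of_eventuallyEq k e7).symm
  rw [hjf, hjh]

/-- The submanifold parametrized by `f` is near `0` a graph `u = u(x)` in the chart `c = (x,u)`. -/
def IsGraphGerm (c : OpenPartialHomeomorph M (Coord p q)) (f : (Fin p → ℝ) → M) : Prop :=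
  f 0 ∈ c.source ∧ (fderiv ℝ (fun t => (c (f t)).1) 0).IsInvertible

/-- Germs with the same jet agree only after a reparametrization. Its derivative `L` enters the
`x`-coordinates and every `jetDeriv` in the same way. -/
theorem exists_reparam_of_germJet_eq {k : ℕ} {f g : (Fin p → ℝ) → M}
    (hf : IsImmersionGerm (q := q) f) (hg : IsImmersionGerm (q := q) g)
    (h : germJet q ((k + 1 : ℕ) : ℕ∞) f = germJet q ((k + 1 : ℕ) : ℕ∞) g)
    {c : OpenPartialHomeomorph M (Coord p q)}
    (hc : c ∈ IsManifold.maximalAtlas 𝓘(ℝ, Coord p q) ∞ M) (hgc : g 0 ∈ c.source) :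
    ∃ L : (Fin p → ℝ) →L[ℝ] (Fin p → ℝ), L.IsInvertible ∧
      fderiv ℝ (fun t => (c (f t)).1) 0 = (fderiv ℝ (fun t => (c (g t)).1) 0).comp L ∧
      ∀ F : Jet p q M (k : ℕ∞) → ℝ, JetSmoothAt F (germJet q (k : ℕ∞) g) →
        jetDeriv F f = (jetDeriv F g).comp L := by
  have h0 : f 0 = g 0 := by
    have := congrArg Jet.base h
    rwa [base_germJet hf, base_germJet hg] at this
  have hfc : f 0 ∈ c.source := h0 ▸ hgc
  obtain ⟨-, φ, hφ, hcon⟩ := (hasContact_iff_chart hc hfc).1 ((germJet_eq_iff hf hg).1 h)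
  simp only [IsImmersionGerm.coe_toGerm] at hcon
  have hgφc : g (φ 0) ∈ c.source := by rwa [hφ.map_zero]
  have hgφ : IsImmersionGerm (q := q) fun t => g (φ t) := by
    refine (isImmersionGerm_iff hc (hφ.eventually_contMDiffAt_comp hg.1) hgφc).2 ?_
    have hinj := (isImmersionGerm_iff hc hf.1 hfc).1 hf
    rw [hcon.fderiv_eq (Nat.succ_le_succ (Nat.zero_le k))] at hinj
    exact hinj
  have hdiff : ∀ {w : (Fin p → ℝ) → M}, IsImmersionGerm (q := q) w → w 0 ∈ c.source →
      DifferentiableAt ℝ (fun t => c (w t)) 0 := fun hw hw0 =>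
    (contDiffAt_chart_comp hc hw.1.self_of_nhds hw0).differentiableAt (by simp)
  have hfst : ∀ {w : (Fin p → ℝ) → M}, IsImmersionGerm (q := q) w → w 0 ∈ c.source →
      fderiv ℝ (fun t => (c (w t)).1) 0 =
        (ContinuousLinearMap.fst ℝ _ _).comp (fderiv ℝ (fun t => c (w t)) 0) := fun hw hw0 =>
    (hasFDerivAt_fst.comp (0 : Fin p → ℝ) (hdiff hw hw0).hasFDerivAt).fderiv
  refine ⟨fderiv ℝ φ 0, hφ.isInvertible_fderiv, ?_, fun F hF => ?_⟩
  · rw [hfst hf hfc, hfst hg hgc, hcon.fderiv_eq (Nat.succ_le_succ (Nat.zero_le k)),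
      ContinuousLinearMap.comp_assoc]
    congr 1
    exact (HasFDerivAt.comp (g := fun t => c (g t)) (0 : Fin p → ℝ)
      (by rw [hφ.map_zero]; exact (hdiff hg hgc).hasFDerivAt)
      (hφ.contDiffAt.differentiableAt (by simp)).hasFDerivAt).fderiv
  · rw [← jetDeriv_comp_reparam hg hF hφ hgφ]
    refine jetDeriv_eq_of_eqDerivs hf hgφ ?_ hc hfc hgφc hcon
    have : germJet q (k : ℕ∞) (fun t => g (φ t)) = germJet q k g := by
      rw [germJet_eq_iff hgφ hg, hasContact_iff]
      exact ⟨φ, hφ, rfl, fun _ _ => rfl⟩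
    rwa [this]

theorem IsGraphGerm.of_germJet_eq {k : ℕ} {f g : (Fin p → ℝ) → M}
    (hf : IsImmersionGerm (q := q) f) (hg : IsImmersionGerm (q := q) g)
    (h : germJet q ((k + 1 : ℕ) : ℕ∞) f = germJet q ((k + 1 : ℕ) : ℕ∞) g)
    {c : OpenPartialHomeomorph M (Coord p q)}
    (hc : c ∈ IsManifold.maximalAtlas 𝓘(ℝ, Coord p q) ∞ M) (hgc : IsGraphGerm c g) :
    IsGraphGerm c f := by
  have h0 : f 0 = g 0 := by
    have := congrArg Jet.base h
    rwa [base_germJet hf, base_germJet hg] at this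
  obtain ⟨L, hL, hL', -⟩ := exists_reparam_of_germJet_eq hf hg h hc hgc.1
  refine ⟨h0 ▸ hgc.1, ?_⟩
  rw [hL']
  exact hgc.2.comp hL

/-- The total derivative of a differential function of order `k`, as a function on the jets of order
`k + 1`. -/
def totalDerivFin {k : ℕ} (c : OpenPartialHomeomorph M (Coord p q)) (i : Fin p)
    (F : Jet p q M (k : ℕ∞) → ℝ) (η : Jet p q M ((k + 1 : ℕ) : ℕ∞)) : ℝ :=
  let f : ImmersionGerm p q M := Quot.out η
  jetDeriv F f.1 ((fderiv ℝ (fun s => (c (f.1 s)).1) 0).inverse (Pi.single i 1))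

/-- The factor `L` cancels against its inverse, so the total derivative is independent of the
representative. -/
theorem jetDeriv_inverse_eq {k : ℕ} {f g : (Fin p → ℝ) → M}
    (hf : IsImmersionGerm (q := q) f) (hg : IsImmersionGerm (q := q) g)
    (h : germJet q ((k + 1 : ℕ) : ℕ∞) f = germJet q ((k + 1 : ℕ) : ℕ∞) g)
    {c : OpenPartialHomeomorph M (Coord p q)}
    (hc : c ∈ IsManifold.maximalAtlas 𝓘(ℝ, Coord p q) ∞ M) (hgc : IsGraphGerm c g)
    {F : Jet p q M (k : ℕ∞) → ℝ} (hF : JetSmoothAt F (germJet q (k : ℕ∞) g)) (v : Fin p → ℝ) :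
    jetDeriv F f ((fderiv ℝ (fun s => (c (f s)).1) 0).inverse v) =
      jetDeriv F g ((fderiv ℝ (fun s => (c (g s)).1) 0).inverse v) := by
  obtain ⟨L, ⟨e, rfl⟩, hL, hL'⟩ := exists_reparam_of_germJet_eq hf hg h hc hgc.1
  obtain ⟨e', he'⟩ := hgc.2
  rw [hL' F hF, hL, ← he']
  have : ((e' : (Fin p → ℝ) →L[ℝ] (Fin p → ℝ)).comp (e : (Fin p → ℝ) →L[ℝ] (Fin p → ℝ))) =
      ((e.trans e' : (Fin p → ℝ) ≃L[ℝ] (Fin p → ℝ)) : (Fin p → ℝ) →L[ℝ] (Fin p → ℝ)) := rfl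
  rw [this, ContinuousLinearMap.inverse_equiv, ContinuousLinearMap.inverse_equiv]
  simp

theorem totalDerivFin_germJet {k : ℕ} {f : (Fin p → ℝ) → M}
    (hf : IsImmersionGerm (q := q) f) {c : OpenPartialHomeomorph M (Coord p q)}
    (hc : c ∈ IsManifold.maximalAtlas 𝓘(ℝ, Coord p q) ∞ M) (hfc : IsGraphGerm c f)
    {F : Jet p q M (k : ℕ∞) → ℝ} (hF : JetSmoothAt F (germJet q (k : ℕ∞) f)) (i : Fin p) :
    totalDerivFin c i F (germJet q ((k + 1 : ℕ) : ℕ∞) f) =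
      jetDeriv F f ((fderiv ℝ (fun s => (c (f s)).1) 0).inverse (Pi.single i 1)) := by
  refine jetDeriv_inverse_eq (Quot.out (germJet q ((k + 1 : ℕ) : ℕ∞) f)).2 hf ?_ hc hfc hF _
  rw [germJet_coe]
  exact Quot.out_eq _

theorem IsSmoothFamily.eventually_isGraphGerm {S : Type*} [NormedAddCommGroup S] [NormedSpace ℝ S]
    {H : S → (Fin p → ℝ) → M} {s₀ : S} (hH : IsSmoothFamily q H s₀)
    {c : OpenPartialHomeomorph M (Coord p q)}
    (hc : c ∈ IsManifold.maximalAtlas 𝓘(ℝ, Coord p q) ∞ M) (hH₀ : IsGraphGerm c (H s₀)) :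
    (∀ᶠ s in 𝓝 s₀, IsGraphGerm c (H s)) ∧
      ContDiffAt ℝ ∞ (fun s => (fderiv ℝ (fun t => (c (H s t)).1) 0).inverse) s₀ := by
  have hcH := eventually_contDiffAt_chart_comp hc hH hH₀.1
  let Y : S × (Fin p → ℝ) → (Fin p → ℝ) := fun x => (c (H x.1 x.2)).1
  have hcs : ContinuousAt (fun s : S => (s, (0 : Fin p → ℝ))) s₀ := by fun_prop
  have hY : ContDiffAt ℝ ∞ Y (s₀, 0) := hcH.self_of_nhds.2.fst
  have h1 : ContDiffAt ℝ ∞ (fun x => (fderiv ℝ Y x).comp (ContinuousLinearMap.inr ℝ S _))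
      (s₀, (0 : Fin p → ℝ)) := (hY.fderiv_right (m := ∞) le_rfl).clm_comp contDiffAt_const
  have h2 : ContDiffAt ℝ ∞ (fun s => (fderiv ℝ Y (s, 0)).comp (ContinuousLinearMap.inr ℝ S _)) s₀ :=
    ContDiffAt.comp (g := fun x => (fderiv ℝ Y x).comp (ContinuousLinearMap.inr ℝ S _)) s₀ h1
      (contDiffAt_id.prodMk contDiffAt_const)
  have h3 : ContDiffAt ℝ ∞ (fun s => fderiv ℝ (fun t => (c (H s t)).1) 0) s₀ := by
    refine h2.congr_of_eventuallyEq ?_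
    filter_upwards [hcs.eventually hcH] with s hs
    exact fderiv_comp_prodMk_right (f := Y) (hs.2.fst.differentiableAt (by simp))
  refine ⟨?_, ContDiffAt.comp (g := ContinuousLinearMap.inverse) s₀
    hH₀.2.contDiffAt_map_inverse h3⟩
  filter_upwards [hcs.eventually hcH,
    h3.continuousAt.eventually (isOpen_isInvertible.mem_nhds hH₀.2)] with s e1 e2
  exact ⟨e1.1, e2⟩

/-- The jets of graphs `u = u(x)`. -/
def graphJetsFin (k : ℕ) (c : OpenPartialHomeomorph M (Coord p q)) :
    Set (Jet p q M ((k + 1 : ℕ) : ℕ∞)) :=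
  {η | ∃ f, IsImmersionGerm (q := q) f ∧ germJet q _ f = η ∧ IsGraphGerm c f}

theorem germJet_mem_graphJetsFin_iff {k : ℕ} {c : OpenPartialHomeomorph M (Coord p q)}
    (hc : c ∈ IsManifold.maximalAtlas 𝓘(ℝ, Coord p q) ∞ M) {f : (Fin p → ℝ) → M}
    (hf : IsImmersionGerm (q := q) f) :
    germJet q _ f ∈ graphJetsFin k c ↔ IsGraphGerm c f :=
  ⟨fun ⟨_, hg, h1, h2⟩ => IsGraphGerm.of_germJet_eq hf hg h1.symm hc h2,
    fun h => ⟨f, hf, rfl, h⟩⟩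

theorem isOpen_graphJetsFin (k : ℕ) {c : OpenPartialHomeomorph M (Coord p q)}
    (hc : c ∈ IsManifold.maximalAtlas 𝓘(ℝ, Coord p q) ∞ M) : IsOpen (graphJetsFin k c) := by
  refine isOpen_of_eventually_germJet fun c' hc' s hs hsW => ?_
  have hH := isSmoothFamily_graphMap hc' hs
  have himm := isImmersionGerm_graphMap hc' hs
  rw [germJet_mem_graphJetsFin_iff hc himm] at hsW
  filter_upwards [(hH.eventually_isGraphGerm hc hsW).1, hH.eventually_isImmersionGerm himm]
    with s' h1 h2
  exact (germJet_mem_graphJetsFin_iff hc h2).2 h1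

/-- The total derivative is a partial derivative of `F` along a two-parameter family: one parameter
runs through the jets, the other shifts the base point along each submanifold. -/
theorem jetSmoothAt_totalDerivFin {k : ℕ} {c : OpenPartialHomeomorph M (Coord p q)}
    (hc : c ∈ IsManifold.maximalAtlas 𝓘(ℝ, Coord p q) ∞ M) (i : Fin p)
    {F : Jet p q M (k : ℕ∞) → ℝ} {W : Set (Jet p q M (k : ℕ∞))} (hW : IsOpen W)
    (hF : ∀ ζ ∈ W, JetSmoothAt F ζ) {η : Jet p q M ((k + 1 : ℕ) : ℕ∞)}
    (hη : η ∈ graphJetsFin k c) (hηW : Jet.proj (Nat.cast_le.2 (Nat.le_succ k)) η ∈ W) :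
    JetSmoothAt (totalDerivFin c i F) η := by
  rintro c' hc' s₀ hs₀ rfl
  have hH := isSmoothFamily_graphMap hc' hs₀
  have himm := isImmersionGerm_graphMap hc' hs₀
  rw [germJet_mem_graphJetsFin_iff hc himm] at hη
  rw [Jet.proj_germJet _ himm] at hηW
  obtain ⟨h1, h2⟩ := hH.eventually_isGraphGerm hc hη
  -- The germ at `(s, τ)` is the graph with jet coordinates `s`, based at parameter `τ`. The
  -- derivative in `τ` at `0` is `jetDeriv F` on that graph.
  let H₂ : JetCoord p q (k + 1) × (Fin p → ℝ) → (Fin p → ℝ) → M :=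
    fun x t => graphMap c' x.1 (x.2 + t)
  have hH₂ : IsSmoothFamily q H₂ (s₀, 0) := by
    have ht : Filter.Tendsto
        (fun x : (JetCoord p q (k + 1) × (Fin p → ℝ)) × (Fin p → ℝ) => (x.1.1, x.1.2 + x.2))
        (𝓝 ((s₀, 0), 0)) (𝓝 (s₀, 0)) := by
      have : Continuous fun x : (JetCoord p q (k + 1) × (Fin p → ℝ)) × (Fin p → ℝ) =>
        (x.1.1, x.1.2 + x.2) := by fun_prop
      simpa using this.tendsto ((s₀, 0), 0)
    filter_upwards [ht.eventually hH] with x hx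
    refine ContMDiffAt.comp (g := fun x : JetCoord p q (k + 1) × (Fin p → ℝ) =>
      graphMap c' x.1 x.2) (f := fun x : (JetCoord p q (k + 1) × (Fin p → ℝ)) × (Fin p → ℝ) =>
      (x.1.1, x.1.2 + x.2)) x hx ?_
    exact ((contDiff_fst.comp contDiff_fst).prodMk
      ((contDiff_snd.comp contDiff_fst).add contDiff_snd)).contMDiff.contMDiffAt
  have hH₂0 : H₂ (s₀, 0) = graphMap c' s₀ := by
    funext t
    simp [H₂]
  have himm₂ : IsImmersionGerm (q := q) (H₂ (s₀, 0)) := by rwa [hH₂0]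
  let G : JetCoord p q (k + 1) × (Fin p → ℝ) → ℝ := fun x => F (germJet q (k : ℕ∞) (H₂ x))
  have hGev : ∀ᶠ x in 𝓝 (s₀, (0 : Fin p → ℝ)), ContDiffAt ℝ ∞ G x := by
    filter_upwards [hH₂.eventually_germJet_mem himm₂ hW (by rwa [hH₂0]), hH₂.eventually,
      hH₂.eventually_isImmersionGerm himm₂] with x e1 e2 e3
    exact e2.contDiffAt_germJet e3 (hF _ e1)
  have hcs : ContinuousAt (fun s : JetCoord p q (k + 1) => (s, (0 : Fin p → ℝ))) s₀ := by fun_prop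
  have h3 : ContDiffAt ℝ ∞ (fun s => ((fderiv ℝ G (s, 0)).comp (ContinuousLinearMap.inr ℝ _ _))
      ((fderiv ℝ (fun t => (c (graphMap c' s t)).1) 0).inverse (Pi.single i 1))) s₀ := by
    refine ContDiffAt.clm_apply (ContDiffAt.clm_comp ?_ contDiffAt_const)
      (h2.clm_apply contDiffAt_const)
    exact ContDiffAt.comp (g := fderiv ℝ G) s₀
      (hGev.self_of_nhds.fderiv_right (m := ∞) le_rfl) (contDiffAt_id.prodMk contDiffAt_const)
  refine h3.congr_of_eventuallyEq ?_
  filter_upwards [h1, hH.eventually_isImmersionGerm himm,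
    hH.eventually_germJet_mem himm hW hηW, hcs.eventually hGev] with s e1 e2 e3 e4
  rw [totalDerivFin_germJet e2 hc e1 (hF _ e3)]
  congr 1
  exact fderiv_comp_prodMk_right (f := G) (e4.differentiableAt (by simp))

end JetDeriv

end

noncomputable section

set_option linter.unusedSectionVars false

/-! ### The inverse limit: topology, differential functions and total derivatives on `J^∞`. -/

section InfiniteJets

variable {p q : ℕ} {M : Type*} [TopologicalSpace M] [ChartedSpace (Coord p q) M]
  [IsManifold 𝓘(ℝ, Coord p q) ∞ M] [Nonempty M]

theorem Jet.proj_proj {k l m : ℕ∞} (hkl : k ≤ l) (hlm : l ≤ m) (ζ : Jet p q M m) :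
    Jet.proj hkl (Jet.proj hlm ζ) = Jet.proj (hkl.trans hlm) ζ := by
  obtain ⟨f, hf, rfl⟩ := exists_germJet_eq ζ
  rw [Jet.proj_germJet _ hf, Jet.proj_germJet _ hf, Jet.proj_germJet _ hf]

theorem Jet.continuous_proj_top (k : ℕ) :
    Continuous (Jet.proj (p := p) (q := q) (M := M) (k := (k : ℕ∞)) le_top) :=
  continuous_iff_le_induced.2 (iInf_le _ k)

/-- The neighborhood filters pulled back from the finite levels are directed, because the
projections between them are continuous. Hence one finite level suffices. -/
theorem mem_nhds_jet_top {ζ : Jet p q M ⊤} {U : Set (Jet p q M ⊤)} :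
    U ∈ 𝓝 ζ ↔ ∃ (k : ℕ) (W : Set (Jet p q M (k : ℕ∞))), IsOpen W ∧
      Jet.proj le_top ζ ∈ W ∧ Jet.proj le_top ⁻¹' W ⊆ U := by
  have h : 𝓝 ζ = ⨅ k : ℕ, Filter.comap (Jet.proj (k := (k : ℕ∞)) le_top)
      (𝓝 (Jet.proj le_top ζ)) := by
    change @nhds _ (⨅ k : ℕ, TopologicalSpace.induced
      (Jet.proj (p := p) (q := q) (M := M) (k := (k : ℕ∞)) le_top) inferInstance) ζ = _
    simp only [nhds_iInf, nhds_induced]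
  constructor
  · intro hU
    rw [h, Filter.mem_iInf_of_directed] at hU
    · obtain ⟨k, hk⟩ := hU
      obtain ⟨t, ht, htU⟩ := hk
      obtain ⟨W, hWt, hW, hζ⟩ := mem_nhds_iff.1 ht
      exact ⟨k, W, hW, hζ, fun ζ' hζ' => htU (hWt hζ')⟩
    · refine directed_of_isDirected_le fun k l hkl => ?_
      have hkl' : (k : ℕ∞) ≤ l := Nat.cast_le.2 hkl
      have h1 : Jet.proj (p := p) (q := q) (M := M) (k := (k : ℕ∞)) le_top =
          Jet.proj hkl' ∘ Jet.proj le_top := by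
        funext ζ
        exact (Jet.proj_proj hkl' le_top ζ).symm
      change Filter.comap _ _ ≤ Filter.comap _ _
      rw [h1, ← Filter.comap_comap]
      refine Filter.comap_mono ?_
      rw [← Filter.tendsto_iff_comap]
      exact (Jet.continuous_proj hkl').tendsto _
  · rintro ⟨k, W, hW, hζ, hWU⟩
    exact Filter.mem_of_superset
      ((hW.preimage (Jet.continuous_proj_top k)).mem_nhds hζ) hWU

/-- `F` is, near `ζ`, a differential function. -/
def SmoothAtInf (F : Jet p q M ⊤ → ℝ) (ζ : Jet p q M ⊤) : Prop :=
  ∃ (k : ℕ) (W : Set (Jet p q M (k : ℕ∞))) (F' : Jet p q M (k : ℕ∞) → ℝ),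
    IsOpen W ∧ Jet.proj le_top ζ ∈ W ∧ (∀ η ∈ W, JetSmoothAt F' η) ∧
      ∀ ζ', Jet.proj le_top ζ' ∈ W → F ζ' = F' (Jet.proj le_top ζ')

/-- The order can be raised at will by composing with a projection, so finitely many differential
functions have a common order near a jet. -/
theorem SmoothAtInf.exists_level {F : Jet p q M ⊤ → ℝ} {ζ : Jet p q M ⊤} (h : SmoothAtInf F ζ) :
    ∃ k : ℕ, ∀ l ≥ k, ∃ (W : Set (Jet p q M (l : ℕ∞))) (F' : Jet p q M (l : ℕ∞) → ℝ),
      IsOpen W ∧ Jet.proj le_top ζ ∈ W ∧ (∀ η ∈ W, JetSmoothAt F' η) ∧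
        ∀ ζ', Jet.proj le_top ζ' ∈ W → F ζ' = F' (Jet.proj le_top ζ') := by
  obtain ⟨k, W, F', hW, hζ, hF', hFF'⟩ := h
  refine ⟨k, fun l hl => ?_⟩
  have hkl : (k : ℕ∞) ≤ l := Nat.cast_le.2 hl
  refine ⟨Jet.proj hkl ⁻¹' W, fun η => F' (Jet.proj hkl η),
    hW.preimage (Jet.continuous_proj hkl), ?_, fun η hη => (hF' _ hη).comp_proj hkl, ?_⟩
  · rwa [Set.mem_preimage, Jet.proj_proj]
  · intro ζ' hζ'
    rw [Set.mem_preimage, Jet.proj_proj] at hζ'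
    change _ = F' (Jet.proj hkl (Jet.proj le_top ζ'))
    rw [Jet.proj_proj]
    exact hFF' ζ' hζ'

theorem SmoothAtInf.eventually {F : Jet p q M ⊤ → ℝ} {ζ : Jet p q M ⊤} (h : SmoothAtInf F ζ) :
    ∀ᶠ ζ' in 𝓝 ζ, SmoothAtInf F ζ' := by
  obtain ⟨k, W, F', hW, hζ, hF', hFF'⟩ := h
  filter_upwards [(hW.preimage (Jet.continuous_proj_top k)).mem_nhds hζ] with ζ' hζ'
  exact ⟨k, W, F', hW, hζ', hF', hFF'⟩

theorem SmoothAtInf.congr {F G : Jet p q M ⊤ → ℝ} {ζ : Jet p q M ⊤} (h : SmoothAtInf F ζ)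
    (hFG : F =ᶠ[𝓝 ζ] G) : SmoothAtInf G ζ := by
  obtain ⟨k, W, hW, hζ, hWFG⟩ := mem_nhds_jet_top.1 hFG
  obtain ⟨l, hl⟩ := h.exists_level
  obtain ⟨W', F', hW', hζ', hF', hFF'⟩ := hl (max k l) (le_max_right _ _)
  have hk : (k : ℕ∞) ≤ (max k l : ℕ) := Nat.cast_le.2 (le_max_left _ _)
  refine ⟨max k l, W' ∩ Jet.proj hk ⁻¹' W, F', hW'.inter (hW.preimage (Jet.continuous_proj hk)),
    ⟨hζ', by rwa [Set.mem_preimage, Jet.proj_proj]⟩, fun η hη => hF' η hη.1, ?_⟩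
  rintro ζ₁ ⟨h1, h2⟩
  rw [Set.mem_preimage, Jet.proj_proj] at h2
  rw [← hFF' ζ₁ h1]
  exact (hWFG h2).symm

/-- `SmoothAtInf` asks for agreement at all jets over `W`, not only at those in `U`. As `U` is open,
a smaller `W` at a higher level achieves this. -/
theorem smoothOnJetInf_iff {F : Jet p q M ⊤ → ℝ} {U : Set (Jet p q M ⊤)} (hU : IsOpen U) :
    SmoothOnJetInf F U ↔ ∀ ζ ∈ U, SmoothAtInf F ζ := by
  constructor
  · intro h ζ hζ
    obtain ⟨k, W, F', hW, hζW, hF', hFF'⟩ := h ζ hζ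
    have h1 : SmoothAtInf (fun ζ' => F' (Jet.proj le_top ζ')) ζ :=
      ⟨k, W, F', hW, hζW, (smoothOnJet_iff hW).1 hF', fun _ _ => rfl⟩
    refine h1.congr ?_
    filter_upwards [hU.mem_nhds hζ, (hW.preimage (Jet.continuous_proj_top k)).mem_nhds hζW]
      with ζ' h2 h3
    exact (hFF' ζ' h2 h3).symm
  · intro h ζ hζ
    obtain ⟨k, W, F', hW, hζW, hF', hFF'⟩ := h ζ hζ
    exact ⟨k, W, F', hW, hζW, (smoothOnJet_iff hW).2 hF', fun ζ' _ h2 => hFF' ζ' h2⟩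

theorem isOpen_inter_preimage_pi {k : ℕ} {ι : Type*} [Fintype ι] {W : Set (Jet p q M (k : ℕ∞))}
    (hW : IsOpen W) {F : ι → Jet p q M (k : ℕ∞) → ℝ} (hF : ∀ a, ∀ ζ ∈ W, JetSmoothAt (F a) ζ)
    {O : Set (ι → ℝ)} (hO : IsOpen O) : IsOpen (W ∩ {ζ | (fun a => F a ζ) ∈ O}) := by
  refine isOpen_of_eventually_germJet fun c hc s hs hsW => ?_
  have hcont : ContinuousAt (fun s a => F a (germJet q (k : ℕ∞) (graphMap c s))) s :=
    continuousAt_pi.2 fun a => (hF a _ hsW.1 c hc s hs rfl).continuousAt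
  filter_upwards [(isSmoothFamily_graphMap hc hs).eventually_germJet_mem
    (isImmersionGerm_graphMap hc hs) hW hsW.1, hcont.eventually (hO.mem_nhds hsW.2)] with s' h1 h2
  exact ⟨h1, h2⟩

/-- All components are first brought to one finite order; the domain is then cut down to where their
values lie in an open set on which `g` is smooth. -/
theorem SmoothAtInf.comp {ι : Type*} [Fintype ι] {F : ι → Jet p q M ⊤ → ℝ} {ζ : Jet p q M ⊤}
    (hF : ∀ a, SmoothAtInf (F a) ζ) {g : (ι → ℝ) → ℝ}
    (hg : ∀ᶠ y in 𝓝 (fun a => F a ζ), ContDiffAt ℝ ∞ g y) :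
    SmoothAtInf (fun ζ => g fun a => F a ζ) ζ := by
  choose k hk using fun a => (hF a).exists_level
  obtain ⟨l, hl⟩ := (Set.finite_range k).bddAbove
  choose W F' hW hζ hF' hFF' using fun a => hk a l (hl ⟨a, rfl⟩)
  obtain ⟨O, hO, hOo, hζO⟩ := eventually_nhds_iff.1 hg
  have hWo : IsOpen (⋂ a, W a) := isOpen_iInter_of_finite hW
  have hWs : ∀ a, ∀ η ∈ ⋂ a, W a, JetSmoothAt (F' a) η := fun a η hη =>
    hF' a η (Set.mem_iInter.1 hη a)
  refine ⟨l, _, fun η => g fun a => F' a η, isOpen_inter_preimage_pi hWo hWs hOo,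
    ⟨Set.mem_iInter.2 hζ, ?_⟩, fun η hη => JetSmoothAt.comp (fun a => hWs a η hη.1) (hO _ hη.2), ?_⟩
  · simpa only [Set.mem_ofPred_eq, ← hFF' _ ζ (hζ _)] using hζO
  · rintro ζ' ⟨h1, -⟩
    exact congrArg g (funext fun a => hFF' a ζ' (Set.mem_iInter.1 h1 a))

theorem SmoothAtInf.mul {F G : Jet p q M ⊤ → ℝ} {ζ : Jet p q M ⊤} (hF : SmoothAtInf F ζ)
    (hG : SmoothAtInf G ζ) : SmoothAtInf (fun ζ => F ζ * G ζ) ζ := by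
  have h := SmoothAtInf.comp (F := fun b : Bool => if b then F else G) (ζ := ζ)
    (by rintro (_ | _) <;> simpa) (g := fun y => y true * y false)
    (Filter.Eventually.of_forall fun _ => ((contDiff_apply ℝ ℝ true).mul
      (contDiff_apply ℝ ℝ false)).contDiffAt)
  simpa using h

theorem SmoothAtInf.sum {ι : Type*} [Fintype ι] {F : ι → Jet p q M ⊤ → ℝ} {ζ : Jet p q M ⊤}
    (hF : ∀ a, SmoothAtInf (F a) ζ) : SmoothAtInf (fun ζ => ∑ a, F a ζ) ζ :=
  SmoothAtInf.comp hF (g := fun y => ∑ a, y a)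
    (Filter.Eventually.of_forall fun _ => (ContDiff.sum fun a _ => contDiff_apply ℝ ℝ a).contDiffAt)

theorem SmoothAtInf.continuousAt {F : Jet p q M ⊤ → ℝ} {ζ : Jet p q M ⊤} (hF : SmoothAtInf F ζ) :
    ContinuousAt F ζ := by
  obtain ⟨k, W, F', hW, hζ, hF', hFF'⟩ := hF
  rw [ContinuousAt, tendsto_nhds]
  intro O hO hζO
  rw [hFF' ζ hζ] at hζO
  have h := isOpen_inter_preimage_of_jetSmoothAt hW hF' hO
  filter_upwards [(h.preimage (Jet.continuous_proj_top k)).mem_nhds ⟨hζ, hζO⟩] with ζ' hζ'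
  rw [Set.mem_preimage, hFF' ζ' hζ'.1]
  exact hζ'.2

/-! ### Prolonged submanifolds -/

theorem jetAt_eventuallyEq {f : (Fin p → ℝ) → M} (hf : IsImmersionGerm (q := q) f) (k : ℕ∞) :
    Jet.jetAt k hf.toGerm =ᶠ[𝓝 0] fun t => germJet q k fun s => f (t + s) := by
  filter_upwards [hf.eventually_shift] with t ht
  rw [germJet_eq_mk ht]
  exact dif_pos ht

theorem tendsto_smul_zero (w : Fin p → ℝ) :
    Filter.Tendsto (fun t : ℝ => t • w) (𝓝 0) (𝓝 0) := by
  have : Continuous fun t : ℝ => t • w := by fun_prop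
  simpa using this.tendsto 0

theorem tendsto_germJet_shift {f : (Fin p → ℝ) → M} (hf : IsImmersionGerm (q := q) f) :
    Filter.Tendsto (fun t => germJet q (⊤ : ℕ∞) fun s => f (t + s)) (𝓝 0)
      (𝓝 (germJet q ⊤ f)) := by
  intro U hU
  obtain ⟨k, W, hW, hζ, hWU⟩ := mem_nhds_jet_top.1 hU
  rw [Jet.proj_germJet _ hf] at hζ
  change ∀ᶠ t in 𝓝 0, _ ∈ U
  filter_upwards [hf.eventually_shift, hf.isSmoothFamily_shift.eventually_germJet_mem hf.shift_zero
    hW (by simpa only [zero_add] using hζ)] with t h1 h2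
  refine hWU ?_
  rwa [Set.mem_preimage, Jet.proj_germJet _ h1]

theorem SmoothAtInf.differentiableAt {F : Jet p q M ⊤ → ℝ} {f : (Fin p → ℝ) → M}
    (hf : IsImmersionGerm (q := q) f) (hF : SmoothAtInf F (germJet q ⊤ f)) :
    HasFDerivAt (fun s => F (germJet q (⊤ : ℕ∞) fun t => f (s + t))) (jetDeriv F f) 0 := by
  obtain ⟨k, W, F', hW, hζ, hF', hFF'⟩ := hF
  rw [Jet.proj_germJet _ hf] at hζ
  have h1 := hasFDerivAt_jetDeriv hf (hF' _ hζ)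
  refine (h1.differentiableAt.congr_of_eventuallyEq ?_).hasFDerivAt
  filter_upwards [hf.eventually_shift, hf.isSmoothFamily_shift.eventually_germJet_mem hf.shift_zero
    hW (by simpa only [zero_add] using hζ)] with t h1 h2
  rw [hFF' _ (by rwa [Jet.proj_germJet _ h1]), Jet.proj_germJet _ h1]

theorem jetDeriv_eq_of_level {k : ℕ} {F : Jet p q M ⊤ → ℝ} {W : Set (Jet p q M (k : ℕ∞))}
    {F' : Jet p q M (k : ℕ∞) → ℝ} (hW : IsOpen W)
    (hFF' : ∀ ζ', Jet.proj le_top ζ' ∈ W → F ζ' = F' (Jet.proj le_top ζ'))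
    {f : (Fin p → ℝ) → M} (hf : IsImmersionGerm (q := q) f) (hζ : germJet q (k : ℕ∞) f ∈ W) :
    jetDeriv F f = jetDeriv F' f := by
  refine Filter.EventuallyEq.fderiv_eq ?_
  filter_upwards [hf.eventually_shift, hf.isSmoothFamily_shift.eventually_germJet_mem hf.shift_zero
    hW (by simpa only [zero_add] using hζ)] with t h1 h2
  rw [hFF' _ (by rwa [Jet.proj_germJet _ h1]), Jet.proj_germJet _ h1]

/-- The value of `dF` on a velocity of the prolongation of a submanifold. -/
theorem jetDiff_jetAt {F : Jet p q M ⊤ → ℝ} {f : (Fin p → ℝ) → M}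
    (hf : IsImmersionGerm (q := q) f) (hF : SmoothAtInf F (germJet q ⊤ f)) (w : Fin p → ℝ) :
    jetDiff F (fun t => Jet.jetAt ⊤ hf.toGerm (t • w)) = jetDeriv F f w := by
  have h1 : HasDerivAt (fun t : ℝ => t • w) w 0 := by
    simpa using (hasDerivAt_id (0 : ℝ)).smul_const w
  have h2 := HasFDerivAt.comp_hasDerivAt (0 : ℝ) (by
    rw [zero_smul]; exact SmoothAtInf.differentiableAt hf hF) h1
  refine (h2.congr_of_eventuallyEq ?_).deriv
  filter_upwards [(tendsto_smul_zero w).eventually (jetAt_eventuallyEq hf ⊤)] with t ht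
  rw [ht]
  rfl

theorem mem_graphJets_iff {c : OpenPartialHomeomorph M (Coord p q)} {ζ : Jet p q M ⊤} :
    ζ ∈ graphJets c ↔ ∃ f, IsImmersionGerm (q := q) f ∧ germJet q ⊤ f = ζ ∧ IsGraphGerm c f := by
  constructor
  · rintro ⟨f, rfl, h1, h2⟩
    exact ⟨f.1, f.2, germJet_coe f, h1, ContinuousLinearMap.isInvertible_of_bijective h2⟩
  · rintro ⟨f, hf, rfl, h1, h2⟩
    exact ⟨hf.toGerm, (germJet_eq_mk hf).symm, h1, h2.bijective⟩

theorem germJet_mem_graphJets_iff {c : OpenPartialHomeomorph M (Coord p q)}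
    (hc : c ∈ IsManifold.maximalAtlas 𝓘(ℝ, Coord p q) ∞ M) {f : (Fin p → ℝ) → M}
    (hf : IsImmersionGerm (q := q) f) : germJet q ⊤ f ∈ graphJets c ↔ IsGraphGerm c f := by
  rw [mem_graphJets_iff]
  refine ⟨fun ⟨g, hg, h1, h2⟩ => ?_, fun h => ⟨f, hf, rfl, h⟩⟩
  refine IsGraphGerm.of_germJet_eq (k := 0) hf hg ?_ hc h2
  rw [← Jet.proj_germJet (l := ⊤) le_top hf, ← Jet.proj_germJet (l := ⊤) le_top hg, h1]

theorem proj_mem_graphJetsFin_iff {c : OpenPartialHomeomorph M (Coord p q)}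
    (hc : c ∈ IsManifold.maximalAtlas 𝓘(ℝ, Coord p q) ∞ M) (k : ℕ) {ζ : Jet p q M ⊤} :
    Jet.proj le_top ζ ∈ graphJetsFin k c ↔ ζ ∈ graphJets c := by
  obtain ⟨f, hf, rfl⟩ := exists_germJet_eq ζ
  rw [Jet.proj_germJet _ hf, germJet_mem_graphJetsFin_iff hc hf, germJet_mem_graphJets_iff hc hf]

theorem isOpen_graphJets {c : OpenPartialHomeomorph M (Coord p q)}
    (hc : c ∈ IsManifold.maximalAtlas 𝓘(ℝ, Coord p q) ∞ M) : IsOpen (graphJets (p := p) c) := by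
  have : graphJets (p := p) c = Jet.proj le_top ⁻¹' graphJetsFin 0 c := by
    ext ζ
    rw [Set.mem_preimage, proj_mem_graphJetsFin_iff hc]
  rw [this]
  exact (isOpen_graphJetsFin 0 hc).preimage (Jet.continuous_proj_top 1)

/-- The two sides use different representatives, one chosen for the infinite jet and one for its `(k
+ 1)`-jet; independence of the representative identifies them. -/
theorem totalDeriv_eq_totalDerivFin {c : OpenPartialHomeomorph M (Coord p q)}
    {k : ℕ} {F : Jet p q M ⊤ → ℝ} {W : Set (Jet p q M (k : ℕ∞))}
    (hc : c ∈ IsManifold.maximalAtlas 𝓘(ℝ, Coord p q) ∞ M)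
    {F' : Jet p q M (k : ℕ∞) → ℝ} (hW : IsOpen W) (hF' : ∀ η ∈ W, JetSmoothAt F' η)
    (hFF' : ∀ ζ', Jet.proj le_top ζ' ∈ W → F ζ' = F' (Jet.proj le_top ζ')) {ζ : Jet p q M ⊤}
    (hζ : ζ ∈ graphJets c) (hζW : Jet.proj le_top ζ ∈ W) (i : Fin p) :
    totalDeriv c i F ζ = totalDerivFin c i F' (Jet.proj le_top ζ) := by
  have hf := (Quot.out ζ).2
  have hfζ : germJet q ⊤ (Quot.out ζ).1 = ζ := by
    rw [germJet_coe]
    exact Quot.out_eq ζ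
  have hFs : SmoothAtInf F ζ := ⟨k, W, F', hW, hζW, hF', hFF'⟩
  have hfW : germJet q (k : ℕ∞) (Quot.out ζ).1 ∈ W := by
    rw [← Jet.proj_germJet (l := ⊤) le_top hf, hfζ]
    exact hζW
  have hfc : IsGraphGerm c (Quot.out ζ).1 := by
    rwa [← germJet_mem_graphJets_iff hc hf, hfζ]
  have h1 : totalDeriv c i F ζ = jetDeriv F (Quot.out ζ).1
      ((fderiv ℝ (fun s => (c ((Quot.out ζ).1 s)).1) 0).inverse (Pi.single i 1)) :=
    jetDiff_jetAt hf (by rwa [hfζ]) _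
  rw [h1, jetDeriv_eq_of_level hW hFF' hf hfW, ← totalDerivFin_germJet hf hc hfc (hF' _ hfW),
    ← Jet.proj_germJet (l := ⊤) le_top hf, hfζ]

theorem SmoothAtInf.totalDeriv {c : OpenPartialHomeomorph M (Coord p q)}
    (hc : c ∈ IsManifold.maximalAtlas 𝓘(ℝ, Coord p q) ∞ M) {F : Jet p q M ⊤ → ℝ}
    {ζ : Jet p q M ⊤} (hF : SmoothAtInf F ζ) (hζ : ζ ∈ graphJets c) (i : Fin p) :
    SmoothAtInf (totalDeriv c i F) ζ := by
  obtain ⟨k, W, F', hW, hζW, hF', hFF'⟩ := hF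
  have hk : (k : ℕ∞) ≤ (k + 1 : ℕ) := Nat.cast_le.2 (Nat.le_succ k)
  refine ⟨k + 1, graphJetsFin k c ∩ Jet.proj hk ⁻¹' W, totalDerivFin c i F',
    (isOpen_graphJetsFin k hc).inter (hW.preimage (Jet.continuous_proj hk)),
    ⟨(proj_mem_graphJetsFin_iff hc k).2 hζ, by rwa [Set.mem_preimage, Jet.proj_proj]⟩,
    fun η hη => jetSmoothAt_totalDerivFin hc i hW hF' hη.1 hη.2, ?_⟩
  rintro ζ' ⟨h1, h2⟩
  rw [Set.mem_preimage, Jet.proj_proj] at h2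
  exact totalDeriv_eq_totalDerivFin hc hW hF' hFF' ((proj_mem_graphJetsFin_iff hc k).1 h1) h2 i

theorem ContinuousLinearMap.inverse_apply_of_isInvertible {E : Type*} [NormedAddCommGroup E]
    [NormedSpace ℝ E] {L : E →L[ℝ] E} (hL : L.IsInvertible) (v : E) : L.inverse (L v) = v := by
  obtain ⟨e, rfl⟩ := hL
  simp

theorem sum_apply_inverse_single {L : (Fin p → ℝ) →L[ℝ] (Fin p → ℝ)} (hL : L.IsInvertible)
    (ℓ : (Fin p → ℝ) →L[ℝ] ℝ) (w : Fin p → ℝ) :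
    ∑ i, ℓ (L.inverse (Pi.single i 1)) * L w i = ℓ w := by
  have h1 : L w = ∑ i, L w i • (Pi.single i (1 : ℝ) : Fin p → ℝ) := by
    ext j
    simp [Finset.sum_apply, Pi.single_apply]
  calc ∑ i, ℓ (L.inverse (Pi.single i 1)) * L w i
      = ℓ (L.inverse (∑ i, L w i • (Pi.single i (1 : ℝ) : Fin p → ℝ))) := by
        simp only [map_sum, map_smul, smul_eq_mul, mul_comm]
    _ = ℓ w := by rw [← h1, ContinuousLinearMap.inverse_apply_of_isInvertible hL]

/-- `dF` agrees with `∑ (D_i F) dx^i` on prolonged submanifolds. -/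
theorem sum_totalDeriv_mul {c : OpenPartialHomeomorph M (Coord p q)}
    (hc : c ∈ IsManifold.maximalAtlas 𝓘(ℝ, Coord p q) ∞ M) {F : Jet p q M ⊤ → ℝ}
    {f : (Fin p → ℝ) → M} (hf : IsImmersionGerm (q := q) f) (hfc : IsGraphGerm c f)
    (hF : SmoothAtInf F (germJet q ⊤ f)) (w : Fin p → ℝ) :
    ∑ i, totalDeriv c i F (germJet q ⊤ f) * fderiv ℝ (fun t => (c (f t)).1) 0 w i =
      jetDeriv F f w := by
  obtain ⟨k, W, F', hW, hζW, hF', hFF'⟩ := hF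
  have hζ := (germJet_mem_graphJets_iff hc hf).2 hfc
  have h1 : ∀ i, totalDeriv c i F (germJet q ⊤ f) = jetDeriv F f
      ((fderiv ℝ (fun t => (c (f t)).1) 0).inverse (Pi.single i 1)) := by
    intro i
    rw [totalDeriv_eq_totalDerivFin hc hW hF' hFF' hζ hζW, Jet.proj_germJet _ hf]
    rw [Jet.proj_germJet _ hf] at hζW
    rw [totalDerivFin_germJet hf hc hfc (hF' _ hζW), jetDeriv_eq_of_level hW hFF' hf hζW]
  simp only [h1]
  exact sum_apply_inverse_single hfc.2 _ _

/-- The value of a horizontal form on a velocity of the prolongation of a submanifold. -/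
theorem horizontalForm_jetAt {c : OpenPartialHomeomorph M (Coord p q)}
    (hc : c ∈ IsManifold.maximalAtlas 𝓘(ℝ, Coord p q) ∞ M) {f : (Fin p → ℝ) → M}
    (hf : IsImmersionGerm (q := q) f) (hfc : f 0 ∈ c.source) (Q : Fin p → Jet p q M ⊤ → ℝ)
    (w : Fin p → ℝ) {γ : ℝ → Jet p q M ⊤}
    (hγ : γ =ᶠ[𝓝 0] fun t => germJet q ⊤ fun s => f (t • w + s)) :
    horizontalForm c Q γ =
      ∑ i, Q i (germJet q ⊤ f) * fderiv ℝ (fun t => (c (f t)).1) 0 w i := by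
  have h0 : γ 0 = germJet q ⊤ f := by
    rw [hγ.self_of_nhds]
    simp only [zero_smul, zero_add]
  unfold horizontalForm
  rw [h0]
  refine Finset.sum_congr rfl fun i _ => ?_
  congr 1
  have hd : HasFDerivAt (fun t => (c (f t)).1) (fderiv ℝ (fun t => (c (f t)).1) 0) 0 :=
    ((contDiffAt_chart_comp hc hf.1.self_of_nhds hfc).fst.differentiableAt (by simp)).hasFDerivAt
  have h1 : HasDerivAt (fun t : ℝ => t • w) w 0 := by
    simpa using (hasDerivAt_id (0 : ℝ)).smul_const w
  have h2 := hasDerivAt_pi.1 (HasFDerivAt.comp_hasDerivAt (0 : ℝ)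
    (by rw [zero_smul]; exact hd) h1) i
  refine (h2.congr_of_eventuallyEq ?_).deriv
  filter_upwards [hγ, (tendsto_smul_zero w).eventually hf.eventually_shift] with t ht h3
  rw [ht, indepVar, base_germJet h3, add_zero]
  rfl

end InfiniteJets

end

noncomputable section

set_option linter.unusedSectionVars false

/-! ### Local sections of submersions and lifts of submanifolds. -/

section Submersion

variable {p q r : ℕ} {M N : Type*}
  [TopologicalSpace M] [ChartedSpace (Coord p r) M] [IsManifold 𝓘(ℝ, Coord p r) ∞ M] [Nonempty M]
  [TopologicalSpace N] [ChartedSpace (Coord p q) N] [IsManifold 𝓘(ℝ, Coord p q) ∞ N] [Nonempty N]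
  {P : M → N}

theorem ContMDiff.smoothNear (hP : ContMDiff 𝓘(ℝ, Coord p r) 𝓘(ℝ, Coord p q) ∞ P) (D : Set M) :
    SmoothNear p r q D P := fun _ _ => Filter.Eventually.of_forall fun z => hP z

/-- A submersion has a smooth local section through every point. -/
theorem exists_local_section (hP : ContMDiff 𝓘(ℝ, Coord p r) 𝓘(ℝ, Coord p q) ∞ P) (z : M)
    (hz : Function.Surjective (mfderiv 𝓘(ℝ, Coord p r) 𝓘(ℝ, Coord p q) P z)) :
    ∃ σ : N → M, σ (P z) = z ∧ ∀ᶠ w in 𝓝 (P z),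
      ContMDiffAt 𝓘(ℝ, Coord p q) 𝓘(ℝ, Coord p r) ∞ σ w ∧ P (σ w) = w := by
  set c := chartAt (Coord p r) z with hcdef
  set d := chartAt (Coord p q) (P z) with hddef
  have hc : c ∈ IsManifold.maximalAtlas 𝓘(ℝ, Coord p r) ∞ M :=
    IsManifold.chart_mem_maximalAtlas (I := 𝓘(ℝ, Coord p r)) (n := ∞) z
  have hd : d ∈ IsManifold.maximalAtlas 𝓘(ℝ, Coord p q) ∞ N :=
    IsManifold.chart_mem_maximalAtlas (I := 𝓘(ℝ, Coord p q)) (n := ∞) (P z)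
  have hzc : z ∈ c.source := mem_chart_source _ _
  have hzd : P z ∈ d.source := mem_chart_source _ _
  let G : Coord p r → Coord p q := fun x => d (P (c.symm x))
  have hzc' : c.symm (c z) = z := c.left_inv hzc
  have hGs : ∀ᶠ x in 𝓝 (c z), P (c.symm x) ∈ d.source ∧ ContDiffAt ℝ ∞ G x := by
    refine eventually_contDiffAt_chart_comp hd (f := fun x => P (c.symm x)) ?_ (by rwa [hzc'])
    filter_upwards [c.open_target.mem_nhds (c.map_source hzc)] with x hx
    exact (hP _).comp x (contMDiffAt_symm_of_mem_maximalAtlas hc hx)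
  have hGd : fderiv ℝ G (c z) = mfderiv 𝓘(ℝ, Coord p r) 𝓘(ℝ, Coord p q) P z := by
    rw [((hP z).mdifferentiableAt (by simp)).mfderiv]
    simp only [modelWithCornersSelf_coe, Set.range_id, fderivWithin_univ]
    rfl
  obtain ⟨R, hR⟩ := LinearMap.exists_rightInverse_of_surjective
    (fderiv ℝ G (c z) : Coord p r →ₗ[ℝ] Coord p q)
    (LinearMap.range_eq_top.2 (by
      change Function.Surjective (fderiv ℝ G (c z))
      rw [hGd]; exact hz))
  let R' : Coord p q →L[ℝ] Coord p r := LinearMap.toContinuousLinearMap R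
  have hRR' : ∀ v, fderiv ℝ G (c z) (R' v) = v := fun v => DFunLike.congr_fun hR v
  -- An affine slice through the point in the direction of a right inverse of the derivative. On it
  -- `G` restricts to a map with identity derivative, and its local inverse `φ.symm` followed by `ρ`
  -- is the section in coordinates.
  let ρ : Coord p q → Coord p r := fun v => c z + R' v
  have hρ : ContDiff ℝ ∞ ρ := contDiff_const.add R'.contDiff
  have hρ0 : ρ 0 = c z := by simp [ρ]
  have hρt : Filter.Tendsto ρ (𝓝 0) (𝓝 (c z)) := by
    have := hρ.continuous.tendsto 0
    rwa [hρ0] at this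
  have hK : ∀ᶠ v in 𝓝 0, ContDiffAt ℝ ∞ (G ∘ ρ) v := by
    filter_upwards [hρt.eventually hGs] with v hv
    exact hv.2.comp v hρ.contDiffAt
  have hKd : fderiv ℝ (G ∘ ρ) 0 = ContinuousLinearMap.id ℝ (Coord p q) := by
    have h1 : HasFDerivAt ρ R' 0 := R'.hasFDerivAt.const_add (c z)
    have h2 : HasFDerivAt G (fderiv ℝ G (c z)) (ρ 0) := by
      rw [hρ0]
      exact (hGs.self_of_nhds.2.differentiableAt (by simp)).hasFDerivAt
    rw [(h2.comp 0 h1).fderiv]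
    exact ContinuousLinearMap.ext hRR'
  obtain ⟨φ, hφ0, hφ, -, hφs⟩ := exists_smooth_openPartialHomeomorph hK
    (by rw [hKd]; exact ⟨ContinuousLinearEquiv.refl ℝ _, rfl⟩)
  have hφz : φ 0 = d (P z) := by
    rw [hφ]
    simp only [Function.comp_apply, hρ0, G, hzc']
  have hzt : d (P z) ∈ φ.target := hφz ▸ φ.map_source hφ0
  have hφz' : φ.symm (d (P z)) = 0 := by rw [← hφz, φ.left_inv hφ0]
  let τ : N → Coord p r := fun w => ρ (φ.symm (d w))
  have hτz : τ (P z) = c z := by simp only [τ, hφz', hρ0]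
  have hdc : ContinuousAt d (P z) := d.continuousAt hzd
  have hτc : Filter.Tendsto τ (𝓝 (P z)) (𝓝 (c z)) := by
    refine hρt.comp ?_
    have := (φ.continuousAt_symm hzt).comp hdc
    rw [ContinuousAt, Function.comp_apply, hφz'] at this
    exact this
  refine ⟨fun w => c.symm (τ w), (congrArg c.symm hτz).trans hzc', ?_⟩
  filter_upwards [d.open_source.mem_nhds hzd, hdc.eventually (φ.open_target.mem_nhds hzt),
    hτc.eventually (c.open_target.mem_nhds (c.map_source hzc)), hτc.eventually hGs]
    with w h1 h2 h3 h4
  constructor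
  · have e1 := contMDiffAt_of_mem_maximalAtlas hd h1
    have e2 : ContDiffAt ℝ ∞ (fun y => ρ (φ.symm y)) (d w) :=
      hρ.contDiffAt.comp _ (hφs.contDiffAt (φ.open_target.mem_nhds h2))
    exact (contMDiffAt_symm_of_mem_maximalAtlas hc h3).comp w (e2.contMDiffAt.comp w e1)
  · refine d.injOn h4.1 h1 ?_
    have := φ.right_inv h2
    rw [hφ] at this
    exact this

theorem isOpenMap_of_submersion (hP : ContMDiff 𝓘(ℝ, Coord p r) 𝓘(ℝ, Coord p q) ∞ P)
    (hsub : ∀ z, Function.Surjective (mfderiv 𝓘(ℝ, Coord p r) 𝓘(ℝ, Coord p q) P z)) :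
    IsOpenMap P := by
  rw [isOpenMap_iff_nhds_le]
  intro z s hs
  obtain ⟨σ, hσz, hσ⟩ := exists_local_section hP z (hsub z)
  have hc : Filter.Tendsto σ (𝓝 (P z)) (𝓝 z) := by
    have := hσ.self_of_nhds.1.continuousAt
    rwa [ContinuousAt, hσz] at this
  filter_upwards [hσ, hc.eventually hs] with w h1 h2
  rw [← h1.2]
  exact h2

/-- Submanifolds of the target of a submersion can be lifted. -/
theorem exists_lift (hP : ContMDiff 𝓘(ℝ, Coord p r) 𝓘(ℝ, Coord p q) ∞ P)
    (hsub : ∀ z, Function.Surjective (mfderiv 𝓘(ℝ, Coord p r) 𝓘(ℝ, Coord p q) P z))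
    {h : (Fin p → ℝ) → N} (hh : IsImmersionGerm (q := q) h) {z : M} (hz : P z = h 0) :
    ∃ f, IsImmersionGerm (q := r) f ∧ f 0 = z ∧ P ∘ f =ᶠ[𝓝 0] h := by
  obtain ⟨σ, hσz, hσ⟩ := exists_local_section hP z (hsub z)
  rw [hz] at hσz hσ
  have h1 : P ∘ (σ ∘ h) =ᶠ[𝓝 0] h := by
    filter_upwards [hh.1.self_of_nhds.continuousAt.eventually hσ] with t ht
    exact ht.2
  refine ⟨σ ∘ h, IsImmersionGerm.of_comp (Ψ := P)
    (eventually_contMDiffAt_comp hh (hσ.mono fun w hw => hw.1)) (hP _) (hh.congr h1.symm),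
    hσz, h1⟩

end Submersion

/-! ### The local action and the transformations induced on `N`. -/

section Actions

variable {p q r : ℕ} {M N : Type*}
  [TopologicalSpace M] [ChartedSpace (Coord p r) M] [IsManifold 𝓘(ℝ, Coord p r) ∞ M] [Nonempty M]
  [TopologicalSpace N] [ChartedSpace (Coord p q) N] [IsManifold 𝓘(ℝ, Coord p q) ∞ N] [Nonempty N]
  {E G : Type*} [NormedAddCommGroup E] [NormedSpace ℝ E]
  [TopologicalSpace G] [ChartedSpace E G] [Group G]
  {A : LocalAction (E := E) (G := G) (E' := Coord p r) (M := M)} {P : M → N}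

theorem LocalAction.isOpen_transf_dom (g : G) : IsOpen (A.transf g).dom :=
  A.isOpen_dom.preimage (Continuous.prodMk_right g)

theorem LocalAction.smoothNear_transf (g : G) :
    SmoothNear p r r (A.transf g).dom (A.transf g).toFun := by
  intro z hz
  filter_upwards [(LocalAction.isOpen_transf_dom g).mem_nhds hz] with z' hz'
  exact (A.smooth.contMDiffAt (A.isOpen_dom.mem_nhds hz')).comp z'
    (f := fun z : M => ((g, z) : G × M)) (contMDiffAt_const.prodMk contMDiffAt_id)

/-- Applying `g⁻¹` recovers the immersion `f` near `0`. -/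
theorem LocalAction.isImmersionGerm_transf {g : G} {f : (Fin p → ℝ) → M}
    (hf : IsImmersionGerm (q := r) f) (hg : f 0 ∈ (A.transf g).dom) :
    IsImmersionGerm (q := r) ((A.transf g).toFun ∘ f) := by
  have hc := hf.1.self_of_nhds.continuousAt
  refine IsImmersionGerm.of_comp (Ψ := (A.transf g⁻¹).toFun)
    (eventually_contMDiffAt_comp hf (LocalAction.smoothNear_transf g _ hg))
    (LocalAction.smoothNear_transf g⁻¹ _ (A.inv_mem _ _ hg)).self_of_nhds (hf.congr ?_)
  filter_upwards [hc.eventually ((LocalAction.isOpen_transf_dom g).mem_nhds hg)] with t ht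
  exact (A.inv_act _ _ ht).symm

theorem LocalAction.projected_toFun (hproj : A.Projectable P) {g : G} {z : M}
    (hz : z ∈ (A.transf g).dom) :
    (A.projected P g).toFun (P z) = P ((A.transf g).toFun z) := by
  have hex : ∃ z', (g, z') ∈ A.dom ∧ P z' = P z := ⟨z, hz, rfl⟩
  obtain ⟨w', hw'⟩ := hproj g (P z)
  refine (dif_pos hex).trans ?_
  rw [hw' _ hex.choose_spec.2 hex.choose_spec.1]
  exact (hw' z rfl hz).symm

theorem LocalAction.isOpen_projected_dom
    (hP : ContMDiff 𝓘(ℝ, Coord p r) 𝓘(ℝ, Coord p q) ∞ P)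
    (hsub : ∀ z, Function.Surjective (mfderiv 𝓘(ℝ, Coord p r) 𝓘(ℝ, Coord p q) P z)) (g : G) :
    IsOpen (A.projected P g).dom :=
  isOpenMap_of_submersion hP hsub _ (LocalAction.isOpen_transf_dom (A := A) g)

/-- Near `P z` the induced transformation is `P ∘ g ∘ σ`, for a local section `σ` through a point
`z` at which `g` is defined. -/
theorem LocalAction.smoothNear_projected (hproj : A.Projectable P)
    (hP : ContMDiff 𝓘(ℝ, Coord p r) 𝓘(ℝ, Coord p q) ∞ P)
    (hsub : ∀ z, Function.Surjective (mfderiv 𝓘(ℝ, Coord p r) 𝓘(ℝ, Coord p q) P z)) (g : G) :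
    SmoothNear p q q (A.projected P g).dom (A.projected P g).toFun := by
  rintro _ ⟨z, hz, rfl⟩
  obtain ⟨σ, hσz, hσ⟩ := exists_local_section hP z (hsub z)
  have hc : Filter.Tendsto σ (𝓝 (P z)) (𝓝 z) := by
    have := hσ.self_of_nhds.1.continuousAt
    rwa [ContinuousAt, hσz] at this
  have h1 : ∀ᶠ w in 𝓝 (P z),
      (A.projected P g).toFun w = P ((A.transf g).toFun (σ w)) := by
    filter_upwards [hσ, hc.eventually ((LocalAction.isOpen_transf_dom (A := A) g).mem_nhds hz)]
      with w h2 h3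
    rw [← LocalAction.projected_toFun hproj h3, h2.2]
  filter_upwards [hσ, h1.eventually_nhds,
    hc.eventually (LocalAction.smoothNear_transf (A := A) g z hz)] with w h2 h3 h4
  exact ((hP _).comp w (h4.comp w h2.1)).congr_of_eventuallyEq h3

/-- The transformation induced by `g⁻¹` inverts the one induced by `g` on its whole domain; this is
checked on a point of the fiber where `g` is defined. -/
theorem LocalAction.isImmersionGerm_projected (hproj : A.Projectable P)
    (hP : ContMDiff 𝓘(ℝ, Coord p r) 𝓘(ℝ, Coord p q) ∞ P)
    (hsub : ∀ z, Function.Surjective (mfderiv 𝓘(ℝ, Coord p r) 𝓘(ℝ, Coord p q) P z)) {g : G}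
    {h : (Fin p → ℝ) → N} (hh : IsImmersionGerm (q := q) h) (hg : h 0 ∈ (A.projected P g).dom) :
    IsImmersionGerm (q := q) ((A.projected P g).toFun ∘ h) := by
  have hmem : ∀ w ∈ (A.projected P g).dom,
      (A.projected P g).toFun w ∈ (A.projected P g⁻¹).dom ∧
        (A.projected P g⁻¹).toFun ((A.projected P g).toFun w) = w := by
    rintro _ ⟨z, hz, rfl⟩
    rw [LocalAction.projected_toFun hproj (show z ∈ (A.transf g).dom from hz)]
    have h1 : (A.transf g).toFun z ∈ (A.transf g⁻¹).dom := A.inv_mem _ _ hz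
    refine ⟨⟨_, h1, rfl⟩, ?_⟩
    rw [LocalAction.projected_toFun hproj h1]
    exact congrArg P (A.inv_act _ _ hz)
  have hc := hh.1.self_of_nhds.continuousAt
  refine IsImmersionGerm.of_comp (Ψ := (A.projected P g⁻¹).toFun)
    (eventually_contMDiffAt_comp hh (LocalAction.smoothNear_projected hproj hP hsub g _ hg))
    (LocalAction.smoothNear_projected hproj hP hsub g⁻¹ _ (hmem _ hg).1).self_of_nhds (hh.congr ?_)
  filter_upwards [hc.eventually ((LocalAction.isOpen_projected_dom hP hsub g).mem_nhds hg)]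
    with t ht
  exact (hmem _ ht).2.symm

/-- The projection intertwines the action with the projected action. -/
theorem LocalAction.projected_comp_eventuallyEq (hproj : A.Projectable P) {g : G}
    {f : (Fin p → ℝ) → M} (hf : IsImmersionGerm (q := r) f) (hg : f 0 ∈ (A.transf g).dom) :
    (A.projected P g).toFun ∘ (P ∘ f) =ᶠ[𝓝 0] P ∘ ((A.transf g).toFun ∘ f) := by
  filter_upwards [hf.1.self_of_nhds.continuousAt.eventually
    ((LocalAction.isOpen_transf_dom g).mem_nhds hg)] with t ht
  exact LocalAction.projected_toFun hproj ht

end Actions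

end

noncomputable section

set_option linter.unusedSectionVars false

/-! ### Prolongation of maps to infinite jets. -/

section InfiniteProlongation

variable {p q r : ℕ} {M N : Type*}
  [TopologicalSpace M] [ChartedSpace (Coord p r) M] [IsManifold 𝓘(ℝ, Coord p r) ∞ M] [Nonempty M]
  [TopologicalSpace N] [ChartedSpace (Coord p q) N] [IsManifold 𝓘(ℝ, Coord p q) ∞ N] [Nonempty N]
  {D : Set M} {Φ : M → N}

/-- From order one on, the jet decides whether `Φ` immerses its submanifolds. Finite-level arguments
on `J^∞` are therefore carried out at order `k + 1` rather than `k`. -/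
theorem mem_prolongDom_of_proj (hΦ : SmoothNear p r q D Φ) {k l : ℕ∞} (hk : 1 ≤ k) (hkl : k ≤ l)
    {ζ : Jet p r M l} (hζ : Jet.proj hkl ζ ∈ prolongDom (q := q) D Φ) :
    ζ ∈ prolongDom (q := q) D Φ := by
  obtain ⟨f, hf, rfl⟩ := exists_germJet_eq ζ
  rw [Jet.proj_germJet _ hf, germJet_mem_prolongDom_iff hΦ hk hf] at hζ
  exact germJet_mem_prolongDom hf hζ.1 hζ.2

theorem one_le_natCast_succ (k : ℕ) : (1 : ℕ∞) ≤ ((k + 1 : ℕ) : ℕ∞) := by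
  exact_mod_cast Nat.succ_le_succ (Nat.zero_le k)

theorem isOpen_prolong_preimage_top (hD : IsOpen D) (hΦ : SmoothNear p r q D Φ)
    {V : Set (Jet p q N ⊤)} (hV : IsOpen V) :
    IsOpen {ζ : Jet p r M ⊤ | ζ ∈ prolongDom (q := q) D Φ ∧ prolong D Φ ζ ∈ V} := by
  rw [isOpen_iff_mem_nhds]
  rintro ζ ⟨h1, h2⟩
  obtain ⟨k, W, hW, hζW, hWV⟩ := mem_nhds_jet_top.1 (hV.mem_nhds h2)
  have hk : (k : ℕ∞) ≤ (k + 1 : ℕ) := Nat.cast_le.2 (Nat.le_succ k)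
  have hW' := isOpen_prolong_preimage (r := r) (k := k + 1) hD hΦ
    (hW.preimage (Jet.continuous_proj hk))
  refine mem_nhds_jet_top.2 ⟨k + 1, _, hW', ⟨proj_mem_prolongDom le_top h1, ?_⟩, ?_⟩
  · rwa [Set.mem_preimage, ← proj_prolong hΦ le_top h1, Jet.proj_proj]
  · rintro ζ' ⟨h3, h4⟩
    have h5 := mem_prolongDom_of_proj hΦ (one_le_natCast_succ k) le_top h3
    rw [Set.mem_preimage, ← proj_prolong hΦ le_top h5, Jet.proj_proj] at h4
    exact ⟨h5, hWV h4⟩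

theorem SmoothAtInf.comp_prolong (hD : IsOpen D) (hΦ : SmoothNear p r q D Φ)
    {F : Jet p q N ⊤ → ℝ} {ζ : Jet p r M ⊤} (hζ : ζ ∈ prolongDom (q := q) D Φ)
    (hF : SmoothAtInf F (prolong D Φ ζ)) : SmoothAtInf (fun ζ => F (prolong D Φ ζ)) ζ := by
  obtain ⟨k, hk⟩ := hF.exists_level
  obtain ⟨W, F', hW, hζW, hF', hFF'⟩ := hk (k + 1) (Nat.le_succ k)
  refine ⟨k + 1, _, fun η => F' (prolong D Φ η), isOpen_prolong_preimage (r := r) hD hΦ hW,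
    ⟨proj_mem_prolongDom le_top hζ, by rwa [← proj_prolong hΦ le_top hζ]⟩,
    fun η hη => JetSmoothAt.comp_prolong hD hΦ hη.1 (hF' _ hη.2), ?_⟩
  rintro ζ' ⟨h3, h4⟩
  have h5 := mem_prolongDom_of_proj hΦ (one_le_natCast_succ k) le_top h3
  rw [← proj_prolong hΦ le_top h5] at h4
  exact (hFF' _ h4).trans (congrArg F' (proj_prolong hΦ le_top h5))

/-- The prolongation of a prolonged submanifold. -/
theorem prolong_germJet_shift (hD : IsOpen D) (hΦ : SmoothNear p r q D Φ) {k : ℕ∞}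
    {f : (Fin p → ℝ) → M} (hf : IsImmersionGerm (q := r) f) (hfD : f 0 ∈ D)
    (hΦf : IsImmersionGerm (q := q) (Φ ∘ f)) :
    ∀ᶠ t in 𝓝 0, (germJet r k fun s => f (t + s)) ∈ prolongDom (q := q) D Φ ∧
      prolong D Φ (germJet r k fun s => f (t + s)) = germJet q k fun s => (Φ ∘ f) (t + s) := by
  filter_upwards [hf.eventually_shift, hΦf.eventually_shift,
    hf.1.self_of_nhds.continuousAt.eventually (hD.mem_nhds hfD)] with t h1 h2 h3
  have h4 : f (t + 0) ∈ D := by rwa [add_zero]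
  exact ⟨germJet_mem_prolongDom h1 h4 h2, prolong_germJet hΦ h1 h4 h2⟩

/-- Prolonging commutes with shifting the base point, so the two functions being differentiated
coincide near `0`. -/
theorem jetDeriv_comp_prolong (hD : IsOpen D) (hΦ : SmoothNear p r q D Φ) {k : ℕ∞}
    {f : (Fin p → ℝ) → M} (hf : IsImmersionGerm (q := r) f) (hfD : f 0 ∈ D)
    (hΦf : IsImmersionGerm (q := q) (Φ ∘ f)) (F : Jet p q N k → ℝ) :
    jetDeriv (fun ζ : Jet p r M k => F (prolong D Φ ζ)) f = jetDeriv F (Φ ∘ f) := by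
  refine Filter.EventuallyEq.fderiv_eq ?_
  filter_upwards [prolong_germJet_shift (k := k) hD hΦ hf hfD hΦf] with t ht
  rw [ht.2]

end InfiniteProlongation

/-! ### Values of horizontal forms on velocities of prolonged submanifolds. -/

section Forms

variable {p q : ℕ} {M : Type*} [TopologicalSpace M] [ChartedSpace (Coord p q) M]
  [IsManifold 𝓘(ℝ, Coord p q) ∞ M] [Nonempty M]

theorem jetDeriv_congr {F F' : Jet p q M ⊤ → ℝ} {f : (Fin p → ℝ) → M}
    (hf : IsImmersionGerm (q := q) f) (h : F =ᶠ[𝓝 (germJet q ⊤ f)] F') :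
    jetDeriv F f = jetDeriv F' f :=
  Filter.EventuallyEq.fderiv_eq ((tendsto_germJet_shift hf).eventually h)

theorem Jet.base_proj {k l : ℕ∞} (hkl : k ≤ l) (ζ : Jet p q M l) :
    (Jet.proj hkl ζ).base = ζ.base := by
  obtain ⟨f, hf, rfl⟩ := exists_germJet_eq ζ
  rw [Jet.proj_germJet _ hf, base_germJet hf, base_germJet hf]

theorem contMDiffAt_base_graphMap {k : ℕ} {c : OpenPartialHomeomorph M (Coord p q)}
    (hc : c ∈ IsManifold.maximalAtlas 𝓘(ℝ, Coord p q) ∞ M) {s : JetCoord p q k}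
    (hs : s ∈ jetCoordDomain k c) :
    ContMDiffAt 𝓘(ℝ, JetCoord p q k) 𝓘(ℝ, Coord p q) ∞
      (fun s => (germJet q (k : ℕ∞) (graphMap c s)).base) s := by
  have hH := isSmoothFamily_graphMap hc hs
  have h1 := hH.self_of_nhds.comp s (f := fun s => (s, 0))
    (contDiff_prodMk_left (0 : Fin p → ℝ)).contMDiff.contMDiffAt
  refine h1.congr_of_eventuallyEq ?_
  filter_upwards [hH.eventually_isImmersionGerm (isImmersionGerm_graphMap hc hs)] with s' hs'
  exact base_germJet hs'

theorem Jet.continuous_base (k : ℕ) :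
    Continuous (Jet.base (p := p) (q := q) (M := M) (k := (k : ℕ∞))) :=
  continuous_def.2 fun _ hO => isOpen_of_eventually_germJet fun _ hc _ hs hsO =>
    (contMDiffAt_base_graphMap hc hs).continuousAt.eventually (hO.mem_nhds hsO)

theorem Jet.continuous_base_top :
    Continuous (Jet.base (p := p) (q := q) (M := M) (k := ⊤)) := by
  have h : Jet.base (p := p) (q := q) (M := M) (k := ⊤) =
      Jet.base ∘ Jet.proj (k := ((0 : ℕ) : ℕ∞)) le_top := by
    funext ζ
    exact (Jet.base_proj le_top ζ).symm
  rw [h]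
  exact (Jet.continuous_base 0).comp (Jet.continuous_proj_top 0)

theorem smoothAtInf_base {h : M → ℝ} {ζ : Jet p q M ⊤}
    (hh : ∀ᶠ z in 𝓝 ζ.base, ContMDiffAt 𝓘(ℝ, Coord p q) 𝓘(ℝ, ℝ) ∞ h z) :
    SmoothAtInf (fun ζ => h ζ.base) ζ := by
  obtain ⟨O, hO, hOo, hζO⟩ := eventually_nhds_iff.1 hh
  refine ⟨0, Jet.base ⁻¹' O, fun η => h η.base, hOo.preimage (Jet.continuous_base 0), ?_, ?_,
    fun ζ' _ => congrArg h (Jet.base_proj le_top ζ').symm⟩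
  · rwa [Set.mem_preimage, Jet.base_proj]
  · rintro η hη c hc s hs rfl
    exact ((hO _ hη).comp s (contMDiffAt_base_graphMap hc hs)).contDiffAt

theorem jetDeriv_base {f : (Fin p → ℝ) → M} (hf : IsImmersionGerm (q := q) f) (h : M → ℝ) :
    jetDeriv (fun ζ : Jet p q M ⊤ => h ζ.base) f = fderiv ℝ (fun t => h (f t)) 0 := by
  refine Filter.EventuallyEq.fderiv_eq ?_
  filter_upwards [hf.eventually_shift] with t ht
  rw [base_germJet ht, add_zero]

/-- The value of the horizontal form `∑ Q_i dx^i` on the velocity `w` of the prolongation of the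
submanifold parametrized by `f`. -/
def horizontalValue (c : OpenPartialHomeomorph M (Coord p q)) (Q : Fin p → Jet p q M ⊤ → ℝ)
    (f : (Fin p → ℝ) → M) (w : Fin p → ℝ) : ℝ :=
  ∑ i, Q i (germJet q ⊤ f) * fderiv ℝ (fun t => (c (f t)).1) 0 w i

theorem horizontalValue_congr (c : OpenPartialHomeomorph M (Coord p q))
    (Q : Fin p → Jet p q M ⊤ → ℝ) {f g : (Fin p → ℝ) → M} (hf : IsImmersionGerm (q := q) f)
    (h : f =ᶠ[𝓝 0] g) (w : Fin p → ℝ) : horizontalValue c Q f w = horizontalValue c Q g w := by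
  have h1 : (fun t => (c (f t)).1) =ᶠ[𝓝 0] fun t => (c (g t)).1 :=
    h.mono fun t ht => congrArg (fun z => (c z).1) ht
  unfold horizontalValue
  rw [germJet_congr hf h, h1.fderiv_eq]

theorem horizontalForm_jetAt_smul {c : OpenPartialHomeomorph M (Coord p q)}
    (hc : c ∈ IsManifold.maximalAtlas 𝓘(ℝ, Coord p q) ∞ M) {f : (Fin p → ℝ) → M}
    (hf : IsImmersionGerm (q := q) f) (hfc : f 0 ∈ c.source) (Q : Fin p → Jet p q M ⊤ → ℝ)
    (w : Fin p → ℝ) :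
    horizontalForm c Q (fun t => Jet.jetAt ⊤ hf.toGerm (t • w)) = horizontalValue c Q f w :=
  horizontalForm_jetAt hc hf hfc Q w ((tendsto_smul_zero w).eventually (jetAt_eventuallyEq hf ⊤))

/-- The coefficients with respect to a coframe are unique. -/
theorem eq_of_sum_mul_horizontalValue {c : OpenPartialHomeomorph M (Coord p q)}
    {f : (Fin p → ℝ) → M} (hfc : IsGraphGerm c f) {Q : Fin p → Fin p → Jet p q M ⊤ → ℝ}
    (hQ : LinearIndependent ℝ fun i j => Q i j (germJet q ⊤ f)) {a b : Fin p → ℝ}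
    (h : ∀ w, ∑ j, a j * horizontalValue c (Q j) f w = ∑ j, b j * horizontalValue c (Q j) f w) :
    a = b := by
  have h1 : ∑ j, (a j - b j) • (fun i => Q j i (germJet q ⊤ f)) = 0 := by
    funext i
    -- The velocity on which `dx^j` equals `δ^j_i`; the coframe evaluated on it gives the `i`-th
    -- column of coefficients.
    obtain ⟨w, hw⟩ := hfc.2.bijective.2 (Pi.single i 1)
    have h2 : ∀ j, horizontalValue c (Q j) f w = Q j i (germJet q ⊤ f) := by
      intro j
      rw [horizontalValue, hw]
      simp [Pi.single_apply]
    have h3 := h w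
    simp only [h2] at h3
    simp only [Finset.sum_apply, Pi.smul_apply, smul_eq_mul, sub_mul, Finset.sum_sub_distrib, h3,
      sub_self, Pi.zero_apply]
  funext j
  exact sub_eq_zero.1 (Fintype.linearIndependent_iff.1 hQ _ h1 j)

end Forms

/-! ### Pulled-back forms on velocities of prolonged submanifolds. -/

section Pullback

variable {p q r : ℕ} {M N : Type*}
  [TopologicalSpace M] [ChartedSpace (Coord p r) M] [IsManifold 𝓘(ℝ, Coord p r) ∞ M] [Nonempty M]
  [TopologicalSpace N] [ChartedSpace (Coord p q) N] [IsManifold 𝓘(ℝ, Coord p q) ∞ N] [Nonempty N]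
  {D : Set M} {Φ : M → N} {d : OpenPartialHomeomorph N (Coord p q)}

theorem pullbackForm_jetAt_smul (hd : d ∈ IsManifold.maximalAtlas 𝓘(ℝ, Coord p q) ∞ N)
    (hD : IsOpen D) (hΦ : SmoothNear p r q D Φ)
    {f : (Fin p → ℝ) → M} (hf : IsImmersionGerm (q := r) f) (hfD : f 0 ∈ D)
    (hΦf : IsImmersionGerm (q := q) (Φ ∘ f)) (hfd : Φ (f 0) ∈ d.source)
    (Q : Fin p → Jet p q N ⊤ → ℝ) (w : Fin p → ℝ) :
    pullbackForm D Φ (horizontalForm d Q) (fun t => Jet.jetAt ⊤ hf.toGerm (t • w)) =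
      horizontalValue d Q (Φ ∘ f) w := by
  refine horizontalForm_jetAt hd hΦf hfd Q w ?_
  filter_upwards [(tendsto_smul_zero w).eventually (jetAt_eventuallyEq hf ⊤),
    (tendsto_smul_zero w).eventually (prolong_germJet_shift (k := ⊤) hD hΦ hf hfD hΦf)]
    with t h1 h2
  rw [h1, h2.2]

end Pullback

/-! ### Dual operators: existence, uniqueness and smoothness. -/

section Duality

variable {p q : ℕ} {M : Type*} [TopologicalSpace M] [ChartedSpace (Coord p q) M]
  [IsManifold 𝓘(ℝ, Coord p q) ∞ M] [Nonempty M]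
  {c : OpenPartialHomeomorph M (Coord p q)} {U : Set (Jet p q M ⊤)}
  {Q : Fin p → Fin p → Jet p q M ⊤ → ℝ}
  {𝒟 : Fin p → (Jet p q M ⊤ → ℝ) → Jet p q M ⊤ → ℝ}

/-- The set of jets at which `F` is a differential function is open, so duality, stated on open
sets, applies at a single jet. -/
theorem IsDual.totalDeriv_eq (h𝒟 : IsDual c U Q 𝒟) (hU : IsOpen U) {F : Jet p q M ⊤ → ℝ}
    {ζ : Jet p q M ⊤} (hζ : ζ ∈ U) (hF : SmoothAtInf F ζ) (i : Fin p) :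
    totalDeriv c i F ζ = ∑ j, 𝒟 j F ζ * Q j i ζ := by
  have hW : IsOpen (U ∩ {ζ | SmoothAtInf F ζ}) :=
    hU.inter (isOpen_iff_mem_nhds.2 fun ζ hζ => SmoothAtInf.eventually hζ)
  exact h𝒟 _ F hW Set.inter_subset_left ((smoothOnJetInf_iff hW).2 fun ζ hζ => hζ.2) ζ ⟨hζ, hF⟩ i

/-- `dF` agrees with `∑ (𝒟_j F) ω^j` on prolonged submanifolds. -/
theorem IsDual.sum_mul_horizontalValue (h𝒟 : IsDual c U Q 𝒟) (hU : IsOpen U)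
    (hc : c ∈ IsManifold.maximalAtlas 𝓘(ℝ, Coord p q) ∞ M) {F : Jet p q M ⊤ → ℝ}
    {f : (Fin p → ℝ) → M} (hf : IsImmersionGerm (q := q) f) (hfc : IsGraphGerm c f)
    (hfU : germJet q ⊤ f ∈ U) (hF : SmoothAtInf F (germJet q ⊤ f)) (w : Fin p → ℝ) :
    ∑ j, 𝒟 j F (germJet q ⊤ f) * horizontalValue c (Q j) f w = jetDeriv F f w := by
  rw [← sum_totalDeriv_mul hc hf hfc hF w]
  simp only [h𝒟.totalDeriv_eq hU hfU hF, horizontalValue, Finset.mul_sum, Finset.sum_mul]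
  rw [Finset.sum_comm]
  simp only [mul_assoc]

/-- The operators dual to a coframe. -/
def dualOperator (c : OpenPartialHomeomorph M (Coord p q)) (Q : Fin p → Fin p → Jet p q M ⊤ → ℝ)
    (j : Fin p) (F : Jet p q M ⊤ → ℝ) (ζ : Jet p q M ⊤) : ℝ :=
  ∑ i, totalDeriv c i F ζ * (Matrix.of fun a b => Q a b ζ)⁻¹ i j

theorem isUnit_det_of_linearIndependent {B : Fin p → Fin p → ℝ} (hB : LinearIndependent ℝ B) :
    IsUnit (Matrix.of B).det :=
  (Matrix.isUnit_iff_isUnit_det _).1 (Matrix.linearIndependent_rows_iff_isUnit.1 hB)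

theorem isDual_dualOperator (hQ : ∀ ζ ∈ U, LinearIndependent ℝ fun i j => Q i j ζ) :
    IsDual c U Q (dualOperator c Q) := by
  intro W F _ hWU _ ζ hζ k
  have h1 := Matrix.nonsing_inv_mul _ (isUnit_det_of_linearIndependent (hQ ζ (hWU hζ)))
  simp only [dualOperator, Finset.sum_mul, mul_assoc]
  rw [Finset.sum_comm]
  have h2 : ∀ i, ∑ j, (Matrix.of fun a b => Q a b ζ)⁻¹ i j * Q j k ζ =
      (1 : Matrix (Fin p) (Fin p) ℝ) i k := fun i => by
    rw [← h1, Matrix.mul_apply]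
    rfl
  simp only [← Finset.mul_sum, h2, Matrix.one_apply]
  simp

/-- The coefficient matrix is invertible, so duality determines the operators on differential
functions. Any dual family thereby inherits the smoothness of the explicit one. -/
theorem IsDual.eq_dualOperator (h𝒟 : IsDual c U Q 𝒟) (hU : IsOpen U)
    (hQ : ∀ ζ ∈ U, LinearIndependent ℝ fun i j => Q i j ζ) {F : Jet p q M ⊤ → ℝ}
    {ζ : Jet p q M ⊤} (hζ : ζ ∈ U) (hF : SmoothAtInf F ζ) (j : Fin p) :
    𝒟 j F ζ = dualOperator c Q j F ζ := by
  have h1 := Matrix.mul_nonsing_inv _ (isUnit_det_of_linearIndependent (hQ ζ hζ))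
  simp only [dualOperator, h𝒟.totalDeriv_eq hU hζ hF, Finset.sum_mul, mul_assoc]
  rw [Finset.sum_comm]
  have h2 : ∀ i, ∑ k, Q i k ζ * (Matrix.of fun a b => Q a b ζ)⁻¹ k j =
      (1 : Matrix (Fin p) (Fin p) ℝ) i j := fun i => by
    rw [← h1, Matrix.mul_apply]
    rfl
  simp only [← Finset.mul_sum, h2, Matrix.one_apply]
  simp

theorem contDiff_det {X : Type*} [NormedAddCommGroup X] [NormedSpace ℝ X]
    {B : X → Matrix (Fin p) (Fin p) ℝ} (hB : ∀ i j, ContDiff ℝ ∞ fun x => B x i j) :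
    ContDiff ℝ ∞ fun x => (B x).det := by
  simp only [Matrix.det_apply']
  exact ContDiff.sum fun σ _ => contDiff_const.mul (contDiff_prod fun i _ => hB _ _)

/-- The components of a covector with respect to a coframe, as functions of the coefficients. -/
def coframeComponent (j : Fin p) (y : (Fin p × Fin p) ⊕ Fin p → ℝ) : ℝ :=
  ∑ i, y (.inr i) * (Matrix.of fun a b => y (.inl (a, b)))⁻¹ i j

/-- Cramer's rule: the inverse matrix is the adjugate, polynomial in the entries, divided by the
nonvanishing determinant. -/
theorem contDiffAt_coframeComponent (j : Fin p) {y : (Fin p × Fin p) ⊕ Fin p → ℝ}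
    (hy : (Matrix.of fun a b => y (.inl (a, b))).det ≠ 0) :
    ContDiffAt ℝ ∞ (coframeComponent j) y := by
  have hdet : ContDiff ℝ ∞ fun y : (Fin p × Fin p) ⊕ Fin p → ℝ =>
      (Matrix.of fun a b => y (.inl (a, b))).det := by
    refine contDiff_det fun a b => ?_
    exact contDiff_apply ℝ ℝ (Sum.inl (a, b))
  refine ContDiffAt.sum fun i _ => (contDiff_apply ℝ ℝ (Sum.inr i)).contDiffAt.mul ?_
  simp only [Matrix.inv_def, Ring.inverse_eq_inv', Matrix.smul_apply, smul_eq_mul,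
    Matrix.adjugate_apply]
  refine (hdet.contDiffAt.inv hy).mul (ContDiff.contDiffAt (contDiff_det fun a b => ?_))
  -- The adjugate entry is the determinant with row `j` replaced by a constant unit vector.
  by_cases h : a = j
  · subst h
    simp only [Matrix.updateRow_self]
    exact contDiff_const
  · simp only [Matrix.updateRow_ne h]
    exact contDiff_apply ℝ ℝ (Sum.inl (a, b))

theorem eventually_contDiffAt_coframeComponent (j : Fin p) {y : (Fin p × Fin p) ⊕ Fin p → ℝ}
    (hy : (Matrix.of fun a b => y (.inl (a, b))).det ≠ 0) :
    ∀ᶠ y' in 𝓝 y, ContDiffAt ℝ ∞ (coframeComponent j) y' := by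
  have hdet : ContDiff ℝ ∞ fun y : (Fin p × Fin p) ⊕ Fin p → ℝ =>
      (Matrix.of fun a b => y (.inl (a, b))).det :=
    contDiff_det fun a b => contDiff_apply ℝ ℝ (Sum.inl (a, b))
  filter_upwards [hdet.continuous.continuousAt.eventually_ne hy] with y' hy'
  exact contDiffAt_coframeComponent j hy'

theorem smoothAtInf_dualOperator (hc : c ∈ IsManifold.maximalAtlas 𝓘(ℝ, Coord p q) ∞ M)
    {F : Jet p q M ⊤ → ℝ} {ζ : Jet p q M ⊤} (hζ : ζ ∈ graphJets c)
    (hQ : ∀ a b, SmoothAtInf (Q a b) ζ) (hQ' : LinearIndependent ℝ fun i j => Q i j ζ)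
    (hF : SmoothAtInf F ζ) (j : Fin p) : SmoothAtInf (dualOperator c Q j F) ζ := by
  let B : (Fin p × Fin p) ⊕ Fin p → Jet p q M ⊤ → ℝ :=
    Sum.elim (fun x => Q x.1 x.2) fun i => totalDeriv c i F
  have hB : ∀ x, SmoothAtInf (B x) ζ := by
    rintro (⟨a, b⟩ | i)
    · exact hQ a b
    · exact hF.totalDeriv hc hζ i
  exact SmoothAtInf.comp hB (eventually_contDiffAt_coframeComponent j
    (isUnit_det_of_linearIndependent hQ').ne_zero)

end Duality

end

noncomputable section

set_option linter.unusedSectionVars false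

/-! ### Invariant differentiation with respect to a contact-invariant coframe. -/

section InvariantDifferentiation

variable {p q : ℕ} {M : Type*} [TopologicalSpace M] [ChartedSpace (Coord p q) M]
  [IsManifold 𝓘(ℝ, Coord p q) ∞ M] [Nonempty M] {Γ : Type*} {τ : Γ → LocalTransf M}
  {c : OpenPartialHomeomorph M (Coord p q)} {U : Set (Jet p q M ⊤)}
  {Q : Fin p → Fin p → Jet p q M ⊤ → ℝ}
  {𝒟 : Fin p → (Jet p q M ⊤ → ℝ) → Jet p q M ⊤ → ℝ}

theorem IsContactInvariantCoframe.smoothAtInf (hQ : IsContactInvariantCoframe τ c U Q)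
    {ζ : Jet p q M ⊤} (hζ : ζ ∈ U) (i j : Fin p) : SmoothAtInf (Q i j) ζ :=
  (smoothOnJetInf_iff hQ.isOpen).1 (hQ.smooth i j) ζ hζ

theorem IsContactInvariantCoframe.isGraphGerm (hQ : IsContactInvariantCoframe τ c U Q)
    (hc : c ∈ IsManifold.maximalAtlas 𝓘(ℝ, Coord p q) ∞ M) {f : (Fin p → ℝ) → M}
    (hf : IsImmersionGerm (q := q) f) (hfU : germJet q ⊤ f ∈ U) : IsGraphGerm c f :=
  (germJet_mem_graphJets_iff hc hf).1 (hQ.subset hfU)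

/-- The coframe takes the same values on a submanifold and on its image. -/
theorem IsContactInvariantCoframe.horizontalValue_comp (hQ : IsContactInvariantCoframe τ c U Q)
    (hc : c ∈ IsManifold.maximalAtlas 𝓘(ℝ, Coord p q) ∞ M) (g : Γ)
    (hτ : IsOpen (τ g).dom) (hτ' : SmoothNear p q q (τ g).dom (τ g).toFun)
    {f : (Fin p → ℝ) → M} (hf : IsImmersionGerm (q := q) f) (hfg : f 0 ∈ (τ g).dom)
    (hgf : IsImmersionGerm (q := q) ((τ g).toFun ∘ f)) (hfU : germJet q ⊤ f ∈ U)
    (hgfU : germJet q ⊤ ((τ g).toFun ∘ f) ∈ U) (i : Fin p) (w : Fin p → ℝ) :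
    horizontalValue c (Q i) ((τ g).toFun ∘ f) w = horizontalValue c (Q i) f w := by
  have h1 := hQ.invariant g i _ hfU (germJet_mem_prolongDom hf hfg hgf)
    (by rwa [prolong_germJet hτ' hf hfg hgf]) hf.toGerm (germJet_eq_mk hf).symm w
  rwa [pullbackForm_jetAt_smul hc hτ hτ' hf hfg hgf (hQ.isGraphGerm hc hgf hgfU).1,
    horizontalForm_jetAt_smul hc hf (hQ.isGraphGerm hc hf hfU).1] at h1

/-- On `f` and on `g ∘ f` the coframe takes the same values, and `F` has the same derivative along
both because it is invariant. The expansions of these derivatives in the coframe then have equal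
coefficients. -/
theorem IsContactInvariantCoframe.isInvariantOn_dual (hQ : IsContactInvariantCoframe τ c U Q)
    (hc : c ∈ IsManifold.maximalAtlas 𝓘(ℝ, Coord p q) ∞ M) (hτ : ∀ g, IsOpen (τ g).dom)
    (hτ' : ∀ g, SmoothNear p q q (τ g).dom (τ g).toFun) (h𝒟 : IsDual c U Q 𝒟)
    {W : Set (Jet p q M ⊤)} (hW : IsOpen W) (hWU : W ⊆ U) {F : Jet p q M ⊤ → ℝ}
    (hF : SmoothOnJetInf F W) (hinv : IsInvariantOn τ F W) (i : Fin p) :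
    IsInvariantOn τ (𝒟 i F) W := by
  intro g ζ hζ hζg hgζ
  obtain ⟨f, hf, rfl, hfg, hgf⟩ := mem_prolongDom_iff.1 hζg
  rw [prolong_germJet (hτ' g) hf hfg hgf] at hgζ ⊢
  have hF' := (smoothOnJetInf_iff hW).1 hF
  refine congrFun (a := i) (eq_of_sum_mul_horizontalValue
    (a := fun j => 𝒟 j F (germJet q ⊤ ((τ g).toFun ∘ f))) (b := fun j => 𝒟 j F (germJet q ⊤ f))
    (hQ.isGraphGerm hc hf (hWU hζ)) (hQ.linearIndependent _ (hWU hζ)) fun w => ?_)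
  rw [h𝒟.sum_mul_horizontalValue hQ.isOpen hc hf (hQ.isGraphGerm hc hf (hWU hζ)) (hWU hζ)
    (hF' _ hζ)]
  have h1 := h𝒟.sum_mul_horizontalValue hQ.isOpen hc hgf (hQ.isGraphGerm hc hgf (hWU hgζ))
    (hWU hgζ) (hF' _ hgζ) w
  simp only [hQ.horizontalValue_comp hc g (hτ g) (hτ' g) hf hfg hgf (hWU hζ) (hWU hgζ)] at h1
  rw [h1]
  refine DFunLike.congr_fun (Filter.EventuallyEq.fderiv_eq ?_) w
  -- Invariance is used at all nearby points of the prolonged submanifold; these jets and their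
  -- images stay in the open set `W`.
  filter_upwards [prolong_germJet_shift (k := ⊤) (hτ g) (hτ' g) hf hfg hgf,
    (tendsto_germJet_shift hf).eventually (hW.mem_nhds hζ),
    (tendsto_germJet_shift hgf).eventually (hW.mem_nhds hgζ)] with t h2 h3 h4
  have h5 := hinv g _ h3 h2.1 (by rw [h2.2]; exact h4)
  rw [h2.2] at h5
  exact h5

end InvariantDifferentiation

/-! ### The lifted coframe and the intertwining formula. -/

section Lift

variable {p q r : ℕ} {M N : Type*}
  [TopologicalSpace M] [ChartedSpace (Coord p r) M] [IsManifold 𝓘(ℝ, Coord p r) ∞ M] [Nonempty M]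
  [TopologicalSpace N] [ChartedSpace (Coord p q) N] [IsManifold 𝓘(ℝ, Coord p q) ∞ N] [Nonempty N]
  {P : M → N} {c : OpenPartialHomeomorph M (Coord p r)} {d : OpenPartialHomeomorph N (Coord p q)}
  {V : Set (Jet p q N ⊤)} {Q : Fin p → Fin p → Jet p q N ⊤ → ℝ}

theorem smoothAtInf_component (hP : ContMDiff 𝓘(ℝ, Coord p r) 𝓘(ℝ, Coord p q) ∞ P)
    (hd : d ∈ IsManifold.maximalAtlas 𝓘(ℝ, Coord p q) ∞ N) {ζ : Jet p r M ⊤}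
    (hζ : P ζ.base ∈ d.source) (k : Fin p) :
    SmoothAtInf (fun ζ' : Jet p r M ⊤ => (d (P ζ'.base)).1 k) ζ := by
  refine smoothAtInf_base (h := fun z => (d (P z)).1 k) ?_
  filter_upwards [hP.continuous.continuousAt.eventually (d.open_source.mem_nhds hζ)] with z hz
  have h1 : ContDiff ℝ ∞ fun x : Coord p q => x.1 k :=
    (contDiff_apply ℝ ℝ k).comp contDiff_fst
  exact h1.contMDiff.contMDiffAt.comp z ((contMDiffAt_of_mem_maximalAtlas hd hz).comp z (hP z))

theorem jetDeriv_component (hP : ContMDiff 𝓘(ℝ, Coord p r) 𝓘(ℝ, Coord p q) ∞ P)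
    (hd : d ∈ IsManifold.maximalAtlas 𝓘(ℝ, Coord p q) ∞ N) {f : (Fin p → ℝ) → M}
    (hf : IsImmersionGerm (q := r) f) (hfd : P (f 0) ∈ d.source) (k : Fin p) (w : Fin p → ℝ) :
    jetDeriv (fun ζ' : Jet p r M ⊤ => (d (P ζ'.base)).1 k) f w =
      fderiv ℝ (fun t => (d ((P ∘ f) t)).1) 0 w k := by
  rw [jetDeriv_base hf fun z => (d (P z)).1 k]
  have h1 := (contDiffAt_chart_comp hd (f := P ∘ f) ((hP _).comp 0 hf.1.self_of_nhds)
    hfd).fst.differentiableAt (by simp)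
  have h2 := hasFDerivAt_pi'.1 h1.hasFDerivAt k
  exact DFunLike.congr_fun h2.fderiv w

/-- The coefficients of the lifted coframe. -/
theorem liftedCoframe_eq (hP : ContMDiff 𝓘(ℝ, Coord p r) 𝓘(ℝ, Coord p q) ∞ P)
    (hd : d ∈ IsManifold.maximalAtlas 𝓘(ℝ, Coord p q) ∞ N) {ζ : Jet p r M ⊤}
    (hζ : ζ ∈ prolongDom (q := q) Set.univ P) (hζd : P ζ.base ∈ d.source) (i j : Fin p) :
    liftedCoframe c d P Q i j ζ =
      ∑ k, Q i k (prolong Set.univ P ζ) * totalJacobian c d P ζ j k := by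
  have hPs := hP.smoothNear (p := p) Set.univ
  have hf := (Quot.out ζ).2
  have hfζ : germJet r ⊤ (Quot.out ζ).1 = ζ := by
    rw [germJet_coe]
    exact Quot.out_eq ζ
  have hPf : IsImmersionGerm (q := q) (P ∘ (Quot.out ζ).1) := by
    rw [← hfζ, germJet_mem_prolongDom_iff hPs le_top hf] at hζ
    exact hζ.2
  have hfd : P ((Quot.out ζ).1 0) ∈ d.source := by
    rwa [← base_germJet (k := ⊤) hf, hfζ]
  have h1 : liftedCoframe c d P Q i j ζ = horizontalValue d (Q i) (P ∘ (Quot.out ζ).1)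
      ((fderiv ℝ (fun s => (c ((Quot.out ζ).1 s)).1) 0).inverse (Pi.single j 1)) :=
    pullbackForm_jetAt_smul hd isOpen_univ hPs hf (Set.mem_univ _) hPf hfd (Q i) _
  rw [h1, horizontalValue]
  refine Finset.sum_congr rfl fun k _ => ?_
  -- On the velocity of `D_j` the form `dy^k` pulls back to `D_j P^k`, the entry of the total
  -- Jacobian.
  rw [← prolong_germJet hPs hf (Set.mem_univ _) hPf, hfζ, ← jetDeriv_component hP hd hf hfd]
  congr 1
  refine (jetDiff_jetAt hf ?_ _).symm
  rw [hfζ]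
  exact smoothAtInf_component hP hd hζd k

/-- On prolonged submanifolds, the lifted coframe is the pull-back of the coframe. -/
theorem horizontalValue_liftedCoframe (hP : ContMDiff 𝓘(ℝ, Coord p r) 𝓘(ℝ, Coord p q) ∞ P)
    (hc : c ∈ IsManifold.maximalAtlas 𝓘(ℝ, Coord p r) ∞ M)
    (hd : d ∈ IsManifold.maximalAtlas 𝓘(ℝ, Coord p q) ∞ N) {f : (Fin p → ℝ) → M}
    (hf : IsImmersionGerm (q := r) f) (hPf : IsImmersionGerm (q := q) (P ∘ f))
    (hfc : IsGraphGerm c f) (hfd : P (f 0) ∈ d.source) (i : Fin p) (w : Fin p → ℝ) :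
    horizontalValue c (liftedCoframe c d P Q i) f w = horizontalValue d (Q i) (P ∘ f) w := by
  have hPs := hP.smoothNear (p := p) Set.univ
  have hζ := germJet_mem_prolongDom (k := ⊤) hf (Set.mem_univ _) hPf
  have hζd : P (germJet r ⊤ f).base ∈ d.source := by rwa [base_germJet hf]
  simp only [horizontalValue, liftedCoframe_eq hP hd hζ hζd,
    prolong_germJet hPs hf (Set.mem_univ _) hPf, Finset.sum_mul]
  rw [Finset.sum_comm]
  refine Finset.sum_congr rfl fun k _ => ?_
  simp only [mul_assoc, ← Finset.mul_sum]
  congr 1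
  rw [← jetDeriv_component hP hd hf hfd,
    ← sum_totalDeriv_mul hc hf hfc (smoothAtInf_component hP hd hζd k)]
  rfl

theorem smoothAtInf_totalJacobian (hP : ContMDiff 𝓘(ℝ, Coord p r) 𝓘(ℝ, Coord p q) ∞ P)
    (hc : c ∈ IsManifold.maximalAtlas 𝓘(ℝ, Coord p r) ∞ M)
    (hd : d ∈ IsManifold.maximalAtlas 𝓘(ℝ, Coord p q) ∞ N) {ζ : Jet p r M ⊤}
    (hζ : ζ ∈ graphJets c) (hζd : P ζ.base ∈ d.source) (j k : Fin p) :
    SmoothAtInf (fun ζ => totalJacobian c d P ζ j k) ζ :=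
  (smoothAtInf_component hP hd hζd k).totalDeriv hc hζ j

theorem mem_nonsingularJets_germJet (hP : ContMDiff 𝓘(ℝ, Coord p r) 𝓘(ℝ, Coord p q) ∞ P)
    (hc : c ∈ IsManifold.maximalAtlas 𝓘(ℝ, Coord p r) ∞ M) {f : (Fin p → ℝ) → M}
    (hf : IsImmersionGerm (q := r) f) (h : germJet r ⊤ f ∈ nonsingularJets c d P V) :
    IsImmersionGerm (q := q) (P ∘ f) ∧ germJet q ⊤ (P ∘ f) ∈ V ∧ IsGraphGerm c f ∧
      P (f 0) ∈ d.source := by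
  obtain ⟨⟨h1, h2⟩, h3, h4, -⟩ := h
  have hPs := hP.smoothNear (p := p) Set.univ
  have hPf := ((germJet_mem_prolongDom_iff hPs le_top hf).1 h1).2
  rw [prolong_germJet hPs hf (Set.mem_univ _) hPf] at h2
  rw [base_germJet hf] at h4
  exact ⟨hPf, h2, (germJet_mem_graphJets_iff hc hf).1 h3, h4⟩

theorem isOpen_nonsingularJets (hP : ContMDiff 𝓘(ℝ, Coord p r) 𝓘(ℝ, Coord p q) ∞ P)
    (hc : c ∈ IsManifold.maximalAtlas 𝓘(ℝ, Coord p r) ∞ M)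
    (hd : d ∈ IsManifold.maximalAtlas 𝓘(ℝ, Coord p q) ∞ N) (hV : IsOpen V) :
    IsOpen (nonsingularJets c d P V) := by
  rw [isOpen_iff_mem_nhds]
  rintro ζ ⟨h1, h2, h3, h4⟩
  have hdet : SmoothAtInf (fun ζ => (totalJacobian c d P ζ).det) ζ := by
    refine SmoothAtInf.comp (ι := Fin p × Fin p)
      (F := fun x ζ => totalJacobian c d P ζ x.1 x.2)
      (fun x => smoothAtInf_totalJacobian hP hc hd h2 h3 _ _)
      (g := fun y => (Matrix.of fun a b => y (a, b)).det)
      (Filter.Eventually.of_forall fun y => ContDiff.contDiffAt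
        (contDiff_det fun a b => contDiff_apply ℝ ℝ (a, b)))
  filter_upwards [(isOpen_prolong_preimage_top isOpen_univ (hP.smoothNear _) hV).mem_nhds h1,
    (isOpen_graphJets hc).mem_nhds h2,
    (hP.continuous.comp Jet.continuous_base_top).continuousAt.eventually (d.open_source.mem_nhds h3),
    hdet.continuousAt.eventually_ne h4] with ζ' e1 e2 e3 e4
  exact ⟨e1, e2, e3, e4⟩

/-- The coefficient matrix of the lift factors as the matrix of the coframe at the projected jet
times the transposed total Jacobian, both invertible. -/
theorem linearIndependent_liftedCoframe (hP : ContMDiff 𝓘(ℝ, Coord p r) 𝓘(ℝ, Coord p q) ∞ P)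
    (hd : d ∈ IsManifold.maximalAtlas 𝓘(ℝ, Coord p q) ∞ N)
    (hQ : ∀ w ∈ V, LinearIndependent ℝ fun i j => Q i j w) {ζ : Jet p r M ⊤}
    (hζ : ζ ∈ nonsingularJets c d P V) :
    LinearIndependent ℝ fun i j => liftedCoframe c d P Q i j ζ := by
  obtain ⟨⟨h1, h2⟩, -, h3, h4⟩ := hζ
  have e : (Matrix.of fun i j => liftedCoframe c d P Q i j ζ) =
      (Matrix.of fun i k => Q i k (prolong Set.univ P ζ)) * (totalJacobian c d P ζ).transpose := by
    ext i j
    rw [Matrix.mul_apply]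
    exact liftedCoframe_eq hP hd h1 h3 i j
  refine (Matrix.linearIndependent_rows_iff_isUnit
    (A := Matrix.of fun i j => liftedCoframe c d P Q i j ζ)).2 ?_
  rw [e, Matrix.isUnit_iff_isUnit_det, Matrix.det_mul, Matrix.det_transpose]
  exact (isUnit_det_of_linearIndependent (hQ _ h2)).mul h4.isUnit

theorem smoothAtInf_liftedCoframe (hP : ContMDiff 𝓘(ℝ, Coord p r) 𝓘(ℝ, Coord p q) ∞ P)
    (hc : c ∈ IsManifold.maximalAtlas 𝓘(ℝ, Coord p r) ∞ M)
    (hd : d ∈ IsManifold.maximalAtlas 𝓘(ℝ, Coord p q) ∞ N) (hV : IsOpen V)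
    (hQ : ∀ i j, ∀ w ∈ V, SmoothAtInf (Q i j) w) {ζ : Jet p r M ⊤}
    (hζ : ζ ∈ nonsingularJets c d P V) (i j : Fin p) :
    SmoothAtInf (liftedCoframe c d P Q i j) ζ := by
  have h1 : SmoothAtInf
      (fun ζ => ∑ k, Q i k (prolong Set.univ P ζ) * totalJacobian c d P ζ j k) ζ :=
    SmoothAtInf.sum fun k => (SmoothAtInf.comp_prolong isOpen_univ (hP.smoothNear _) hζ.1.1
      (hQ i k _ hζ.1.2)).mul (smoothAtInf_totalJacobian hP hc hd hζ.2.1 hζ.2.2.1 j k)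
  refine h1.congr ?_
  filter_upwards [(isOpen_nonsingularJets hP hc hd hV).mem_nhds hζ] with ζ' hζ'
  exact (liftedCoframe_eq hP hd hζ'.1.1 hζ'.2.2.1 i j).symm

theorem contactEqAt_liftedCoframe (hP : ContMDiff 𝓘(ℝ, Coord p r) 𝓘(ℝ, Coord p q) ∞ P)
    (hc : c ∈ IsManifold.maximalAtlas 𝓘(ℝ, Coord p r) ∞ M)
    (hd : d ∈ IsManifold.maximalAtlas 𝓘(ℝ, Coord p q) ∞ N) {ζ : Jet p r M ⊤}
    (hζ : ζ ∈ nonsingularJets c d P V) (i : Fin p) :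
    ContactEqAt ζ (pullbackForm Set.univ P (horizontalForm d (Q i)))
      (horizontalForm c (liftedCoframe c d P Q i)) := by
  rintro f₀ rfl w
  obtain ⟨f, hf, rfl⟩ : ∃ (f : (Fin p → ℝ) → M) (hf : IsImmersionGerm (q := r) f),
      f₀ = hf.toGerm := ⟨f₀.1, f₀.2, rfl⟩
  rw [← germJet_eq_mk hf] at hζ
  obtain ⟨hPf, -, hfc, hfd⟩ := mem_nonsingularJets_germJet hP hc hf hζ
  refine (pullbackForm_jetAt_smul hd isOpen_univ (hP.smoothNear _) hf (Set.mem_univ _) hPf hfd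
    (Q i) w).trans ?_
  rw [← horizontalValue_liftedCoframe hP hc hd hf hPf hfc hfd]
  exact (horizontalForm_jetAt_smul hc hf hfc.1 _ w).symm

variable {E G : Type*} [NormedAddCommGroup E] [NormedSpace ℝ E]
  [TopologicalSpace G] [ChartedSpace E G] [Group G]
  {A : LocalAction (E := E) (G := G) (E' := Coord p r) (M := M)}

/-- For invariance, both sides are moved to `N` by `horizontalValue_liftedCoframe`. There `P ∘ g ∘
f` is replaced by `[g] ∘ P ∘ f`, and the invariance of the given coframe applies. -/
theorem isContactInvariantCoframe_liftedCoframe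
    (hP : ContMDiff 𝓘(ℝ, Coord p r) 𝓘(ℝ, Coord p q) ∞ P)
    (hsub : ∀ z, Function.Surjective (mfderiv 𝓘(ℝ, Coord p r) 𝓘(ℝ, Coord p q) P z))
    (hproj : A.Projectable P) (hc : c ∈ IsManifold.maximalAtlas 𝓘(ℝ, Coord p r) ∞ M)
    (hd : d ∈ IsManifold.maximalAtlas 𝓘(ℝ, Coord p q) ∞ N)
    (hQ : IsContactInvariantCoframe (A.projected P) d V Q) :
    IsContactInvariantCoframe A.transf c (nonsingularJets c d P V) (liftedCoframe c d P Q) where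
  isOpen := isOpen_nonsingularJets hP hc hd hQ.isOpen
  subset ζ hζ := hζ.2.1
  smooth i j := (smoothOnJetInf_iff (isOpen_nonsingularJets hP hc hd hQ.isOpen)).2 fun ζ hζ =>
    smoothAtInf_liftedCoframe hP hc hd hQ.isOpen (fun i j w hw => hQ.smoothAtInf hw i j) hζ i j
  linearIndependent ζ hζ := linearIndependent_liftedCoframe hP hd hQ.linearIndependent hζ
  invariant := by
    rintro g i _ hζ hζg hgζ f₀ rfl w
    obtain ⟨f, hf, rfl⟩ : ∃ (f : (Fin p → ℝ) → M) (hf : IsImmersionGerm (q := r) f),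
        f₀ = hf.toGerm := ⟨f₀.1, f₀.2, rfl⟩
    have hτ := LocalAction.smoothNear_transf (A := A) g
    rw [← germJet_eq_mk hf] at hζ hζg hgζ
    obtain ⟨hfg, hgf⟩ := (germJet_mem_prolongDom_iff hτ le_top hf).1 hζg
    rw [prolong_germJet hτ hf hfg hgf] at hgζ
    obtain ⟨hPf, hPfV, hfc, hfd⟩ := mem_nonsingularJets_germJet hP hc hf hζ
    obtain ⟨hPgf, hPgfV, hgfc, hgfd⟩ := mem_nonsingularJets_germJet hP hc hgf hgζ
    have heq := LocalAction.projected_comp_eventuallyEq hproj hf hfg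
    have himm := hPgf.congr heq.symm
    refine (pullbackForm_jetAt_smul hc (LocalAction.isOpen_transf_dom g) hτ hf hfg hgf hgfc.1
      _ w).trans (Eq.trans ?_ (horizontalForm_jetAt_smul hc hf hfc.1 _ w).symm)
    rw [horizontalValue_liftedCoframe hP hc hd hf hPf hfc hfd,
      horizontalValue_liftedCoframe hP hc hd hgf hPgf hgfc hgfd,
      ← horizontalValue_congr d _ himm heq]
    refine hQ.horizontalValue_comp hd g (LocalAction.isOpen_projected_dom hP hsub g)
      (LocalAction.smoothNear_projected hproj hP hsub g) hPf ⟨f 0, hfg, rfl⟩ himm hPfV ?_ i w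
    rwa [germJet_congr himm heq]

/-- The dual operators are intertwined by the projection. -/
theorem IsDual.intertwine (hP : ContMDiff 𝓘(ℝ, Coord p r) 𝓘(ℝ, Coord p q) ∞ P)
    (hc : c ∈ IsManifold.maximalAtlas 𝓘(ℝ, Coord p r) ∞ M)
    (hd : d ∈ IsManifold.maximalAtlas 𝓘(ℝ, Coord p q) ∞ N)
    {Γ : Type*} {τ : Γ → LocalTransf N} (hQ : IsContactInvariantCoframe τ d V Q)
    {𝒟 : Fin p → (Jet p q N ⊤ → ℝ) → Jet p q N ⊤ → ℝ} (h𝒟 : IsDual d V Q 𝒟)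
    {𝒟' : Fin p → (Jet p r M ⊤ → ℝ) → Jet p r M ⊤ → ℝ}
    (h𝒟' : IsDual c (nonsingularJets c d P V) (liftedCoframe c d P Q) 𝒟') {ζ : Jet p r M ⊤}
    (hζ : ζ ∈ nonsingularJets c d P V) {F : Jet p q N ⊤ → ℝ}
    (hF : SmoothAtInf F (prolong Set.univ P ζ)) {F' : Jet p r M ⊤ → ℝ}
    (hF' : (fun ζ' => F (prolong Set.univ P ζ')) =ᶠ[𝓝 ζ] F') (i : Fin p) :
    𝒟' i F' ζ = 𝒟 i F (prolong Set.univ P ζ) := by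
  have hPs := hP.smoothNear (p := p) Set.univ
  -- `F'` need only agree with the lift of `F` near `ζ`. This admits the lift formed at finite
  -- order, which is known to agree with it only on the domain of the prolongation of `P`.
  have hFP := (SmoothAtInf.comp_prolong isOpen_univ hPs hζ.1.1 hF).congr hF'
  have hlin := linearIndependent_liftedCoframe hP hd hQ.linearIndependent hζ
  obtain ⟨f, hf, rfl⟩ := exists_germJet_eq ζ
  obtain ⟨hPf, hPfV, hfc, hfd⟩ := mem_nonsingularJets_germJet hP hc hf hζ
  rw [prolong_germJet hPs hf (Set.mem_univ _) hPf] at hF ⊢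
  refine congrFun (a := i) (eq_of_sum_mul_horizontalValue
    (a := fun j => 𝒟' j F' (germJet r ⊤ f)) (b := fun j => 𝒟 j F (germJet q ⊤ (P ∘ f)))
    hfc hlin fun w => ?_)
  rw [h𝒟'.sum_mul_horizontalValue (isOpen_nonsingularJets hP hc hd hQ.isOpen) hc hf hfc hζ hFP]
  simp only [horizontalValue_liftedCoframe hP hc hd hf hPf hfc hfd]
  rw [h𝒟.sum_mul_horizontalValue hQ.isOpen hd hPf (hQ.isGraphGerm hd hPf hPfV) hPfV hF,
    ← jetDeriv_congr hf hF', jetDeriv_comp_prolong isOpen_univ hPs hf (Set.mem_univ _) hPf]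

end Lift

end

noncomputable section

set_option linter.unusedSectionVars false

/-! ### Dual operators at finite order. -/

section FiniteOrder

variable {p q : ℕ} {M : Type*} [TopologicalSpace M] [ChartedSpace (Coord p q) M]
  [IsManifold 𝓘(ℝ, Coord p q) ∞ M] [Nonempty M] {c : OpenPartialHomeomorph M (Coord p q)}

/-- The operators dual to a coframe of order `l`, on differential functions of order `k < l`. -/
def dualOperatorFin {k l : ℕ} (hkl : k + 1 ≤ l) (c : OpenPartialHomeomorph M (Coord p q))
    (Q : Fin p → Fin p → Jet p q M (l : ℕ∞) → ℝ) (j : Fin p) (F : Jet p q M (k : ℕ∞) → ℝ)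
    (η : Jet p q M (l : ℕ∞)) : ℝ :=
  ∑ i, totalDerivFin c i F (Jet.proj (Nat.cast_le.2 hkl) η) *
    (Matrix.of fun a b => Q a b η)⁻¹ i j

theorem jetSmoothAt_dualOperatorFin {k l : ℕ} (hkl : k + 1 ≤ l)
    (hc : c ∈ IsManifold.maximalAtlas 𝓘(ℝ, Coord p q) ∞ M)
    {Q : Fin p → Fin p → Jet p q M (l : ℕ∞) → ℝ} {F : Jet p q M (k : ℕ∞) → ℝ}
    {W : Set (Jet p q M (k : ℕ∞))} (hW : IsOpen W) (hF : ∀ ζ ∈ W, JetSmoothAt F ζ)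
    {η : Jet p q M (l : ℕ∞)} (hη : Jet.proj (Nat.cast_le.2 hkl) η ∈ graphJetsFin k c)
    (hηW : Jet.proj (Nat.cast_le.2 ((Nat.le_succ k).trans hkl)) η ∈ W)
    (hQ : ∀ a b, JetSmoothAt (Q a b) η) (hQ' : LinearIndependent ℝ fun a b => Q a b η)
    (j : Fin p) : JetSmoothAt (dualOperatorFin hkl c Q j F) η := by
  let B : (Fin p × Fin p) ⊕ Fin p → Jet p q M (l : ℕ∞) → ℝ :=
    Sum.elim (fun x => Q x.1 x.2) fun i η => totalDerivFin c i F (Jet.proj (Nat.cast_le.2 hkl) η)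
  have hB : ∀ x, JetSmoothAt (B x) η := by
    rintro (⟨a, b⟩ | i)
    · exact hQ a b
    · refine JetSmoothAt.comp_proj _ (jetSmoothAt_totalDerivFin hc i hW hF hη ?_)
      rwa [Jet.proj_proj]
  exact JetSmoothAt.comp hB (contDiffAt_coframeComponent j
    (isUnit_det_of_linearIndependent hQ').ne_zero)

theorem smoothAtInf_comp_proj {k : ℕ} {F : Jet p q M (k : ℕ∞) → ℝ}
    {W : Set (Jet p q M (k : ℕ∞))} (hW : IsOpen W) (hF : ∀ ζ ∈ W, JetSmoothAt F ζ)
    {ζ : Jet p q M ⊤} (hζ : Jet.proj le_top ζ ∈ W) :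
    SmoothAtInf (fun ζ' => F (Jet.proj le_top ζ')) ζ :=
  ⟨k, W, F, hW, hζ, hF, fun _ _ => rfl⟩

/-- The total derivative of `F` lives at order `k + 1` and the coframe at order `l`, so the result
lives at order `l ≥ k + 1`. -/
theorem dualOperator_comp_proj {k l : ℕ} (hkl : k + 1 ≤ l)
    (hc : c ∈ IsManifold.maximalAtlas 𝓘(ℝ, Coord p q) ∞ M)
    {Q : Fin p → Fin p → Jet p q M ⊤ → ℝ} {Q' : Fin p → Fin p → Jet p q M (l : ℕ∞) → ℝ}
    {F : Jet p q M (k : ℕ∞) → ℝ} {W : Set (Jet p q M (k : ℕ∞))} (hW : IsOpen W)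
    (hF : ∀ ζ ∈ W, JetSmoothAt F ζ) {ζ : Jet p q M ⊤} (hζ : ζ ∈ graphJets c)
    (hζW : Jet.proj le_top ζ ∈ W) (hQ : ∀ a b, Q a b ζ = Q' a b (Jet.proj le_top ζ)) (j : Fin p) :
    dualOperator c Q j (fun ζ' => F (Jet.proj le_top ζ')) ζ =
      dualOperatorFin hkl c Q' j F (Jet.proj le_top ζ) := by
  unfold dualOperator dualOperatorFin
  simp only [hQ]
  refine Finset.sum_congr rfl fun i _ => ?_
  rw [totalDeriv_eq_totalDerivFin hc hW hF (fun _ _ => rfl) hζ hζW, Jet.proj_proj]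

/-- A finite jet is represented by an actual germ, which also has an infinite jet. Conditions known
on `V` can thus be read at the points of its finite-order image. -/
theorem Jet.proj_top_surjective (l : ℕ) :
    Function.Surjective (Jet.proj (p := p) (q := q) (M := M) (k := (l : ℕ∞)) le_top) := by
  intro η
  obtain ⟨f, hf, rfl⟩ := exists_germJet_eq η
  exact ⟨germJet q ⊤ f, Jet.proj_germJet _ hf⟩

end FiniteOrder

/-! ### Descent of fiberwise constant differential invariants. -/

section Descent

variable {p q r : ℕ} {M N : Type*}
  [TopologicalSpace M] [ChartedSpace (Coord p r) M] [IsManifold 𝓘(ℝ, Coord p r) ∞ M] [Nonempty M]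
  [TopologicalSpace N] [ChartedSpace (Coord p q) N] [IsManifold 𝓘(ℝ, Coord p q) ∞ N] [Nonempty N]
  {E G : Type*} [NormedAddCommGroup E] [NormedSpace ℝ E]
  [TopologicalSpace G] [ChartedSpace E G] [Group G]
  {A : LocalAction (E := E) (G := G) (E' := Coord p r) (M := M)} {P : M → N}
  {k : ℕ} {W : Set (Jet p q N (k : ℕ∞))}

theorem isOpen_prolongPreimage (hP : ContMDiff 𝓘(ℝ, Coord p r) 𝓘(ℝ, Coord p q) ∞ P)
    (hW : IsOpen W) : IsOpen (prolongPreimage (r := r) P W) :=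
  isOpen_prolong_preimage isOpen_univ (hP.smoothNear _) hW

/-- Every jet of `N` lifts to a jet of `M` over a given point of the fiber. -/
theorem exists_lift_germJet (hP : ContMDiff 𝓘(ℝ, Coord p r) 𝓘(ℝ, Coord p q) ∞ P)
    (hsub : ∀ z, Function.Surjective (mfderiv 𝓘(ℝ, Coord p r) 𝓘(ℝ, Coord p q) P z))
    {h : (Fin p → ℝ) → N} (hh : IsImmersionGerm (q := q) h) {z : M} (hz : P z = h 0)
    (k : ℕ∞) :
    ∃ f, IsImmersionGerm (q := r) f ∧ f 0 = z ∧ P ∘ f =ᶠ[𝓝 0] h ∧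
      IsImmersionGerm (q := q) (P ∘ f) ∧
      germJet r k f ∈ prolongDom (q := q) Set.univ P ∧
      prolong Set.univ P (germJet r k f) = germJet q k h := by
  obtain ⟨f, hf, hfz, hfh⟩ := exists_lift hP hsub hh hz
  have hPf := hh.congr hfh.symm
  refine ⟨f, hf, hfz, hfh, hPf, germJet_mem_prolongDom hf (Set.mem_univ _) hPf, ?_⟩
  rw [prolong_germJet (hP.smoothNear _) hf (Set.mem_univ _) hPf, germJet_congr hPf hfh]

theorem exists_prolongPreimage (hP : ContMDiff 𝓘(ℝ, Coord p r) 𝓘(ℝ, Coord p q) ∞ P)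
    (hsurj : Function.Surjective P)
    (hsub : ∀ z, Function.Surjective (mfderiv 𝓘(ℝ, Coord p r) 𝓘(ℝ, Coord p q) P z))
    {w : Jet p q N (k : ℕ∞)} (hw : w ∈ W) :
    ∃ ζ ∈ prolongPreimage (r := r) P W, prolong Set.univ P ζ = w := by
  obtain ⟨h, hh, rfl⟩ := exists_germJet_eq w
  obtain ⟨z, hz⟩ := hsurj (h 0)
  obtain ⟨f, -, -, -, -, h1, h2⟩ := exists_lift_germJet hP hsub hh hz k
  exact ⟨_, ⟨h1, by rwa [h2]⟩, h2⟩

/-- The prolongation of `P` intertwines the prolonged actions. -/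
theorem prolong_projected (hP : ContMDiff 𝓘(ℝ, Coord p r) 𝓘(ℝ, Coord p q) ∞ P)
    (hsub : ∀ z, Function.Surjective (mfderiv 𝓘(ℝ, Coord p r) 𝓘(ℝ, Coord p q) P z))
    (hproj : A.Projectable P) {g : G} {f : (Fin p → ℝ) → M} (hf : IsImmersionGerm (q := r) f)
    (hPf : IsImmersionGerm (q := q) (P ∘ f)) (hfg : f 0 ∈ (A.transf g).dom) (k : ℕ∞) :
    germJet q k (P ∘ f) ∈ prolongDom (q := q) (A.projected P g).dom (A.projected P g).toFun ∧
    prolong (q := q) (A.projected P g).dom (A.projected P g).toFun (germJet q k (P ∘ f)) =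
      prolong (q := q) Set.univ P (prolong (q := r) (A.transf g).dom (A.transf g).toFun (germJet r k f)) ∧
    prolong (q := r) (A.transf g).dom (A.transf g).toFun (germJet r k f) ∈
      prolongDom (q := q) Set.univ P := by
  have hgf := LocalAction.isImmersionGerm_transf hf hfg
  have hfg' : (P ∘ f) 0 ∈ (A.projected P g).dom := ⟨f 0, hfg, rfl⟩
  have hgPf := LocalAction.isImmersionGerm_projected hproj hP hsub hPf hfg'
  have heq := LocalAction.projected_comp_eventuallyEq hproj hf hfg
  have hPgf := hgPf.congr heq
  rw [prolong_germJet (LocalAction.smoothNear_projected hproj hP hsub g) hPf hfg' hgPf,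
    prolong_germJet (LocalAction.smoothNear_transf g) hf hfg hgf,
    prolong_germJet (hP.smoothNear _) hgf (Set.mem_univ _) hPgf, germJet_congr hgPf heq]
  exact ⟨germJet_mem_prolongDom hPf hfg' hgPf, rfl,
    germJet_mem_prolongDom hgf (Set.mem_univ _) hPgf⟩

theorem isInvariantOn_comp_prolong (hP : ContMDiff 𝓘(ℝ, Coord p r) 𝓘(ℝ, Coord p q) ∞ P)
    (hsub : ∀ z, Function.Surjective (mfderiv 𝓘(ℝ, Coord p r) 𝓘(ℝ, Coord p q) P z))
    (hproj : A.Projectable P) {F : Jet p q N (k : ℕ∞) → ℝ}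
    (hF : IsInvariantOn (A.projected P) F W) :
    IsInvariantOn A.transf (fun ζ => F (prolong Set.univ P ζ))
      (prolongPreimage (r := r) P W) := by
  rintro g ζ ⟨h1, h2⟩ h3 ⟨-, h5⟩
  obtain ⟨f, hf, rfl, -, hPf⟩ := mem_prolongDom_iff.1 h1
  -- At order `0` the germ `f'` for `g` may differ from the germ `f` for `P`. Only the base point of
  -- `f'` is needed, since `g` maps every immersion starting in its domain to an immersion.
  obtain ⟨f', hf', e, hf'g, -⟩ := mem_prolongDom_iff.1 h3
  have hfg : f 0 ∈ (A.transf g).dom := by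
    have := congrArg Jet.base e
    rw [base_germJet hf', base_germJet hf] at this
    rwa [← this]
  obtain ⟨e1, e2, -⟩ := prolong_projected hP hsub hproj hf hPf hfg (k : ℕ∞)
  have e3 := prolong_germJet (k := (k : ℕ∞)) (hP.smoothNear _) hf (Set.mem_univ _) hPf
  rw [e3] at h2
  rw [← e2] at h5
  have := hF g _ h2 e1 h5
  rw [e2] at this
  simp only [e3]
  exact this

/-- A function on jets of `N` is smooth if its lift is. -/
theorem jetSmoothAt_of_comp_prolong (hP : ContMDiff 𝓘(ℝ, Coord p r) 𝓘(ℝ, Coord p q) ∞ P)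
    (hsurj : Function.Surjective P)
    (hsub : ∀ z, Function.Surjective (mfderiv 𝓘(ℝ, Coord p r) 𝓘(ℝ, Coord p q) P z))
    (hW : IsOpen W) {F : Jet p q N (k : ℕ∞) → ℝ} {F' : Jet p r M (k : ℕ∞) → ℝ}
    (hF' : ∀ ζ ∈ prolongPreimage P W, JetSmoothAt F' ζ)
    (hFF' : ∀ ζ ∈ prolongPreimage P W, F (prolong Set.univ P ζ) = F' ζ)
    {w : Jet p q N (k : ℕ∞)} (hw : w ∈ W) : JetSmoothAt F w := by
  rintro c hc s₀ hs₀ rfl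
  have hH := isSmoothFamily_graphMap hc hs₀
  have himm := isImmersionGerm_graphMap hc hs₀
  obtain ⟨z, hz⟩ := hsurj (graphMap c s₀ 0)
  obtain ⟨σ, hσz, hσ⟩ := exists_local_section hP z (hsub z)
  rw [hz] at hσz hσ
  -- The family of coordinate graphs in `N` is lifted by a single local section to a smooth family
  -- in `M`, along which `F` becomes the smooth function `F'`.
  have hK := hH.comp (hσ.mono fun w hw => hw.1)
  have hlift : ∀ᶠ s in 𝓝 s₀, (P ∘ fun t => σ (graphMap c s t)) =ᶠ[𝓝 0] graphMap c s := by
    have h1 : ContinuousAt (fun s : JetCoord p q k => (s, (0 : Fin p → ℝ))) s₀ := by fun_prop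
    filter_upwards [h1.eventually
      (hH.self_of_nhds.continuousAt.eventually hσ).eventually_nhds] with s hs
    have h2 : ContinuousAt (fun t : Fin p → ℝ => (s, t)) 0 := by fun_prop
    filter_upwards [h2.eventually hs] with t ht
    exact ht.2
  have hKimm : IsImmersionGerm (q := r) fun t => σ (graphMap c s₀ t) :=
    IsImmersionGerm.of_comp (Ψ := P) hK.eventually_contMDiffAt (hP _)
      (himm.congr hlift.self_of_nhds.symm)
  have hev : ∀ᶠ s in 𝓝 s₀, germJet r (k : ℕ∞) (fun t => σ (graphMap c s t)) ∈
      prolongPreimage P W ∧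
      prolong Set.univ P (germJet r (k : ℕ∞) (fun t => σ (graphMap c s t))) =
        germJet q k (graphMap c s) := by
    filter_upwards [hlift, hK.eventually_isImmersionGerm hKimm,
      hH.eventually_isImmersionGerm himm, hH.eventually_germJet_mem himm hW hw] with s h1 h2 h3 h4
    have hPK := h3.congr h1.symm
    have e := prolong_germJet (k := (k : ℕ∞)) (hP.smoothNear _) h2 (Set.mem_univ _) hPK
    rw [germJet_congr hPK h1] at e
    exact ⟨⟨germJet_mem_prolongDom h2 (Set.mem_univ _) hPK, by rwa [e]⟩, e⟩
  refine (hK.contDiffAt_germJet hKimm (hF' _ hev.self_of_nhds.1)).congr_of_eventuallyEq ?_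
  filter_upwards [hev] with s hs
  rw [← hFF' _ hs.1, hs.2]

/-- The domain of `[g]` consists of points having some `z` in their fiber at which `g` is defined.
Lifting the germ through this `z` makes `g` act on the lift, where invariance of `F'` applies. -/
theorem isInvariantOn_of_comp_prolong (hP : ContMDiff 𝓘(ℝ, Coord p r) 𝓘(ℝ, Coord p q) ∞ P)
    (hsub : ∀ z, Function.Surjective (mfderiv 𝓘(ℝ, Coord p r) 𝓘(ℝ, Coord p q) P z))
    (hproj : A.Projectable P) {F : Jet p q N (k : ℕ∞) → ℝ} {F' : Jet p r M (k : ℕ∞) → ℝ}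
    (hF' : IsInvariantOn A.transf F' (prolongPreimage P W))
    (hFF' : ∀ ζ ∈ prolongPreimage P W, F (prolong Set.univ P ζ) = F' ζ) :
    IsInvariantOn (A.projected P) F W := by
  intro g w hw hwg hgw
  obtain ⟨h, hh, rfl, ⟨z, hzg, hz⟩, -⟩ := mem_prolongDom_iff.1 hwg
  obtain ⟨f, hf, rfl, hfh, hPf, h1, h2⟩ := exists_lift_germJet hP hsub hh hz (k : ℕ∞)
  obtain ⟨-, e2, e3⟩ := prolong_projected hP hsub hproj hf hPf hzg (k : ℕ∞)
  rw [germJet_congr hPf hfh] at e2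
  rw [e2] at hgw ⊢
  rw [← h2] at hw ⊢
  rw [hFF' _ ⟨h1, hw⟩, hFF' _ ⟨e3, hgw⟩]
  exact hF' g _ ⟨h1, hw⟩ (germJet_mem_prolongDom hf hzg
    (LocalAction.isImmersionGerm_transf hf hzg)) ⟨e3, hgw⟩

/-- The pull-back of differential invariants of the projected action. -/
def pullbackInvariants (hP : ContMDiff 𝓘(ℝ, Coord p r) 𝓘(ℝ, Coord p q) ∞ P)
    (hsub : ∀ z, Function.Surjective (mfderiv 𝓘(ℝ, Coord p r) 𝓘(ℝ, Coord p q) P z))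
    (hproj : A.Projectable P) (hW : IsOpen W) :
    differentialInvariants (A.projected P) W →ₐ[ℝ]
      ↥(differentialInvariants A.transf (prolongPreimage (r := r) P W) ⊓
        fiberwiseConstant (prolong (q := q) (r := r) Set.univ P)
          (prolongPreimage (r := r) P W)) where
  toFun I := ⟨fun ζ => I.1 ⟨prolong Set.univ P ζ.1, ζ.2.2⟩, by
    constructor
    · obtain ⟨F, hF, hF', hI⟩ := I.2
      refine ⟨fun ζ => F (prolong Set.univ P ζ), ?_,
        isInvariantOn_comp_prolong hP hsub hproj hF', ?_⟩
      · rw [smoothOnJet_iff (isOpen_prolongPreimage hP hW)]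
        exact fun ζ hζ => JetSmoothAt.comp_prolong isOpen_univ (hP.smoothNear _) hζ.1
          ((smoothOnJet_iff hW).1 hF _ hζ.2)
      · rw [hI]
    · intro ζ ζ' h
      exact congrArg I.1 (Subtype.ext h)⟩
  map_one' := rfl
  map_mul' _ _ := rfl
  map_zero' := rfl
  map_add' _ _ := rfl
  commutes' _ := rfl

/-- Injectivity holds because every jet in `W` lifts. A fiberwise constant invariant descends by its
value on any lift; smoothness and invariance descend by the two preceding lemmas. -/
theorem bijective_pullbackInvariants (hP : ContMDiff 𝓘(ℝ, Coord p r) 𝓘(ℝ, Coord p q) ∞ P)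
    (hsurj : Function.Surjective P)
    (hsub : ∀ z, Function.Surjective (mfderiv 𝓘(ℝ, Coord p r) 𝓘(ℝ, Coord p q) P z))
    (hproj : A.Projectable P) (hW : IsOpen W) :
    Function.Bijective (pullbackInvariants (A := A) hP hsub hproj hW) := by
  classical
  constructor
  · intro I I' h
    refine Subtype.ext (funext fun w => ?_)
    obtain ⟨ζ, hζ, e⟩ := exists_prolongPreimage hP hsurj hsub w.2
    have h1 := congrFun (congrArg Subtype.val h) ⟨ζ, hζ⟩
    have h2 : (⟨prolong Set.univ P ζ, hζ.2⟩ : W) = w := Subtype.ext e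
    change I.1 ⟨prolong Set.univ P ζ, hζ.2⟩ = I'.1 ⟨prolong Set.univ P ζ, hζ.2⟩ at h1
    rwa [h2] at h1
  · rintro ⟨I, ⟨F', hF', hF'inv, rfl⟩, hconst⟩
    -- The value `0` is taken only off `W`, as every jet in `W` has a lift.
    let F : Jet p q N (k : ℕ∞) → ℝ := fun w =>
      if h : ∃ ζ ∈ prolongPreimage (r := r) P W, prolong Set.univ P ζ = w then F' h.choose else 0
    have hFF' : ∀ ζ ∈ prolongPreimage (r := r) P W, F (prolong Set.univ P ζ) = F' ζ := by
      intro ζ hζ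
      have h : ∃ ζ' ∈ prolongPreimage (r := r) P W,
          prolong (q := q) Set.univ P ζ' = prolong Set.univ P ζ := ⟨ζ, hζ, rfl⟩
      exact (dif_pos h).trans
        (hconst ⟨h.choose, h.choose_spec.1⟩ ⟨ζ, hζ⟩ h.choose_spec.2)
    have hF's := (smoothOnJet_iff (isOpen_prolongPreimage hP hW)).1 hF'
    refine ⟨⟨fun w => F w, F, (smoothOnJet_iff hW).2 fun w hw =>
      jetSmoothAt_of_comp_prolong hP hsurj hsub hW hF's hFF' hw,
      isInvariantOn_of_comp_prolong hP hsub hproj hF'inv hFF', rfl⟩, ?_⟩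
    exact Subtype.ext (funext fun ζ => hFF' ζ.1 ζ.2)

end Descent

end

/-! ### Assembly of the theorem. -/

theorem mainTheorem1
    {p q r : ℕ} (hp : 1 ≤ p) (hq : 1 ≤ q) (hqr : q < r)
    {M : Type*} [TopologicalSpace M] [T2Space M] [SecondCountableTopology M] [Nonempty M]
    [ChartedSpace (Coord p r) M] [IsManifold 𝓘(ℝ, Coord p r) ∞ M]
    {N : Type*} [TopologicalSpace N] [T2Space N] [SecondCountableTopology N] [Nonempty N]
    [ChartedSpace (Coord p q) N] [IsManifold 𝓘(ℝ, Coord p q) ∞ N]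
    {E : Type*} [NormedAddCommGroup E] [NormedSpace ℝ E] [FiniteDimensional ℝ E]
    {G : Type*} [TopologicalSpace G] [ChartedSpace E G] [Group G] [LieGroup 𝓘(ℝ, E) ∞ G]
    (A : LocalAction (E := E) (G := G) (E' := Coord p r) (M := M))
    (P : M → N) (hP : ContMDiff 𝓘(ℝ, Coord p r) 𝓘(ℝ, Coord p q) ∞ P)
    (hPsurj : Function.Surjective P)
    (hPsub : ∀ z, Function.Surjective (mfderiv 𝓘(ℝ, Coord p r) 𝓘(ℝ, Coord p q) P z))
    (hproj : A.Projectable P)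
    (c : OpenPartialHomeomorph M (Coord p r))
    (hc : c ∈ IsManifold.maximalAtlas 𝓘(ℝ, Coord p r) ∞ M)
    (d : OpenPartialHomeomorph N (Coord p q))
    (hd : d ∈ IsManifold.maximalAtlas 𝓘(ℝ, Coord p q) ∞ N)
    (V : Set (Jet p q N ⊤)) (Q : Fin p → Fin p → Jet p q N ⊤ → ℝ)
    (hQ : IsContactInvariantCoframe (A.projected P) d V Q)
    (𝒟 : Fin p → (Jet p q N ⊤ → ℝ) → Jet p q N ⊤ → ℝ) (h𝒟 : IsDual d V Q 𝒟) :
    -- the horizontal components of the pulled-back forms are a contact-invariant coframe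
    IsContactInvariantCoframe A.transf c (nonsingularJets c d P V) (liftedCoframe c d P Q) ∧
    (∀ i, ∀ ζ ∈ nonsingularJets c d P V,
      ContactEqAt ζ (pullbackForm Set.univ P (horizontalForm d (Q i)))
        (horizontalForm c (liftedCoframe c d P Q i))) ∧
    -- the dual operators exist
    (∃ 𝒟' : Fin p → (Jet p r M ⊤ → ℝ) → Jet p r M ⊤ → ℝ,
      IsDual c (nonsingularJets c d P V) (liftedCoframe c d P Q) 𝒟') ∧
    (∀ 𝒟' : Fin p → (Jet p r M ⊤ → ℝ) → Jet p r M ⊤ → ℝ,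
      IsDual c (nonsingularJets c d P V) (liftedCoframe c d P Q) 𝒟' →
      -- they map differential functions to differential functions, invariants to invariants
      (∀ (W : Set (Jet p r M ⊤)) (F : Jet p r M ⊤ → ℝ), IsOpen W →
        W ⊆ nonsingularJets c d P V → SmoothOnJetInf F W → ∀ i,
          SmoothOnJetInf (𝒟' i F) W ∧
          (IsInvariantOn A.transf F W → IsInvariantOn A.transf (𝒟' i F) W)) ∧
      -- the intertwining formula, for differential functions on the infinite jet bundle
      (∀ (W : Set (Jet p q N ⊤)) (F : Jet p q N ⊤ → ℝ), IsOpen W → W ⊆ V → SmoothOnJetInf F W →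
        ∀ i, ∀ ζ ∈ nonsingularJets c d P V, prolong Set.univ P ζ ∈ W →
          𝒟' i (fun ζ' => F (prolong Set.univ P ζ')) ζ = 𝒟 i F (prolong Set.univ P ζ)) ∧
      -- the intertwining formula, for differential functions of order `k` and a coframe of
      -- order at most `l`, where `k + 1 ≤ l`
      (∀ (k l : ℕ) (hkl : k + 1 ≤ l)
        (V' : Set (Jet p q N (l : ℕ∞))) (Q' : Fin p → Fin p → Jet p q N (l : ℕ∞) → ℝ),
        IsOpen V' → (∀ i j, SmoothOnJet (Q' i j) V') → V = Jet.proj le_top ⁻¹' V' →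
        (∀ i j, ∀ w ∈ V, Q i j w = Q' i j (Jet.proj le_top w)) →
        ∀ (W : Set (Jet p q N (k : ℕ∞))) (F : Jet p q N (k : ℕ∞) → ℝ), IsOpen W →
          SmoothOnJet F W →
          ∃ DF : Fin p → Jet p q N (l : ℕ∞) → ℝ, ∀ i,
            SmoothOnJet (DF i) (V' ∩
              Jet.proj (Nat.cast_le.2 ((Nat.le_succ k).trans hkl)) ⁻¹' W) ∧
            (∀ w ∈ V, Jet.proj le_top w ∈ W →
              𝒟 i (fun w' => F (Jet.proj le_top w')) w = DF i (Jet.proj le_top w)) ∧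
            (∀ ζ ∈ nonsingularJets c d P V, Jet.proj le_top ζ ∈ prolongPreimage P W →
              𝒟' i (fun ζ' => F (prolong Set.univ P (Jet.proj le_top ζ'))) ζ =
                DF i (prolong Set.univ P (Jet.proj le_top ζ))))) ∧
    -- the isomorphism with the fiber-wise constant differential invariants
    (∀ (k : ℕ) (W : Set (Jet p q N (k : ℕ∞))), IsOpen W →
      ∃ e : differentialInvariants (A.projected P) W ≃ₐ[ℝ]
          ↥(differentialInvariants A.transf (prolongPreimage (r := r) P W) ⊓
            fiberwiseConstant (prolong (q := q) (r := r) Set.univ P) (prolongPreimage (r := r) P W)),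
        ∀ (I : differentialInvariants (A.projected P) W) (ζ : prolongPreimage (r := r) P W),
          (e I).1 ζ = I.1 ⟨prolong Set.univ P ζ.1, ζ.2.2⟩) := by
  have hPs : SmoothNear p r q Set.univ P := hP.smoothNear _
  have hU := isOpen_nonsingularJets (c := c) hP hc hd hQ.isOpen
  have hQlift := isContactInvariantCoframe_liftedCoframe hP hPsub hproj hc hd hQ
  refine ⟨hQlift, fun i ζ hζ => contactEqAt_liftedCoframe hP hc hd hζ i,
    ⟨_, isDual_dualOperator hQlift.linearIndependent⟩, fun 𝒟' h𝒟' => ⟨?_, ?_, ?_⟩, ?_⟩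
  · intro W F hW hWU hF i
    have hFs := (smoothOnJetInf_iff hW).1 hF
    refine ⟨(smoothOnJetInf_iff hW).2 fun ζ hζ => ?_, fun hinv =>
      hQlift.isInvariantOn_dual hc LocalAction.isOpen_transf_dom LocalAction.smoothNear_transf h𝒟'
        hW hWU hF hinv i⟩
    -- Smoothness is proved for the explicit operator and carried over to `𝒟'`, which agrees with it
    -- near the jet by uniqueness.
    refine (smoothAtInf_dualOperator hc (hQlift.subset (hWU hζ)) (hQlift.smoothAtInf (hWU hζ))
      (hQlift.linearIndependent ζ (hWU hζ)) (hFs ζ hζ) i).congr ?_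
    filter_upwards [hW.mem_nhds hζ] with ζ' hζ'
    exact (h𝒟'.eq_dualOperator hU hQlift.linearIndependent (hWU hζ') (hFs ζ' hζ') i).symm
  · intro W F hW _ hF i ζ hζ hζW
    exact h𝒟.intertwine hP hc hd hQ h𝒟' hζ ((smoothOnJetInf_iff hW).1 hF _ hζW)
      Filter.EventuallyEq.rfl i
  · intro k l hkl V' Q' hV' hQ' hVV' hQQ' W F hW hF
    have hFs := (smoothOnJet_iff hW).1 hF
    have hk : (k : ℕ∞) ≤ l := Nat.cast_le.2 ((Nat.le_succ k).trans hkl)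
    have hdual : ∀ i, ∀ w ∈ V, Jet.proj le_top w ∈ W →
        𝒟 i (fun w' => F (Jet.proj le_top w')) w =
          dualOperatorFin hkl d Q' i F (Jet.proj le_top w) := by
      intro i w hw hwW
      rw [h𝒟.eq_dualOperator hQ.isOpen hQ.linearIndependent hw (smoothAtInf_comp_proj hW hFs hwW)]
      exact dualOperator_comp_proj hkl hd hW hFs (hQ.subset hw) hwW (fun a b => hQQ' a b w hw) i
    refine ⟨fun i => dualOperatorFin hkl d Q' i F, fun i => ⟨?_, hdual i, ?_⟩⟩
    · have hopen : IsOpen (V' ∩ Jet.proj hk ⁻¹' W) :=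
        hV'.inter (hW.preimage (Jet.continuous_proj hk))
      refine (smoothOnJet_iff hopen).2 fun η hη => ?_
      obtain ⟨w, rfl⟩ := Jet.proj_top_surjective l η
      have hw : w ∈ V := by
        rw [hVV']
        exact hη.1
      refine jetSmoothAt_dualOperatorFin hkl hd hW hFs ?_ hη.2
        (fun a b => (smoothOnJet_iff hV').1 (hQ' a b) _ hη.1) ?_ i
      · rw [Jet.proj_proj, proj_mem_graphJetsFin_iff hd]
        exact hQ.subset hw
      · simpa only [← hQQ' _ _ w hw] using hQ.linearIndependent w hw
    · intro ζ hζ hζW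
      -- Projecting and prolonging commute only on the domain of the prolongation. As
      -- `nonsingularJets` is open and contained in it, the two lifts of `F` agree near `ζ`.
      have e1 : ∀ ζ' ∈ prolongDom (q := q) Set.univ P,
          F (Jet.proj le_top (prolong Set.univ P ζ')) =
            F (prolong Set.univ P (Jet.proj le_top ζ')) := fun ζ' hζ' =>
        congrArg F (proj_prolong hPs le_top hζ')
      have hζW' : Jet.proj le_top (prolong Set.univ P ζ) ∈ W := by
        rw [proj_prolong hPs le_top hζ.1.1]
        exact hζW.2
      rw [h𝒟.intertwine hP hc hd hQ h𝒟' hζ (F := fun w => F (Jet.proj le_top w))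
        (smoothAtInf_comp_proj hW hFs hζW') (hU.mem_nhds hζ |> fun h => by
          filter_upwards [h] with ζ' hζ'
          exact e1 ζ' hζ'.1.1), hdual i _ hζ.1.2 hζW', proj_prolong hPs le_top hζ.1.1]
  · intro k W hW
    exact ⟨AlgEquiv.ofBijective _ (bijective_pullbackInvariants hP hPsurj hPsub hproj hW),
      fun I ζ => rfl⟩
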